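/- Let $p$ be a prime. Let $X_0$ be the set of isomorphism classes of finite abelian $p$-groups (that is, of finite $\mathbb{Z}_p$-modules), and $X_1$ the set of isomorphism classes of finitely generated $\mathbb{Z}_p$-modules of $\mathbb{Q}_p$-rank $1$. For $H\in X_1$ let $d(H)\in X_0$ be the quotient of $H$ by the submodule generated by a Haar-random element of $H$ (a finite group with probability one). For $G\in X_0$ let $d^{*}(G)\in X_1$ be the middle term of the extension $0\to\mathbb{Z}_p\to H\to G\to 0$ corresponding to a uniformly random element of the finite group $\mathrm{Ext}(G,\mathbb{Z}_p)$. Extend $d$ and $d^{*}$ linearly to (finite, signed, real) measures on the discrete sets $X_1$, $X_0$: $$(d\nu)(G)=\sum_{H\in X_1}\nu(H)\,\mathbb{P}(d(H)\cong G),\qquad (d^{*}\nu)(H)=\sum_{G\in X_0}\nu(G)\,\mathbb{P}(d^{*}(G)\cong H),$$ and put $\Delta_0=d\,d^{*}$, an operator on measures on $X_0$. Let $\mu_0(G)=c_0/\#\mathrm{Aut}(G)$ be the Cohen--Lenstra measure, where $c_0$ is such that $\mu_0$ is a probability measure on $X_0$. A measure $\nu$ on $X_0$ is called square-summable if $\sum_{G\in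 X_0}\nu(G)^2/\mu_0(G)<\infty$. An eigenfunction of $\Delta_0$ is a measure $\nu\neq 0$ with $\Delta_0\nu=c\,\nu$ for some $c\in\mathbb{R}$. For $F\in X_0$ let $\mathbf{Moment}[F]$ be the measure $G\mapsto \#\mathrm{Sur}(G,F)\,\mu_0(G)$, where $\mathrm{Sur}(G,F)$ is the set of surjective homomorphisms $G\to F$. Write $F'<F$ if there is a surjective homomorphism $F\to F'$ and $F'\not\cong F$. For every $F\in X_0$ there is exactly one eigenfunction $E_F$ of $\Delta_0$ with eigenvalue $1/\#F$ that has the form $$E_F=\mathbf{Moment}[F]+\sum_{F'<F}a_{F'}\,\mathbf{Moment}[F'],\qquad a_{F'}\in\mathbb{R},$$ and every square-summable eigenfunction of $\Delta_0$ either lies in $\ker(\Delta_0)$ or is a finite linear combination of the eigenfunctions $E_F$, $F\in X_0$. -/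

import Mathlib

open CategoryTheory

noncomputable section

namespace CohenLenstra

variable (p : ℕ) [Fact p.Prime]

/-! ## Isomorphism classes of modules over the `p`-adic integers -/

/-- The relation of being isomorphic, on the `ℤ_p`-modules that have the property `P`. -/
def isoSetoid (P : ModuleCat.{0} ℤ_[p] → Prop) : Setoid {M : ModuleCat.{0} ℤ_[p] // P M} where
  r M N := Nonempty (M.1 ≃ₗ[ℤ_[p]] N.1)
  iseqv :=
    { refl := fun _ => ⟨LinearEquiv.refl _ _⟩
      symm := fun ⟨e⟩ => ⟨e.symm⟩
      trans := fun ⟨e⟩ ⟨f⟩ => ⟨e.trans f⟩ }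

/-- `X₀`: isomorphism classes of finite abelian `p`-groups.  A finite `ℤ_p`-module is the same
thing as a finite abelian `p`-group: the `ℤ_p`-module structure of such a group exists, is unique,
and every additive map respects it. -/
def X0 : Type 1 := Quotient (isoSetoid p fun M => Finite M)

/-- `X₁`: isomorphism classes of finitely generated `ℤ_p`-modules `H` of rank one,
i.e. with `dim_{ℚ_p} (ℚ_p ⊗ H) = 1`. -/
def X1 : Type 1 :=
  Quotient (isoSetoid p fun M => Module.Finite ℤ_[p] M ∧ Module.finrank ℤ_[p] M = 1)

variable {p}

/-- A group in the isomorphism class `G`.  Everything below depends only on the class. -/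
def X0.rep (G : X0 p) : ModuleCat.{0} ℤ_[p] := (Quotient.out G).1

/-- A module in the isomorphism class `H`.  Everything below depends only on the class. -/
def X1.rep (H : X1 p) : ModuleCat.{0} ℤ_[p] := (Quotient.out H).1

instance X0.finite_rep (G : X0 p) : Finite G.rep := (Quotient.out G).2

instance X1.finite_rep (H : X1 p) : Module.Finite ℤ_[p] H.rep := (Quotient.out H).2.1

/-- The number of automorphisms of `G`. -/
def cardAut (G : X0 p) : ℕ := Nat.card (G.rep ≃ₗ[ℤ_[p]] G.rep)

/-- The number of surjective homomorphisms `G → F`. -/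
def cardSur (G F : X0 p) : ℕ := Nat.card {f : G.rep →ₗ[ℤ_[p]] F.rep // Function.Surjective f}

/-! ## The Cohen–Lenstra measure -/

variable (p) in
/-- The constant `c₀` that makes `μ₀` a probability measure. -/
def c0 : ℝ := (∑' G : X0 p, (cardAut G : ℝ)⁻¹)⁻¹

/-- The Cohen–Lenstra measure `μ₀(G) = c₀ / #Aut(G)`. -/
def mu0 (G : X0 p) : ℝ := c0 p / cardAut G

/-! ## The random operator `d` -/

section Haar

variable (p) (H : Type) [AddCommGroup H] [Module ℤ_[p] H] [Module.Finite ℤ_[p] H]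

/-- A finitely generated `ℤ_p`-module is compact in its `p`-adic topology, which is
its module topology. -/
theorem compactSpace_moduleTopology : @CompactSpace H (moduleTopology ℤ_[p] H) := by
  let : TopologicalSpace H := moduleTopology ℤ_[p] H
  have : IsModuleTopology ℤ_[p] H := ⟨rfl⟩
  obtain ⟨n, f, hf⟩ := Module.Finite.exists_fin' ℤ_[p] H
  have : ContinuousAdd H := IsModuleTopology.toContinuousAdd ℤ_[p] H
  exact hf.compactSpace (IsModuleTopology.continuous_of_linearMap f)

/-- The Haar probability measure on a finitely generated `ℤ_p`-module `H`, on the Borel sets of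
the `p`-adic topology. -/
def haarProb : @MeasureTheory.Measure H (@borel H (moduleTopology ℤ_[p] H)) :=
  letI : TopologicalSpace H := moduleTopology ℤ_[p] H
  haveI : IsModuleTopology ℤ_[p] H := ⟨rfl⟩
  haveI : IsTopologicalAddGroup H := IsModuleTopology.topologicalAddGroup ℤ_[p] H
  haveI : CompactSpace H := compactSpace_moduleTopology p H
  letI : MeasurableSpace H := borel H
  haveI : BorelSpace H := ⟨rfl⟩
  MeasureTheory.Measure.addHaarMeasure (⊤ : TopologicalSpace.PositiveCompacts H)

end Haar

/-- `ℙ(H → G)` for `d`: the probability that the quotient of `H` by the submodule generated by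
a Haar random element of `H` is isomorphic to `G`. -/
def probD (H : X1 p) (G : X0 p) : ℝ :=
  (haarProb p H.rep
    {h : H.rep | Nonempty ((H.rep ⧸ Submodule.span ℤ_[p] {h}) ≃ₗ[ℤ_[p]] G.rep)}).toReal

/-- The action of `d` on (signed) measures. -/
def d (ν : X1 p → ℝ) : X0 p → ℝ := fun G => ∑' H : X1 p, ν H * probD H G

/-! ## The random operator `d*` -/

/-- The extension `0 → ℤ_p → H → G → 0` with class `e ∈ Ext(G, ℤ_p)` has a middle term
isomorphic to `H`. -/
def IsMiddleTerm {G : ModuleCat.{0} ℤ_[p]}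
    (e : Abelian.Ext G (ModuleCat.of ℤ_[p] ℤ_[p]) 1) (H : ModuleCat.{0} ℤ_[p]) : Prop :=
  ∃ (f : ModuleCat.of ℤ_[p] ℤ_[p] ⟶ H) (g : H ⟶ G) (w : f ≫ g = 0)
    (hS : (ShortComplex.mk f g w).ShortExact), hS.extClass = e

/-- `ℙ(G → H)` for `d*`: the proportion of the elements of the finite group `Ext(G, ℤ_p)` whose
extension of `G` by `ℤ_p` is isomorphic to `H`. -/
def probDStar (G : X0 p) (H : X1 p) : ℝ :=
  (Nat.card {e : Abelian.Ext G.rep (ModuleCat.of ℤ_[p] ℤ_[p]) 1 // IsMiddleTerm e H.rep} : ℝ) /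
    Nat.card (Abelian.Ext G.rep (ModuleCat.of ℤ_[p] ℤ_[p]) 1)

/-- The action of `d*` on (signed) measures. -/
def dStar (ν : X0 p → ℝ) : X1 p → ℝ := fun H => ∑' G : X0 p, ν G * probDStar G H

/-! ## The Cohen–Lenstra operator and its eigenfunctions -/

/-- The Cohen–Lenstra operator `Δ₀ = d d*`, acting on (signed) measures on `X₀`.  The series
converge absolutely whenever `∑ |ν(G)| < ∞`, in particular for square-summable `ν`
(by the Cauchy–Schwarz inequality) and for linear combinations of moment measures. -/
def Delta0 (ν : X0 p → ℝ) : X0 p → ℝ := d (dStar ν)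

/-- `ν` is an eigenfunction of `Δ₀` with eigenvalue `c`. -/
def IsEigenfunction (ν : X0 p → ℝ) (c : ℝ) : Prop := ν ≠ 0 ∧ Delta0 ν = c • ν

/-- Square-summable measures: those of finite norm for `⟨ν₁, ν₂⟩ = ∑ ν₁(G) ν₂(G) / μ₀(G)`. -/
def SquareSummable (ν : X0 p → ℝ) : Prop := Summable fun G : X0 p => ν G * ν G / mu0 G

/-- The measure `Moment[F]`, whose value at `G` is `#Sur(G, F) μ₀(G)`. -/
def moment (F : X0 p) : X0 p → ℝ := fun G => cardSur G F * mu0 G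

/-- `F' < F`: there is a surjection from `F` to `F'`, and `F'` is not isomorphic to `F`. -/
def Below (F' F : X0 p) : Prop :=
  (∃ f : F.rep →ₗ[ℤ_[p]] F'.rep, Function.Surjective f) ∧ F' ≠ F

/-- The defining property of `E_F`: it is an eigenfunction of `Δ₀` with eigenvalue `1 / #F`, and
it has the form `Moment[F] + ∑_{F' < F} a_{F'} Moment[F']`, the sum being finite. -/
def IsLeadingEigenfunction (F : X0 p) (E : X0 p → ℝ) : Prop :=
  IsEigenfunction E (1 / (Nat.card F.rep : ℝ)) ∧
    E - moment F ∈ Submodule.span ℝ (moment '' {F' : X0 p | Below F' F})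

end CohenLenstra

end

noncomputable section

namespace CohenLenstra

/-! ## Counting homomorphisms and submodules -/

section Counting

variable {R : Type*} [CommRing R] {A B C M N F : Type*} [AddCommGroup A] [AddCommGroup B]
  [AddCommGroup C] [AddCommGroup M] [AddCommGroup N] [AddCommGroup F]
  [Module R A] [Module R B] [Module R C] [Module R M] [Module R N] [Module R F]

/-! Everything rests on the counts `#Sur(·, F)`. A surjection from `H / h` to `F` is a surjection
from `H` whose kernel contains `h`, an event of Haar probability `1 / #F`; so the step `d`
multiplies these counts by `1 / #F` on average (`pD_moment`). A surjection to `F` from an extension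
of `G` by `ℤ_p` sends `1 ∈ ℤ_p` to some `x` and induces a surjection `G → F / x`, and each pair of
such data arises equally often; so the step `d*` gives on average `∑ x, #Sur(G, F / x)`
(`pDStar_moment`). Together (`walk_surFun`), the averaging operator sends `#Sur(·, F)` to `(1 / #F)
∑ x, #Sur(·, F / x)`, which is triangular with diagonal entry `1 / #F` coming from `x = 0`.

The two steps are reversible with respect to the weights `1 / #Aut(G)`, because both transition
probabilities count the surjections `H → G` with cyclic kernel (`exists_reversible`). Hence `Δ₀`
acts on densities as the averaging operator (`Delta0_dens`), so it is triangular on the moment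
measures, and it also acts triangularly on the moments of a measure (`mom_Delta0`). Convergence has
to be earned: the iterated averages of `#Sur(·, F)` tend to `1`, the chance of being at the trivial
group is eventually bounded below, and reversibility turns this into finiteness of all moments
(`tsum_surFun_ne_top`). Second moments reduce to first ones, so moment measures are square-summable.

Existence and uniqueness of `E_F` is then linear algebra: proper quotients of `F` have diagonal
entries larger than `1 / #F`, so `Δ₀ - 1 / #F` is invertible on the span of the lower moment
measures.

For completeness, let `Δ₀ ν = c ν` with `c ≠ 0`. By triangularity all moments of `ν` are determined
by those for the finitely many `F` with `1 / #F = c`. The moments in turn determine `ν`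
(`eq_zero_of_mom_eq_zero`): the moments of `|ν|` for `𝔽_p ^ k` grow at most geometrically in `k`
because `c ≠ 0`, while the coefficients of Möbius inversion decay superexponentially, so the
inversion formula for `ν(K)` converges absolutely. Thus the eigenspace has dimension at most the
number of such `F`, and the corresponding `E_F` are independent elements of it (`eigen_le_span`). -/

theorem card_fiber_eq_card_ker (f : A →+ B) (a : A) :
    Nat.card {x // f x = f a} = Nat.card f.ker :=
  Nat.card_congr
    { toFun := fun x => ⟨x.1 - a, by simp [AddMonoidHom.mem_ker, x.2]⟩
      invFun := fun x => ⟨x.1 + a, by simp [(AddMonoidHom.mem_ker).1 x.2]⟩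
      left_inv := fun x => by simp
      right_inv := fun x => by simp }

theorem card_eq_card_ker_mul_card (f : A →+ B) (hf : Function.Surjective f) :
    Nat.card A = Nat.card f.ker * Nat.card B := by
  rw [AddSubgroup.card_eq_card_quotient_mul_card_addSubgroup f.ker, mul_comm,
    Nat.card_congr (QuotientAddGroup.quotientKerEquivOfSurjective f hf).toEquiv]

theorem card_eq_card_submodule_mul_card_quotient (N : Submodule R M) :
    Nat.card M = Nat.card N * Nat.card (M ⧸ N) :=
  Submodule.card_eq_card_quotient_mul_card N

/-- The surjective linear maps. -/
abbrev Sur (R : Type*) [CommRing R] (M N : Type*) [AddCommGroup M] [AddCommGroup N] [Module R M]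
    [Module R N] : Type _ := {f : M →ₗ[R] N // Function.Surjective f}

/-- Surjective linear maps between isomorphic modules. -/
def surCongr (e : M ≃ₗ[R] A) (e' : N ≃ₗ[R] B) : Sur R M N ≃ Sur R A B where
  toFun f := ⟨e'.toLinearMap ∘ₗ f.1 ∘ₗ e.symm.toLinearMap,
    e'.surjective.comp (f.2.comp e.symm.surjective)⟩
  invFun f := ⟨e'.symm.toLinearMap ∘ₗ f.1 ∘ₗ e.toLinearMap,
    e'.symm.surjective.comp (f.2.comp e.surjective)⟩
  left_inv f := by ext; simp
  right_inv f := by ext; simp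

/-- Isomorphisms from `M` to `N` are a torsor under the automorphisms of `N`. -/
def equivCongrRight (e : M ≃ₗ[R] N) : (M ≃ₗ[R] N) ≃ (N ≃ₗ[R] N) where
  toFun f := e.symm.trans f
  invFun f := e.trans f
  left_inv f := by ext; simp
  right_inv f := by ext; simp

/-- A surjective linear map is its kernel together with an identification of the quotient. -/
def surEquivSigma (M F : Type*) [AddCommGroup M] [AddCommGroup F] [Module R M] [Module R F]
    (Q : Submodule R M → Prop) :
    {f : Sur R M F // Q (LinearMap.ker f.1)} ≃
      (Σ K : {K : Submodule R M // Q K ∧ Nonempty ((M ⧸ K) ≃ₗ[R] F)}, ((M ⧸ K.1) ≃ₗ[R] F)) where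
  toFun f := ⟨⟨LinearMap.ker f.1.1, f.2, ⟨f.1.1.quotKerEquivOfSurjective f.1.2⟩⟩,
    f.1.1.quotKerEquivOfSurjective f.1.2⟩
  invFun x := ⟨⟨x.2.toLinearMap ∘ₗ x.1.1.mkQ, x.2.surjective.comp x.1.1.mkQ_surjective⟩, by
    have : LinearMap.ker (x.2.toLinearMap ∘ₗ x.1.1.mkQ) = x.1.1 := by
      rw [LinearEquiv.ker_comp, Submodule.ker_mkQ]
    rw [this]; exact x.1.2.1⟩
  left_inv f := by
    ext x
    simp
  right_inv x := by
    obtain ⟨⟨K, hK⟩, e⟩ := x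
    have hk : LinearMap.ker (e.toLinearMap ∘ₗ K.mkQ) = K := by
      rw [LinearEquiv.ker_comp, Submodule.ker_mkQ]
    -- The type of the isomorphism depends on the kernel, so the kernel is made a variable `K'` that
    -- can be substituted.
    have key : ∀ (K' : Submodule R M) (hK' : K' = K) (h1) (e' : (M ⧸ K') ≃ₗ[R] F),
        (∀ x, e' (K'.mkQ x) = e (K.mkQ x)) →
        (⟨⟨K', h1⟩, e'⟩ : (Σ K : {K : Submodule R M // Q K ∧ Nonempty ((M ⧸ K) ≃ₗ[R] F)},
          ((M ⧸ K.1) ≃ₗ[R] F))) = ⟨⟨K, hK⟩, e⟩ := by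
      rintro K' rfl h1 e' he
      congr 1
      ext x
      obtain ⟨x, rfl⟩ := K'.mkQ_surjective x
      exact he x
    exact key _ hk _ _ (fun x => rfl)

/-- The surjections with a given kernel form a torsor under `Aut(F)`. The predicate `Q` lets the
count be restricted, later to cyclic kernels. -/
theorem card_sur_ker (M F : Type*) [AddCommGroup M] [AddCommGroup F] [Module R M] [Module R F]
    (Q : Submodule R M → Prop) :
    Nat.card {f : Sur R M F // Q (LinearMap.ker f.1)} =
      Nat.card {K : Submodule R M // Q K ∧ Nonempty ((M ⧸ K) ≃ₗ[R] F)} *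
        Nat.card (F ≃ₗ[R] F) := by
  rw [← Nat.card_prod]
  refine Nat.card_congr ((surEquivSigma M F Q).trans ?_)
  refine (Equiv.sigmaCongrRight fun K => equivCongrRight K.2.2.some).trans (Equiv.sigmaEquivProd _ _)

theorem card_sur (M F : Type*) [AddCommGroup M] [AddCommGroup F] [Module R M] [Module R F] :
    Nat.card (Sur R M F) = Nat.card {K : Submodule R M // Nonempty ((M ⧸ K) ≃ₗ[R] F)} *
        Nat.card (F ≃ₗ[R] F) := by
  have h := card_sur_ker (R := R) M F (fun _ => True)
  simp only [true_and] at h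
  rw [← h]
  exact Nat.card_congr (Equiv.subtypeUnivEquiv (fun _ => trivial)).symm

/-- Surjections with a given submodule in the kernel. -/
def surQuotientEquiv (K : Submodule R M) :
    {f : Sur R M F // K ≤ LinearMap.ker f.1} ≃ Sur R (M ⧸ K) F where
  toFun f := ⟨K.liftQ f.1.1 f.2, fun y => by
    obtain ⟨x, hx⟩ := f.1.2 y
    exact ⟨K.mkQ x, by simpa using hx⟩⟩
  invFun f := ⟨⟨f.1 ∘ₗ K.mkQ, f.2.comp K.mkQ_surjective⟩, fun x hx => by
    simp [(Submodule.Quotient.mk_eq_zero K).2 hx]⟩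
  left_inv f := by ext; simp
  right_inv f := by ext x; simp

/-- Linear maps with a given submodule in the kernel. -/
def homQuotientEquiv (K : Submodule R M) :
    {f : M →ₗ[R] F // K ≤ LinearMap.ker f} ≃ ((M ⧸ K) →ₗ[R] F) where
  toFun f := K.liftQ f.1 f.2
  invFun f := ⟨f ∘ₗ K.mkQ, fun x hx => by
    simp [(Submodule.Quotient.mk_eq_zero K).2 hx]⟩
  left_inv f := by ext; simp
  right_inv f := by ext x; simp

instance finite_hom [Module.Finite R M] [Finite F] : Finite (M →ₗ[R] F) := by
  obtain ⟨n, f, hf⟩ := Module.Finite.exists_fin' R M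
  have : Finite ((Fin n → R) →ₗ[R] F) := by
    refine Finite.of_injective (fun (g : (Fin n → R) →ₗ[R] F) (i : Fin n) =>
      g (Pi.single i 1)) ?_
    intro g h hgh
    refine LinearMap.pi_ext' fun i => LinearMap.ext_ring ?_
    exact congrFun hgh i
  exact Finite.of_injective (fun g : M →ₗ[R] F => g ∘ₗ f) fun g h hgh => by
    ext x
    obtain ⟨y, rfl⟩ := hf x
    exact LinearMap.congr_fun hgh y

end Counting

/-! ## The module `ℚ_p / ℤ_p` and duality -/

/-- A homomorphism from a principal ideal `(a)` extends to the ring as soon as the image of `a` can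
be divided by `a`. -/
theorem baer_of_divisible {R M : Type*} [CommRing R] [IsPrincipalIdealRing R] [AddCommGroup M]
    [Module R M] (h : ∀ r : R, r ≠ 0 → ∀ m : M, ∃ m', r • m' = m) : Module.Baer R M := by
  intro I g
  obtain ⟨a, rfl⟩ := IsPrincipalIdealRing.principal I
  obtain rfl | ha := eq_or_ne a 0
  · refine ⟨0, fun n hn ↦ ?_⟩
    rw [Submodule.span_zero_singleton] at hn
    subst hn
    exact (map_zero g).symm
  obtain ⟨m', hm'⟩ := h a ha (g ⟨a, Submodule.mem_span_singleton_self a⟩)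
  refine ⟨LinearMap.toSpanSingleton R M m', fun n hn ↦ ?_⟩
  obtain ⟨n, rfl⟩ := Submodule.mem_span_singleton.mp hn
  rw [map_smul, LinearMap.toSpanSingleton_apply, hm', ← map_smul g, SetLike.mk_smul_mk]

section

variable (p : ℕ) [Fact p.Prime]

/-- The inclusion `ℤ_p → ℚ_p`. -/
abbrev incl : ℤ_[p] →ₗ[ℤ_[p]] ℚ_[p] := Algebra.linearMap ℤ_[p] ℚ_[p]

/-- The module `ℚ_p / ℤ_p`. -/
abbrev QZ : Type := ℚ_[p] ⧸ LinearMap.range (incl p)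

theorem padic_div (r : ℤ_[p]) (hr : r ≠ 0) (x : ℚ_[p]) : ∃ y : ℚ_[p], r • y = x :=
  ⟨(r : ℚ_[p])⁻¹ * x, by
    have : (r : ℚ_[p]) ≠ 0 := fun h => hr (Subtype.ext h)
    rw [Algebra.smul_def]
    exact mul_inv_cancel_left₀ this x⟩

theorem baer_padic : Module.Baer ℤ_[p] ℚ_[p] := baer_of_divisible (padic_div p)

theorem baer_QZ : Module.Baer ℤ_[p] (QZ p) := baer_of_divisible fun r hr m => by
  obtain ⟨x, rfl⟩ := Submodule.mkQ_surjective _ m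
  obtain ⟨y, rfl⟩ := padic_div p r hr x
  exact ⟨Submodule.mkQ _ y, (map_smul _ _ _).symm⟩

variable {p}

theorem mkQ_eq_zero_iff (x : ℚ_[p]) :
    (LinearMap.range (incl p)).mkQ x = 0 ↔ ∃ a : ℤ_[p], (a : ℚ_[p]) = x := by
  rw [Submodule.mkQ_apply, Submodule.Quotient.mk_eq_zero]
  rfl

theorem incl_injective : Function.Injective (incl p) := fun _ _ h => Subtype.ext h

/-- The number of homomorphisms from `ℤ_p / a` to `ℚ_p / ℤ_p`. -/
theorem card_hom_quotient_span (a : ℤ_[p]) (ha : a ≠ 0) :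
    Nat.card ((ℤ_[p] ⧸ Submodule.span ℤ_[p] {a}) →ₗ[ℤ_[p]] QZ p) =
      Nat.card (ℤ_[p] ⧸ Submodule.span ℤ_[p] {a}) := by
  have ha' : (a : ℚ_[p]) ≠ 0 := fun h => ha (Subtype.ext h)
  let f : ℤ_[p] →ₗ[ℤ_[p]] QZ p :=
    LinearMap.toSpanSingleton ℤ_[p] _ ((LinearMap.range (incl p)).mkQ (a : ℚ_[p])⁻¹)
  have hf : ∀ x : ℤ_[p], f x = (LinearMap.range (incl p)).mkQ ((x : ℚ_[p]) * (a : ℚ_[p])⁻¹) :=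
    fun x => by
      rw [LinearMap.toSpanSingleton_apply, ← map_smul]; rfl
  have hker : LinearMap.ker f = Submodule.span ℤ_[p] {a} := by
    ext x
    rw [LinearMap.mem_ker, hf, mkQ_eq_zero_iff, Submodule.mem_span_singleton]
    constructor
    · rintro ⟨b, hb⟩
      refine ⟨b, Subtype.ext ?_⟩
      change (b : ℚ_[p]) * a = x
      rw [hb, inv_mul_cancel_right₀ ha']
    · rintro ⟨b, rfl⟩
      refine ⟨b, ?_⟩
      change (b : ℚ_[p]) = (b : ℚ_[p]) * a * _
      rw [mul_inv_cancel_right₀ ha']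
  -- A homomorphism from `ℤ_p / a` is the image of `1`, an element killed by `a`; these elements are
  -- the classes `x / a`, which form the range of `f`.
  have e1 : ((ℤ_[p] ⧸ Submodule.span ℤ_[p] {a}) →ₗ[ℤ_[p]] QZ p) ≃ LinearMap.range f := by
    refine (homQuotientEquiv _).symm.trans
      ⟨fun g => ⟨g.1 1, ?_⟩, fun x => ⟨LinearMap.toSpanSingleton ℤ_[p] _ x.1, ?_⟩, ?_, ?_⟩
    · have h1 : g.1 a = 0 := g.2 (Submodule.mem_span_singleton_self a)
      obtain ⟨x, hx⟩ := Submodule.mkQ_surjective _ (g.1 1)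
      have h2 : a • g.1 1 = 0 := by rw [← map_smul, smul_eq_mul, mul_one, h1]
      rw [← hx, ← map_smul, mkQ_eq_zero_iff] at h2
      obtain ⟨b, hb⟩ := h2
      refine ⟨b, ?_⟩
      rw [hf, ← hx, hb]
      congr 1
      change (a : ℚ_[p]) * x * _ = x
      rw [mul_comm (a : ℚ_[p]), mul_inv_cancel_right₀ ha']
    · rw [Submodule.span_le, Set.singleton_subset_iff]
      obtain ⟨x, y, rfl⟩ := x
      change LinearMap.toSpanSingleton ℤ_[p] _ (f y) a = 0
      rw [LinearMap.toSpanSingleton_apply, ← map_smul, ← LinearMap.mem_ker, hker]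
      exact Submodule.mem_span_singleton.2 ⟨y, mul_comm _ _⟩
    · intro g
      ext
      simp
    · intro x
      ext
      simp
  rw [Nat.card_congr e1, ← Nat.card_congr f.quotKerEquivRange.toEquiv, hker]

/-- Restriction of homomorphisms into a module satisfying Baer's criterion. -/
theorem card_hom_eq_mul {R M D : Type*} [CommRing R] [AddCommGroup M] [Module R M] [AddCommGroup D]
    [Module R D] (hD : Module.Baer R D) (N : Submodule R M) :
    Nat.card (M →ₗ[R] D) = Nat.card ((M ⧸ N) →ₗ[R] D) * Nat.card (N →ₗ[R] D) := by
  let f : (M →ₗ[R] D) →+ (N →ₗ[R] D) := (LinearMap.lcomp R D N.subtype).toAddMonoidHom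
  have hf : Function.Surjective f := fun g =>
    hD.extension_property N.subtype N.subtype_injective g
  rw [card_eq_card_ker_mul_card f hf, ← Nat.card_congr (homQuotientEquiv (F := D) N)]
  congr 1
  refine Nat.card_congr (Equiv.subtypeEquivRight fun g => ?_)
  rw [AddMonoidHom.mem_ker]
  constructor
  · intro h x hx
    exact LinearMap.congr_fun h ⟨x, hx⟩
  · intro h
    ext x
    exact h x.2

/-- By Baer's criterion `g` has an extension, and its extensions form a coset of the homomorphisms
that factor through `M ⧸ N`. -/
theorem card_hom_fiber {R M D : Type*} [CommRing R] [AddCommGroup M] [Module R M] [AddCommGroup D]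
    [Module R D] (hD : Module.Baer R D) (N : Submodule R M) (g : N →ₗ[R] D) :
    Nat.card {f : M →ₗ[R] D // f ∘ₗ N.subtype = g} = Nat.card ((M ⧸ N) →ₗ[R] D) := by
  let f : (M →ₗ[R] D) →+ (N →ₗ[R] D) := (LinearMap.lcomp R D N.subtype).toAddMonoidHom
  obtain ⟨g', rfl⟩ := hD.extension_property N.subtype N.subtype_injective g
  refine (card_fiber_eq_card_ker f g').trans ?_
  rw [← Nat.card_congr (homQuotientEquiv (F := D) N)]
  refine Nat.card_congr (Equiv.subtypeEquivRight fun g => ?_)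
  rw [AddMonoidHom.mem_ker]
  constructor
  · intro h x hx
    exact LinearMap.congr_fun h ⟨x, hx⟩
  · intro h
    ext x
    exact h x.2

theorem not_injective_of_finite {M : Type*} [AddCommGroup M] [Module ℤ_[p] M] [Finite M]
    (f : ℤ_[p] →ₗ[ℤ_[p]] M) : ¬ Function.Injective f := fun h =>
  not_finite_iff_infinite.2 (inferInstance : Infinite ℤ_[p]) (Finite.of_injective f h)

theorem exists_smul_eq_zero_of_finite {M : Type*} [AddCommGroup M] [Module ℤ_[p] M] [Finite M] :
    ∃ a : ℤ_[p], a ≠ 0 ∧ ∀ x : M, a • x = 0 := by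
  refine ⟨(Nat.card M : ℕ), by exact_mod_cast Nat.card_pos.ne', fun x => ?_⟩
  rw [Nat.cast_smul_eq_nsmul]
  exact card_nsmul_eq_zero'

/-- A finite `ℤ_p`-module and its dual have the same number of elements. -/
theorem card_hom_QZ (M : Type) [AddCommGroup M] [Module ℤ_[p] M] [Finite M] :
    Nat.card (M →ₗ[ℤ_[p]] QZ p) = Nat.card M := by
  induction h : Nat.card M using Nat.strong_induction_on generalizing M with
  | _ n ih =>
  subst h
  by_cases hM : Subsingleton M
  · have : Subsingleton (M →ₗ[ℤ_[p]] QZ p) := ⟨fun f g => by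
      ext x; rw [Subsingleton.elim x 0, map_zero, map_zero]⟩
    rw [Nat.card_of_subsingleton (0 : M), Nat.card_of_subsingleton (0 : M →ₗ[ℤ_[p]] QZ p)]
  rw [not_subsingleton_iff_nontrivial] at hM
  obtain ⟨x, hx⟩ := exists_ne (0 : M)
  -- Split off a nonzero cyclic submodule: the count is multiplicative along `N` because `ℚ_p / ℤ_p`
  -- is divisible, and it is known for cyclic modules.
  let N := Submodule.span ℤ_[p] {x}
  obtain ⟨a, ha⟩ := IsPrincipalIdealRing.principal (LinearMap.ker (LinearMap.toSpanSingleton ℤ_[p] M x))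
  have ha0 : a ≠ 0 := by
    rintro rfl
    refine not_injective_of_finite (LinearMap.toSpanSingleton ℤ_[p] M x) ?_
    rw [← LinearMap.ker_eq_bot, ha, Submodule.span_zero_singleton]
  have e : (ℤ_[p] ⧸ Submodule.span ℤ_[p] {a}) ≃ₗ[ℤ_[p]] N :=
    (Submodule.quotEquivOfEq _ _ ha.symm).trans
      ((LinearMap.quotKerEquivRange _).trans
        (LinearEquiv.ofEq _ _ (LinearMap.range_toSpanSingleton x)))
  have h1 : Nat.card (N →ₗ[ℤ_[p]] QZ p) = Nat.card N := by
    rw [← Nat.card_congr e.toEquiv, ← card_hom_quotient_span a ha0]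
    exact Nat.card_congr (e.symm.arrowCongr (LinearEquiv.refl _ _)).toEquiv
  have hN : 1 < Nat.card N := by
    rw [Finite.one_lt_card_iff_nontrivial, Submodule.nontrivial_iff_ne_bot]
    simpa [N] using hx
  have hmul := card_eq_card_submodule_mul_card_quotient N
  have := Finite.of_surjective _ N.mkQ_surjective
  have hlt : Nat.card (M ⧸ N) < Nat.card M := by
    rw [hmul]
    exact lt_mul_of_one_lt_left Nat.card_pos hN
  rw [card_hom_eq_mul (baer_QZ p) N, h1, ih _ hlt _ rfl, hmul, mul_comm]

instance finite_hom_QZ (M : Type) [AddCommGroup M] [Module ℤ_[p] M] [Finite M] :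
    Finite (M →ₗ[ℤ_[p]] QZ p) :=
  Nat.finite_of_card_ne_zero (by rw [card_hom_QZ]; exact Nat.card_pos.ne')

end

/-! ## Extensions by `ℤ_p` -/

section

variable {p : ℕ} [Fact p.Prime]

/-- The extension of `M` by `ℤ_p` that is pulled back from `ℤ_p → ℚ_p → ℚ_p / ℤ_p` along a
homomorphism `M → ℚ_p / ℤ_p`. -/
def midSub {M : Type} [AddCommGroup M] [Module ℤ_[p] M] (χ : M →ₗ[ℤ_[p]] QZ p) :
    Submodule ℤ_[p] (ℚ_[p] × M) :=
  LinearMap.eqLocus ((LinearMap.range (incl p)).mkQ ∘ₗ LinearMap.fst ℤ_[p] ℚ_[p] M)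
    (χ ∘ₗ LinearMap.snd ℤ_[p] ℚ_[p] M)

theorem mem_midSub {M : Type} [AddCommGroup M] [Module ℤ_[p] M] {χ : M →ₗ[ℤ_[p]] QZ p}
    {x : ℚ_[p] × M} : x ∈ midSub χ ↔ (LinearMap.range (incl p)).mkQ x.1 = χ x.2 := Iff.rfl

theorem mkQ_coe (a : ℤ_[p]) : (LinearMap.range (incl p)).mkQ (a : ℚ_[p]) = 0 :=
  (mkQ_eq_zero_iff _).2 ⟨a, rfl⟩

variable (p) in
/-- The short complex `ℤ_p → ℚ_p → ℚ_p / ℤ_p`. -/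
def fracComplex : ShortComplex (ModuleCat.{0} ℤ_[p]) :=
  ShortComplex.mk (ModuleCat.ofHom (incl p)) (ModuleCat.ofHom (LinearMap.range (incl p)).mkQ)
    (by ext; exact mkQ_coe _)

theorem shortExact_of_linearMap {A B C : ModuleCat.{0} ℤ_[p]} (f : A ⟶ B) (g : B ⟶ C)
    (w : f ≫ g = 0) (hf : Function.Injective f.hom) (hg : Function.Surjective g.hom)
    (h : ∀ x, g.hom x = 0 → ∃ y, f.hom y = x) : (ShortComplex.mk f g w).ShortExact where
  exact := by
    rw [ShortComplex.moduleCat_exact_iff]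
    exact h
  mono_f := (ModuleCat.mono_iff_injective f).2 hf
  epi_g := (ModuleCat.epi_iff_surjective g).2 hg

variable (p) in
theorem fracComplex_shortExact : (fracComplex p).ShortExact :=
  shortExact_of_linearMap _ _ _ incl_injective (Submodule.mkQ_surjective _)
    (fun _ h => (mkQ_eq_zero_iff _).1 h)

/-- The extension class that corresponds to a homomorphism into `ℚ_p / ℤ_p`. -/
def extOf (M : ModuleCat.{0} ℤ_[p]) (χ : M →ₗ[ℤ_[p]] QZ p) :
    Abelian.Ext M (ModuleCat.of ℤ_[p] ℤ_[p]) 1 :=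
  (Abelian.Ext.mk₀ (ModuleCat.ofHom χ : M ⟶ ModuleCat.of ℤ_[p] (QZ p))).comp
    (fracComplex_shortExact p).extClass (zero_add 1)

theorem hom_padic_eq_zero {M : Type} [AddCommGroup M] [Module ℤ_[p] M] [Finite M]
    (f : M →ₗ[ℤ_[p]] ℚ_[p]) : f = 0 := by
  obtain ⟨a, ha, h⟩ := exists_smul_eq_zero_of_finite (p := p) (M := M)
  ext x
  have h1 : a • f x = 0 := by rw [← map_smul, h, map_zero]
  exact (smul_eq_zero.1 h1).resolve_left ha

/-- Long exact sequence for `ℤ_p → ℚ_p → ℚ_p / ℤ_p`: the neighbours `Hom(M, ℚ_p)` and `Ext(M, ℚ_p)`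
of the connecting map vanish, since `M` is torsion and `ℚ_p` is injective. -/
theorem extOf_bijective (M : ModuleCat.{0} ℤ_[p]) [Finite M] : Function.Bijective (extOf M) := by
  constructor
  · have hadd : ∀ χ χ' : M →ₗ[ℤ_[p]] QZ p, extOf M (χ + χ') = extOf M χ + extOf M χ' := by
      intro χ χ'
      exact (congrArg (fun z => Abelian.Ext.comp z (fracComplex_shortExact p).extClass
        (zero_add 1)) (Abelian.Ext.mk₀_add (ModuleCat.ofHom χ : M ⟶ ModuleCat.of ℤ_[p] (QZ p))
          (ModuleCat.ofHom χ'))).trans (Abelian.Ext.add_comp _ _ _ _)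
    intro χ χ' h
    replace h : extOf M (χ - χ') = 0 :=
      (map_sub (AddMonoidHom.mk' (extOf M) hadd) χ χ').trans (sub_eq_zero.2 h)
    obtain ⟨x₂, hx₂⟩ := Abelian.Ext.covariant_sequence_exact₃ M (fracComplex_shortExact p) _
      (zero_add 1) h
    obtain ⟨f, rfl⟩ := Abelian.Ext.homEquiv₀.symm.surjective x₂
    have hf : f = 0 := by
      apply ModuleCat.hom_ext
      exact hom_padic_eq_zero f.hom
    subst hf
    have h0 : (Abelian.Ext.mk₀ (ModuleCat.ofHom (χ - χ') : M ⟶ ModuleCat.of ℤ_[p] (QZ p))) = 0 := by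
      rw [← hx₂]
      exact (congrArg (fun z => Abelian.Ext.comp z _ _)
        (Abelian.Ext.mk₀_zero _ _)).trans
        (Abelian.Ext.zero_comp _ _ _ _ _)
    rw [Abelian.Ext.mk₀_eq_zero_iff] at h0
    exact sub_eq_zero.1 (congrArg ModuleCat.Hom.hom h0)
  · intro e
    have : Injective (fracComplex p).X₂ :=
      Module.injective_object_of_injective_module (inj := (baer_padic p).injective)
    obtain ⟨x₃, hx₃⟩ := Abelian.Ext.covariant_sequence_exact₁ M (fracComplex_shortExact p) e
      (Abelian.Ext.eq_zero_of_injective _) (zero_add 1)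
    obtain ⟨f, rfl⟩ := Abelian.Ext.homEquiv₀.symm.surjective x₃
    exact ⟨f.hom, hx₃⟩

/-- Naturality of the extension class under the morphism `(id, F, χ)` to `ℤ_p → ℚ_p → ℚ_p / ℤ_p`. -/
theorem extClass_eq_extOf {M H : ModuleCat.{0} ℤ_[p]} (f : ModuleCat.of ℤ_[p] ℤ_[p] ⟶ H)
    (g : H ⟶ M) (w : f ≫ g = 0) (hS : (ShortComplex.mk f g w).ShortExact)
    (F : H →ₗ[ℤ_[p]] ℚ_[p]) (χ : M →ₗ[ℤ_[p]] QZ p) (hF : F ∘ₗ f.hom = incl p)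
    (hχ : (LinearMap.range (incl p)).mkQ ∘ₗ F = χ ∘ₗ g.hom) : hS.extClass = extOf M χ := by
  let φ : ShortComplex.mk f g w ⟶ fracComplex p :=
    ShortComplex.homMk (𝟙 _) (ModuleCat.ofHom F) (ModuleCat.ofHom χ)
      (ModuleCat.hom_ext (hF.symm : incl p ∘ₗ LinearMap.id = _))
      (ModuleCat.hom_ext hχ)
  have h := hS.extClass_naturality (fracComplex_shortExact p) φ
  exact (Abelian.Ext.comp_mk₀_id _).symm.trans h

/-- Injectivity of `ℚ_p` extends the inclusion of `ℤ_p` to `F : H → ℚ_p`, and `(F, g)` identifies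
`H` with the pullback. This removes `Ext` from the problem: what remains is a condition on the
module `H` alone. -/
theorem isMiddleTerm_extOf_iff (M H : ModuleCat.{0} ℤ_[p]) [Finite M] (χ : M →ₗ[ℤ_[p]] QZ p) :
    IsMiddleTerm (extOf M χ) H ↔ Nonempty (H ≃ₗ[ℤ_[p]] midSub χ) := by
  constructor
  · rintro ⟨f, g, w, hS, he⟩
    have hf : Function.Injective f.hom := (ModuleCat.mono_iff_injective f).1 hS.mono_f
    have hg : Function.Surjective g.hom := (ModuleCat.epi_iff_surjective g).1 hS.epi_g
    have hfg : ∀ x, g.hom (f.hom x) = 0 := fun x => LinearMap.congr_fun (congrArg ModuleCat.Hom.hom w) x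
    have hex : ∀ x, g.hom x = 0 → ∃ y, f.hom y = x :=
      (ShortComplex.moduleCat_exact_iff _).1 hS.exact
    obtain ⟨F, hF⟩ := (baer_padic p).extension_property f.hom hf (incl p)
    have hFf : ∀ a, F (f.hom a) = (a : ℚ_[p]) := fun a => LinearMap.congr_fun hF a
    obtain ⟨χ', hχ'⟩ : ∃ χ' : M →ₗ[ℤ_[p]] QZ p,
        (LinearMap.range (incl p)).mkQ ∘ₗ F = χ' ∘ₗ g.hom := by
      have hker : LinearMap.ker g.hom ≤ LinearMap.ker ((LinearMap.range (incl p)).mkQ ∘ₗ F) := by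
        intro x hx
        obtain ⟨y, rfl⟩ := hex x hx
        rw [LinearMap.mem_ker, LinearMap.comp_apply, hFf, mkQ_coe]
      refine ⟨(LinearMap.ker g.hom).liftQ _ hker ∘ₗ
        (g.hom.quotKerEquivOfSurjective hg).symm.toLinearMap, ?_⟩
      ext x
      have : (g.hom.quotKerEquivOfSurjective hg).symm (g.hom x) = (LinearMap.ker g.hom).mkQ x := by
        rw [LinearEquiv.symm_apply_eq]; rfl
      simp [this]
    have h1 := extClass_eq_extOf f g w hS F χ' hF hχ'
    -- The homomorphism induced by `F` has the same extension class as `χ`, and classes determine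
    -- homomorphisms.
    obtain rfl : χ' = χ := (extOf_bijective M).1 (h1.symm.trans he)
    have hχx : ∀ x, (LinearMap.range (incl p)).mkQ (F x) = χ' (g.hom x) :=
      fun x => LinearMap.congr_fun hχ' x
    refine ⟨LinearEquiv.ofBijective ((F.prod g.hom).codRestrict (midSub χ') hχx) ⟨?_, ?_⟩⟩
    · rw [← LinearMap.ker_eq_bot, LinearMap.ker_eq_bot']
      intro x hx
      have hx' := congrArg Subtype.val hx
      obtain ⟨y, rfl⟩ := hex x (congrArg Prod.snd hx')
      have h2 : F (f.hom y) = 0 := congrArg Prod.fst hx'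
      rw [hFf] at h2
      have : y = 0 := Subtype.ext h2
      rw [this, map_zero]
    · rintro ⟨⟨y, m⟩, hy⟩
      obtain ⟨x, rfl⟩ := hg m
      rw [mem_midSub] at hy
      dsimp only at hy
      rw [← hχx, ← sub_eq_zero, ← map_sub, mkQ_eq_zero_iff] at hy
      obtain ⟨a, ha⟩ := hy
      refine ⟨x + f.hom a, Subtype.ext (Prod.ext ?_ ?_)⟩
      · change F (x + f.hom a) = y
        rw [map_add, hFf, ha]; ring
      · change g.hom (x + f.hom a) = g.hom x
        rw [map_add, hfg, add_zero]
  · rintro ⟨e⟩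
    let i : ℤ_[p] →ₗ[ℤ_[p]] midSub χ := ((incl p).prod 0).codRestrict (midSub χ) (fun a => by
      rw [mem_midSub]; exact (mkQ_coe a).trans (map_zero _).symm)
    let f : ModuleCat.of ℤ_[p] ℤ_[p] ⟶ H := ModuleCat.ofHom (e.symm.toLinearMap ∘ₗ i)
    let q : midSub χ →ₗ[ℤ_[p]] M := LinearMap.snd ℤ_[p] ℚ_[p] M ∘ₗ (midSub χ).subtype
    let g : H ⟶ M := ModuleCat.ofHom (q ∘ₗ e.toLinearMap)
    have w : f ≫ g = 0 := by
      apply ModuleCat.hom_ext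
      ext
      simp [f, g, q, i]
    have hS : (ShortComplex.mk f g w).ShortExact := by
      refine shortExact_of_linearMap f g w ?_ ?_ ?_
      · refine e.symm.injective.comp fun a b hab => ?_
        exact incl_injective (congrArg (fun z : midSub χ => z.1.1) hab)
      · refine Function.Surjective.comp (g := q) (fun m => ?_) e.surjective
        obtain ⟨y, hy⟩ := Submodule.mkQ_surjective _ (χ m)
        exact ⟨⟨(y, m), hy⟩, rfl⟩
      · intro x hx
        have hx' : (e x).1.2 = 0 := hx
        have h2 := mem_midSub.1 (e x).2
        rw [hx', map_zero, mkQ_eq_zero_iff] at h2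
        obtain ⟨a, ha⟩ := h2
        refine Exists.intro (a : ℤ_[p]) ?_
        change e.symm (i a) = x
        rw [LinearEquiv.symm_apply_eq]
        exact Subtype.ext (Prod.ext ha hx'.symm)
    refine ⟨f, g, w, hS, extClass_eq_extOf f g w hS
      (LinearMap.fst ℤ_[p] ℚ_[p] M ∘ₗ (midSub χ).subtype ∘ₗ e.toLinearMap) χ ?_ ?_⟩
    · ext
      simp [f, i]
    · ext x
      exact mem_midSub.1 (e x).2

theorem probDStar_eq (G : X0 p) (H : X1 p) :
    probDStar G H = (Nat.card {χ : G.rep →ₗ[ℤ_[p]] QZ p // Nonempty (H.rep ≃ₗ[ℤ_[p]] midSub χ)} : ℝ) /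
      Nat.card G.rep := by
  have hb := extOf_bijective G.rep
  unfold probDStar
  rw [← Nat.card_congr (Equiv.ofBijective _ hb), card_hom_QZ]
  congr 2
  refine (Nat.card_congr (Equiv.subtypeEquiv (Equiv.ofBijective _ hb) fun χ => ?_)).symm
  exact (isMiddleTerm_extOf_iff _ _ χ).symm

end

/-! ## Finite modules and modules of rank one -/

section

variable {p : ℕ} [Fact p.Prime]

theorem finite_quotient_of_ne_bot (I : Ideal ℤ_[p]) (hI : I ≠ ⊥) : Finite (ℤ_[p] ⧸ I) := by
  obtain ⟨n, rfl⟩ := PadicInt.ideal_eq_span_pow_p hI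
  rw [← PadicInt.ker_toZModPow]
  have : NeZero (p ^ n) := ⟨pow_ne_zero _ (Fact.out : p.Prime).ne_zero⟩
  exact Finite.of_injective _ (RingHom.kerLift_injective (PadicInt.toZModPow n : ℤ_[p] →+* _))

theorem finite_of_smul_eq_zero {M : Type*} [AddCommGroup M] [Module ℤ_[p] M]
    [Module.Finite ℤ_[p] M] (a : ℤ_[p]) (ha : a ≠ 0) (h : ∀ x : M, a • x = 0) : Finite M := by
  obtain ⟨n, f, hf⟩ := Module.Finite.exists_fin' ℤ_[p] M
  have := finite_quotient_of_ne_bot (Ideal.span {a}) (by simpa using ha)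
  refine Finite.of_surjective
    (fun v : Fin n → ℤ_[p] ⧸ Ideal.span {a} => f fun i => Quotient.out (v i)) fun m => ?_
  obtain ⟨x, rfl⟩ := hf m
  refine ⟨fun i => Ideal.Quotient.mk _ (x i), ?_⟩
  have h1 : ∀ i, ∃ z, a * z = Quotient.out (Ideal.Quotient.mk (Ideal.span {a}) (x i)) - x i := by
    intro i
    have : Quotient.out (Ideal.Quotient.mk (Ideal.span {a}) (x i)) - x i ∈ Ideal.span {a} := by
      rw [← Ideal.Quotient.mk_eq_mk_iff_sub_mem]
      exact Quotient.out_eq _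
    obtain ⟨z, hz⟩ := Ideal.mem_span_singleton.1 this
    exact ⟨z, hz.symm⟩
  choose z hz using h1
  rw [← sub_eq_zero, ← map_sub]
  have : (fun i => Quotient.out (Ideal.Quotient.mk (Ideal.span {a}) (x i))) - x = a • z := by
    funext i
    exact (hz i).symm
  rw [this, map_smul, h]

theorem finite_of_isTorsion {M : Type*} [AddCommGroup M] [Module ℤ_[p] M]
    [Module.Finite ℤ_[p] M] (h : Module.IsTorsion ℤ_[p] M) : Finite M := by
  obtain ⟨s, hs⟩ := Module.Finite.fg_top (R := ℤ_[p]) (M := M)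
  have h' : ∀ x : M, ∃ a : nonZeroDivisors ℤ_[p], a • x = 0 := fun x => @h x
  choose a ha using h'
  refine finite_of_smul_eq_zero (∏ x ∈ s, (a x : ℤ_[p]))
    (Finset.prod_ne_zero_iff.2 fun x _ => nonZeroDivisors.ne_zero (a x).2) fun x => ?_
  have hx : x ∈ Submodule.span ℤ_[p] (s : Set M) := by rw [hs]; trivial
  induction hx using Submodule.span_induction with
  | mem x hx =>
    obtain ⟨c, hc⟩ := Finset.dvd_prod_of_mem (fun x => (a x : ℤ_[p])) hx
    rw [hc, mul_comm, mul_smul]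
    change c • (a x • x) = 0
    rw [ha, smul_zero]
  | zero => exact smul_zero _
  | add x y _ _ hx hy => rw [smul_add, hx, hy, add_zero]
  | smul r x _ hx => rw [smul_comm, hx, smul_zero]

theorem isTorsion_of_finite {M : Type*} [AddCommGroup M] [Module ℤ_[p] M] [Finite M] :
    Module.IsTorsion ℤ_[p] M := fun {x} => by
  obtain ⟨a, ha, h⟩ := exists_smul_eq_zero_of_finite (p := p) (M := M)
  exact ⟨⟨a, mem_nonZeroDivisors_of_ne_zero ha⟩, h x⟩

theorem finrank_eq_zero_of_finite {M : Type*} [AddCommGroup M] [Module ℤ_[p] M] [Finite M] :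
    Module.finrank ℤ_[p] M = 0 :=
  Module.IsTorsion.finrank_eq_zero isTorsion_of_finite

/-- A finitely generated module of rank one maps onto `ℤ_p` with finite kernel. -/
theorem exists_rho (H : Type) [AddCommGroup H] [Module ℤ_[p] H] [Module.Finite ℤ_[p] H]
    (h : Module.finrank ℤ_[p] H = 1) :
    ∃ ρ : H →ₗ[ℤ_[p]] ℤ_[p], Function.Surjective ρ ∧ Finite (LinearMap.ker ρ) := by
  let T := Submodule.torsion ℤ_[p] H
  have hT : Module.finrank ℤ_[p] (H ⧸ T) = 1 := by
    rw [finrank_quotient_eq_of_le_torsion le_rfl, h]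
  have hfree : Module.Free ℤ_[p] (H ⧸ T) := inferInstance
  let b := Module.finBasisOfFinrankEq ℤ_[p] (H ⧸ T) hT
  let e : (H ⧸ T) ≃ₗ[ℤ_[p]] ℤ_[p] := b.equivFun.trans (LinearEquiv.funUnique (Fin 1) ℤ_[p] ℤ_[p])
  refine ⟨e.toLinearMap ∘ₗ T.mkQ, e.surjective.comp T.mkQ_surjective, ?_⟩
  rw [LinearEquiv.ker_comp, Submodule.ker_mkQ]
  exact finite_of_isTorsion (Submodule.torsion_isTorsion)

theorem infinite_of_surjective {H : Type} [AddCommGroup H] [Module ℤ_[p] H]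
    {ρ : H →ₗ[ℤ_[p]] ℤ_[p]} (hρ : Function.Surjective ρ) : Infinite H :=
  Infinite.of_surjective ρ hρ

/-- An extension of a finite module by `ℤ_p` is finitely generated of rank one. -/
theorem midSub_rank {M : Type} [AddCommGroup M] [Module ℤ_[p] M] [Finite M]
    (χ : M →ₗ[ℤ_[p]] QZ p) :
    Module.Finite ℤ_[p] (midSub χ) ∧ Module.finrank ℤ_[p] (midSub χ) = 1 := by
  let q : midSub χ →ₗ[ℤ_[p]] M := LinearMap.snd ℤ_[p] ℚ_[p] M ∘ₗ (midSub χ).subtype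
  let i : ℤ_[p] →ₗ[ℤ_[p]] midSub χ := ((incl p).prod 0).codRestrict (midSub χ) (fun a => by
    rw [mem_midSub]; exact (mkQ_coe a).trans (map_zero _).symm)
  have hi : Function.Injective i := fun a b hab =>
    incl_injective (congrArg (fun z : midSub χ => z.1.1) hab)
  have hr : LinearMap.range i = LinearMap.ker q := by
    ext x
    constructor
    · rintro ⟨a, rfl⟩
      rfl
    · intro hx
      have hx' : x.1.2 = 0 := hx
      have h2 := mem_midSub.1 x.2
      rw [hx', map_zero, mkQ_eq_zero_iff] at h2
      obtain ⟨a, ha⟩ := h2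
      exact ⟨a, Subtype.ext (Prod.ext ha hx'.symm)⟩
  have e : ℤ_[p] ≃ₗ[ℤ_[p]] LinearMap.ker q :=
    (LinearEquiv.ofInjective i hi).trans (LinearEquiv.ofEq _ _ hr)
  have : Module.Finite ℤ_[p] (LinearMap.ker q) := Module.Finite.equiv e
  have : Finite (midSub χ ⧸ LinearMap.ker q) :=
    Finite.of_injective _ (LinearMap.quotKerEquivRange q).injective
  have hfin := Module.Finite.of_submodule_quotient (LinearMap.ker q)
  refine ⟨hfin, ?_⟩
  have h1 := (LinearMap.ker q).finrank_quotient_add_finrank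
  rw [finrank_eq_zero_of_finite, ← e.finrank_eq, Module.finrank_self] at h1
  exact h1.symm

/-! ## Isomorphism classes -/

/-- The isomorphism class of a finite module. -/
def X0.of (M : Type) [AddCommGroup M] [Module ℤ_[p] M] [Finite M] : X0 p :=
  Quotient.mk _ ⟨ModuleCat.of ℤ_[p] M, ‹Finite M›⟩

theorem X0.rep_of (M : Type) [AddCommGroup M] [Module ℤ_[p] M] [Finite M] :
    Nonempty ((X0.of (p := p) M).rep ≃ₗ[ℤ_[p]] M) :=
  Quotient.mk_out (s := isoSetoid p fun M => Finite M) ⟨ModuleCat.of ℤ_[p] M, ‹Finite M›⟩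

theorem X0.of_eq_iff (M : Type) [AddCommGroup M] [Module ℤ_[p] M] [Finite M] (G : X0 p) :
    X0.of M = G ↔ Nonempty (M ≃ₗ[ℤ_[p]] G.rep) := by
  constructor
  · rintro rfl
    exact (X0.rep_of M).map LinearEquiv.symm
  · intro h
    rw [← Quotient.out_eq G]
    exact Quotient.sound h

theorem X0.of_rep (G : X0 p) : X0.of G.rep = G := (X0.of_eq_iff _ _).2 ⟨LinearEquiv.refl _ _⟩

theorem X0.eq_iff (G K : X0 p) : G = K ↔ Nonempty (G.rep ≃ₗ[ℤ_[p]] K.rep) := by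
  rw [← X0.of_eq_iff, X0.of_rep]

/-- The isomorphism class of a finitely generated module of rank one. -/
def X1.of (M : Type) [AddCommGroup M] [Module ℤ_[p] M]
    (h : Module.Finite ℤ_[p] M ∧ Module.finrank ℤ_[p] M = 1) : X1 p :=
  Quotient.mk _ ⟨ModuleCat.of ℤ_[p] M, h⟩

theorem X1.rep_of (M : Type) [AddCommGroup M] [Module ℤ_[p] M]
    (h : Module.Finite ℤ_[p] M ∧ Module.finrank ℤ_[p] M = 1) :
    Nonempty ((X1.of M h).rep ≃ₗ[ℤ_[p]] M) :=
  Quotient.mk_out (s := isoSetoid p _) ⟨ModuleCat.of ℤ_[p] M, h⟩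

theorem X1.of_eq_iff (M : Type) [AddCommGroup M] [Module ℤ_[p] M]
    (h : Module.Finite ℤ_[p] M ∧ Module.finrank ℤ_[p] M = 1) (H : X1 p) :
    X1.of M h = H ↔ Nonempty (M ≃ₗ[ℤ_[p]] H.rep) := by
  constructor
  · rintro rfl
    exact (X1.rep_of M h).map LinearEquiv.symm
  · intro h
    rw [← Quotient.out_eq H]
    exact Quotient.sound h

theorem X1.finrank_rep (H : X1 p) : Module.finrank ℤ_[p] H.rep = 1 := (Quotient.out H).2.2

end

/-! ## Surjections with cyclic kernel and extensions -/

section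

variable {p : ℕ} [Fact p.Prime]

variable {H M : Type} [AddCommGroup H] [Module ℤ_[p] H] [AddCommGroup M] [Module ℤ_[p] M]

/-- A surjection `g` and a map `F` to `ℚ_p` that identifies its kernel with `ℤ_p` present `H` as
the extension of a homomorphism to `ℚ_p / ℤ_p`. -/
theorem exists_equiv_midSub (g : H →ₗ[ℤ_[p]] M) (hg : Function.Surjective g)
    (F : H →ₗ[ℤ_[p]] ℚ_[p]) (hF : ∀ x, g x = 0 → F x = 0 → x = 0)
    (hF1 : ∀ x, g x = 0 → ∃ a : ℤ_[p], (a : ℚ_[p]) = F x)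
    (hF2 : ∀ a : ℤ_[p], ∃ x, g x = 0 ∧ F x = a) :
    ∃ (χ : M →ₗ[ℤ_[p]] QZ p) (θ : H ≃ₗ[ℤ_[p]] midSub χ), ∀ x, (θ x).1 = (F x, g x) := by
  obtain ⟨χ, hχ⟩ : ∃ χ : M →ₗ[ℤ_[p]] QZ p,
      ∀ x, (LinearMap.range (incl p)).mkQ (F x) = χ (g x) := by
    have hker : LinearMap.ker g ≤ LinearMap.ker ((LinearMap.range (incl p)).mkQ ∘ₗ F) :=
      fun x hx => (mkQ_eq_zero_iff _).2 (hF1 x hx)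
    refine ⟨(LinearMap.ker g).liftQ _ hker ∘ₗ
      (g.quotKerEquivOfSurjective hg).symm.toLinearMap, fun x => ?_⟩
    have : (g.quotKerEquivOfSurjective hg).symm (g x) = (LinearMap.ker g).mkQ x := by
      rw [LinearEquiv.symm_apply_eq]; rfl
    simp [this]
  refine ⟨χ, LinearEquiv.ofBijective ((F.prod g).codRestrict (midSub χ) hχ) ⟨?_, ?_⟩, fun x => rfl⟩
  · rw [← LinearMap.ker_eq_bot, LinearMap.ker_eq_bot']
    intro x hx
    have hx' := congrArg Subtype.val hx
    exact hF x (congrArg Prod.snd hx') (congrArg Prod.fst hx')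
  · rintro ⟨⟨y, m⟩, hy⟩
    obtain ⟨x, rfl⟩ := hg m
    rw [mem_midSub] at hy
    dsimp only at hy
    rw [← hχ, ← sub_eq_zero, ← map_sub, mkQ_eq_zero_iff] at hy
    obtain ⟨a, ha⟩ := hy
    obtain ⟨z, hz, hza⟩ := hF2 a
    refine ⟨x + z, Subtype.ext (Prod.ext ?_ ?_)⟩
    · change F (x + z) = y
      rw [map_add, hza, ha]; ring
    · change g (x + z) = g x
      rw [map_add, hz, add_zero]

theorem midSub_snd_surjective (χ : M →ₗ[ℤ_[p]] QZ p) :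
    Function.Surjective (LinearMap.snd ℤ_[p] ℚ_[p] M ∘ₗ (midSub χ).subtype) := fun m => by
  obtain ⟨y, hy⟩ := Submodule.mkQ_surjective _ (χ m)
  exact ⟨⟨(y, m), hy⟩, rfl⟩

theorem coe_mem_midSub (χ : M →ₗ[ℤ_[p]] QZ p) (a : ℤ_[p]) : ((a : ℚ_[p]), (0 : M)) ∈ midSub χ := by
  rw [mem_midSub]; exact (mkQ_coe a).trans (map_zero _).symm

theorem exists_coe_of_mem_midSub {χ : M →ₗ[ℤ_[p]] QZ p} {y : ℚ_[p]}
    (h : (y, (0 : M)) ∈ midSub χ) : ∃ a : ℤ_[p], (a : ℚ_[p]) = y := by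
  rw [mem_midSub] at h
  exact (mkQ_eq_zero_iff _).1 (h.trans (map_zero _))

/-- Surjections from `H` to `M` with cyclic kernel. -/
abbrev CycSur (H M : Type) [AddCommGroup H] [Module ℤ_[p] H] [AddCommGroup M] [Module ℤ_[p] M] :=
  {g : Sur ℤ_[p] H M // ∃ x, LinearMap.ker g.1 = Submodule.span ℤ_[p] {x}}

variable (ρ : H →ₗ[ℤ_[p]] ℤ_[p])

/-- The automorphisms of `H` that are compatible with `ρ`. -/
abbrev AutOver := {α : H ≃ₗ[ℤ_[p]] H // ∀ x, ρ (α x) = ρ x}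

/-- The isomorphisms from `H` to an extension of `M` by `ℤ_p` whose component in `ℚ_p` is the
multiple of `ρ` by a power of `p`. -/
abbrev NormEquiv (χ : M →ₗ[ℤ_[p]] QZ p) :=
  {θ : H ≃ₗ[ℤ_[p]] midSub χ // ∃ n : ℤ, ∀ x, (θ x).1.1 = (p : ℚ_[p]) ^ n * (ρ x : ℚ_[p])}

/-- If each of two powers of `p` is an integral multiple of the other, their norms agree. This is
what makes the exponent in a normalized isomorphism unique. -/
theorem zpow_coe_eq {n n' : ℤ} {a b : ℤ_[p]} (h : (p : ℚ_[p]) ^ n = (p : ℚ_[p]) ^ n' * a)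
    (h' : (p : ℚ_[p]) ^ n' = (p : ℚ_[p]) ^ n * b) : n = n' := by
  have hp1 : (1 : ℝ) < p := by exact_mod_cast (Fact.out : p.Prime).one_lt
  have key : ∀ (n n' : ℤ) (a : ℤ_[p]), (p : ℚ_[p]) ^ n = (p : ℚ_[p]) ^ n' * a → n' ≤ n := by
    intro n n' a h
    have h1 := congrArg norm h
    rw [norm_mul, Padic.norm_p_zpow, Padic.norm_p_zpow] at h1
    have h2 : (p : ℝ) ^ (-n) ≤ (p : ℝ) ^ (-n') := by
      rw [h1]
      exact mul_le_of_le_one_right (by positivity) a.2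
    have := (zpow_le_zpow_iff_right₀ hp1).1 h2
    omega
  exact le_antisymm (key _ _ _ h') (key _ _ _ h)

variable {ρ}

theorem p_ne_zero : (p : ℚ_[p]) ≠ 0 := by exact_mod_cast (Fact.out : p.Prime).ne_zero

/-- Normalized isomorphisms with the same extension differ by an automorphism over `ρ`. -/
theorem normEquiv_diff (hρ : Function.Surjective ρ) {χ : M →ₗ[ℤ_[p]] QZ p} (θ θ' : NormEquiv ρ χ)
    (x : H) : ρ ((θ.1.trans θ'.1.symm) x) = ρ x := by
  obtain ⟨θ, n, hθ⟩ := θ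
  obtain ⟨θ', n', hθ'⟩ := θ'
  have h : ∀ x, (p : ℚ_[p]) ^ n * (ρ x : ℚ_[p]) = (p : ℚ_[p]) ^ n' * (ρ (θ'.symm (θ x))) := by
    intro x
    rw [← hθ, ← hθ', LinearEquiv.apply_symm_apply]
  obtain ⟨s, hs⟩ := hρ 1
  -- Evaluating at `s` and at the element that `θ` sends to `θ' s` shows each power of `p` to be an
  -- integral multiple of the other.
  have h1 := h s
  have h2 := h (θ.symm (θ' s))
  rw [LinearEquiv.apply_symm_apply, LinearEquiv.symm_apply_apply] at h2
  rw [hs, PadicInt.coe_one, mul_one] at h1 h2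
  obtain rfl := zpow_coe_eq h1 h2.symm
  have h3 := h x
  have := mul_left_cancel₀ (zpow_ne_zero n p_ne_zero) h3
  exact (Subtype.ext this).symm

theorem normEquiv_comp {χ : M →ₗ[ℤ_[p]] QZ p} (θ : NormEquiv ρ χ) (α : AutOver ρ) :
    ∃ n : ℤ, ∀ x, ((α.1.trans θ.1) x).1.1 = (p : ℚ_[p]) ^ n * (ρ x : ℚ_[p]) := by
  obtain ⟨n, h⟩ := θ.2
  refine ⟨n, fun x => ?_⟩
  rw [LinearEquiv.trans_apply, h, α.2]

/-- Normalized isomorphisms are a torsor under the automorphisms over `ρ`. -/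
def normEquivEquiv (hρ : Function.Surjective ρ) {χ : M →ₗ[ℤ_[p]] QZ p} (θ₀ : NormEquiv ρ χ) :
    NormEquiv ρ χ ≃ AutOver ρ where
  toFun θ := ⟨θ.1.trans θ₀.1.symm, normEquiv_diff hρ θ θ₀⟩
  invFun α := ⟨α.1.trans θ₀.1, normEquiv_comp θ₀ α⟩
  left_inv θ := Subtype.ext (LinearEquiv.ext fun x => by simp)
  right_inv α := by ext; simp

/-- Multiplication by a unit on the complement of the kernel of `ρ`. -/
theorem exists_aut_scale (hρ : Function.Surjective ρ) (u : ℤ_[p]ˣ) :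
    ∃ α : H ≃ₗ[ℤ_[p]] H, ∀ x, ρ (α x) = u * ρ x := by
  obtain ⟨s, hs⟩ := hρ 1
  -- Since `ρ s = 1`, the map `f c` multiplies `s` by `c` and fixes `ker ρ`; so `f c` and `f d` are
  -- inverse when `c d = 1`.
  let f : ℤ_[p] → H →ₗ[ℤ_[p]] H := fun c => LinearMap.id + (LinearMap.toSpanSingleton ℤ_[p] H ((c - 1) • s)) ∘ₗ ρ
  have hf : ∀ c x, f c x = x + ρ x • (c - 1) • s := fun c x => rfl
  have hcomp : ∀ c d : ℤ_[p], c * d = 1 → f c ∘ₗ f d = LinearMap.id := by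
    intro c d hcd
    ext x
    have h1 : ρ x * (d - 1) + (ρ x + ρ x * (d - 1)) * (c - 1) = 0 := by
      linear_combination ρ x * hcd
    rw [LinearMap.comp_apply, hf, hf]
    simp only [map_add, map_smul, hs, smul_eq_mul, mul_one, LinearMap.id_apply]
    rw [add_assoc, smul_smul, smul_smul, ← add_smul, h1, zero_smul, add_zero]
  refine ⟨LinearEquiv.ofLinearMap (f u) (f (u⁻¹ : ℤ_[p]ˣ)) (hcomp _ _ (by simp)) (hcomp _ _ (by simp)),
    fun x => ?_⟩
  change ρ (f u x) = _
  rw [hf]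
  simp only [map_add, map_smul, hs, smul_eq_mul, mul_one]
  ring

theorem exists_zpow_mul_unit {c : ℚ_[p]} (hc : c ≠ 0) :
    ∃ (n : ℤ) (u : ℤ_[p]ˣ), c = (p : ℚ_[p]) ^ n * (u : ℤ_[p]) := by
  have hn : ‖c * (p : ℚ_[p]) ^ (-c.valuation)‖ = 1 := by
    have hp0 : (p : ℝ) ≠ 0 := by exact_mod_cast (Fact.out : p.Prime).ne_zero
    rw [norm_mul, Padic.norm_p_zpow, Padic.norm_eq_zpow_neg_valuation hc, neg_neg,
      ← zpow_add₀ hp0, neg_add_cancel, zpow_zero]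
  refine ⟨c.valuation, PadicInt.mkUnits hn, ?_⟩
  rw [PadicInt.mkUnits_eq, mul_comm c, ← mul_assoc, ← zpow_add₀ p_ne_zero, add_neg_cancel,
    zpow_zero, one_mul]

/-- Every map to `ℚ_p` kills the finite kernel of `ρ`, so the component of `θ` in `ℚ_p` is a nonzero
multiple of `ρ`. The unit part of the scalar is absorbed by an automorphism of `H`, leaving a power
of `p`. -/
theorem nonempty_normEquiv (hρ : Function.Surjective ρ) (hT : Finite (LinearMap.ker ρ))
    {χ : M →ₗ[ℤ_[p]] QZ p} (θ : H ≃ₗ[ℤ_[p]] midSub χ) : Nonempty (NormEquiv ρ χ) := by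
  let F : H →ₗ[ℤ_[p]] ℚ_[p] := LinearMap.fst ℤ_[p] ℚ_[p] M ∘ₗ (midSub χ).subtype ∘ₗ θ.toLinearMap
  obtain ⟨s, hs⟩ := hρ 1
  have hF0 : ∀ x, ρ x = 0 → F x = 0 := fun x hx =>
    LinearMap.congr_fun (hom_padic_eq_zero (F ∘ₗ (LinearMap.ker ρ).subtype)) ⟨x, hx⟩
  have hF : ∀ x, F x = F s * ρ x := by
    intro x
    have h := hF0 (x - ρ x • s) (by simp [hs])
    rw [map_sub, map_smul, sub_eq_zero] at h
    rw [h, mul_comm]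
    rfl
  have hc : F s ≠ 0 := by
    intro h0
    have h1 := hF (θ.symm ⟨_, coe_mem_midSub χ 1⟩)
    rw [h0, zero_mul] at h1
    change (θ (θ.symm _)).1.1 = 0 at h1
    rw [LinearEquiv.apply_symm_apply] at h1
    exact one_ne_zero h1
  obtain ⟨n, u, hu⟩ := exists_zpow_mul_unit hc
  obtain ⟨α, hα⟩ := exists_aut_scale hρ u⁻¹
  refine ⟨α.trans θ, n, fun x => ?_⟩
  change F (α x) = _
  rw [hF, hα, hu, PadicInt.coe_mul, mul_assoc, ← mul_assoc _ _ (ρ x : ℚ_[p]), ← PadicInt.coe_mul,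
    Units.mul_inv, PadicInt.coe_one, one_mul]

/-- A normalized isomorphism determines a surjection with cyclic kernel. -/
def cycSurOf (x : Σ χ : {χ : M →ₗ[ℤ_[p]] QZ p // Nonempty (H ≃ₗ[ℤ_[p]] midSub χ)},
    NormEquiv ρ χ.1) : CycSur (p := p) H M :=
  ⟨⟨LinearMap.snd ℤ_[p] ℚ_[p] M ∘ₗ (midSub x.1.1).subtype ∘ₗ x.2.1.toLinearMap,
    Function.Surjective.comp (g := LinearMap.snd ℤ_[p] ℚ_[p] M ∘ₗ (midSub x.1.1).subtype)
      (midSub_snd_surjective x.1.1) x.2.1.surjective⟩, by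
    refine ⟨x.2.1.symm ⟨_, coe_mem_midSub x.1.1 1⟩, ?_⟩
    ext z
    rw [Submodule.mem_span_singleton]
    constructor
    · intro hz
      have hz' : (x.2.1 z).1.2 = 0 := hz
      have hm : ((x.2.1 z).1.1, (0 : M)) ∈ midSub x.1.1 := by
        rw [← hz']; exact (x.2.1 z).2
      obtain ⟨a, ha⟩ := exists_coe_of_mem_midSub hm
      refine ⟨a, ?_⟩
      rw [← map_smul, LinearEquiv.symm_apply_eq]
      refine Subtype.ext (Prod.ext ?_ ?_)
      · change (a : ℚ_[p]) * 1 = _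
        rw [mul_one, ha]
      · change a • (0 : M) = _
        rw [smul_zero, hz']
    · rintro ⟨a, rfl⟩
      rw [LinearMap.mem_ker]
      change (x.2.1 (a • _)).1.2 = 0
      rw [map_smul, LinearEquiv.apply_symm_apply]
      exact smul_zero a⟩

/-- The kernel of a surjection fixes the isomorphism with `ℤ_p` only up to a unit. Requiring the
component in `ℚ_p` to be a power of `p` times `ρ` removes this ambiguity, so `g` determines both `χ`
and `θ`. -/
theorem cycSurOf_bijective (hρ : Function.Surjective ρ) (hT : Finite (LinearMap.ker ρ)) [Finite M] :
    Function.Bijective (cycSurOf (M := M) (ρ := ρ)) := by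
  constructor
  · rintro ⟨⟨χ, h1⟩, ⟨θ, n, hθ⟩⟩ ⟨⟨χ', h1'⟩, ⟨θ', n', hθ'⟩⟩ h
    have hg : ∀ x, (θ x).1.2 = (θ' x).1.2 := fun x =>
      LinearMap.congr_fun (congrArg (fun g : CycSur (p := p) H M => g.1.1) h) x
    have key : ∀ (χ χ' : M →ₗ[ℤ_[p]] QZ p) (θ : H ≃ₗ[ℤ_[p]] midSub χ) (θ' : H ≃ₗ[ℤ_[p]] midSub χ')
        (n n' : ℤ), (∀ x, (θ x).1.1 = (p : ℚ_[p]) ^ n * (ρ x : ℚ_[p])) →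
        (∀ x, (θ' x).1.1 = (p : ℚ_[p]) ^ n' * (ρ x : ℚ_[p])) → (∀ x, (θ x).1.2 = (θ' x).1.2) →
        ∃ a : ℤ_[p], (p : ℚ_[p]) ^ n = (p : ℚ_[p]) ^ n' * a := by
      intro χ χ' θ θ' n n' h h' hg
      -- The element `k` generates the common kernel and has component `1` under `θ'`; its component
      -- under `θ` is integral, and the two expressions in `ρ k` compare the powers of `p`.
      set k := θ'.symm ⟨_, coe_mem_midSub χ' 1⟩
      have hk : θ' k = ⟨_, coe_mem_midSub χ' 1⟩ := θ'.apply_symm_apply _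
      have h2 : ((θ k).1.1, (0 : M)) ∈ midSub χ := by
        have : (θ k).1.2 = 0 := by rw [hg, hk]
        rw [← this]; exact (θ k).2
      obtain ⟨a, ha⟩ := exists_coe_of_mem_midSub h2
      have h3 : (1 : ℚ_[p]) = (p : ℚ_[p]) ^ n' * (ρ k : ℚ_[p]) := by
        rw [← h', hk]; rfl
      refine ⟨a, ?_⟩
      rw [ha, h]
      linear_combination ((p : ℚ_[p]) ^ n) * h3
    obtain ⟨a, ha⟩ := key χ χ' θ θ' n n' hθ hθ' hg
    obtain ⟨b, hb⟩ := key χ' χ θ' θ n' n hθ' hθ (fun x => (hg x).symm)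
    obtain rfl := zpow_coe_eq ha hb
    have hx : ∀ x, (θ x).1 = (θ' x).1 := fun x => Prod.ext (by rw [hθ, hθ']) (hg x)
    obtain rfl : χ = χ' := by
      ext m
      obtain ⟨z, rfl⟩ := midSub_snd_surjective χ m
      have h3 := mem_midSub.1 (θ (θ.symm z)).2
      have h4 := mem_midSub.1 (θ' (θ.symm z)).2
      rw [← hx, LinearEquiv.apply_symm_apply] at h4
      rw [LinearEquiv.apply_symm_apply] at h3
      exact h3.symm.trans h4
    obtain rfl : θ = θ' := LinearEquiv.ext fun x => Subtype.ext (hx x)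
    rfl
  · rintro ⟨⟨g, hg⟩, k, hk⟩
    -- Otherwise the kernel of `g` would lie in the finite module `ker ρ`, and `H` would be finite
    -- because `M` is.
    have hk0 : ρ k ≠ 0 := by
      intro h0
      have hle : LinearMap.ker g ≤ LinearMap.ker ρ := by
        rw [hk, Submodule.span_le, Set.singleton_subset_iff]
        exact h0
      have hfin : Finite (LinearMap.ker g) := Finite.of_injective _ (Submodule.inclusion_injective hle)
      have : Finite (H ⧸ LinearMap.ker g) :=
        Finite.of_injective _ (g.quotKerEquivOfSurjective hg).injective
      have : Finite H := Nat.finite_of_card_ne_zero (by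
        rw [card_eq_card_submodule_mul_card_quotient (LinearMap.ker g)]
        exact mul_ne_zero Nat.card_pos.ne' Nat.card_pos.ne')
      exact not_finite_iff_infinite.2 (infinite_of_surjective hρ) this
    obtain ⟨n, u, hu⟩ := exists_zpow_mul_unit
      (show ((ρ k : ℤ_[p]) : ℚ_[p]) ≠ 0 from fun h => hk0 (Subtype.ext h))
    -- With `ρ k = p ^ n u`, the scalar `p ^ (-n)` makes the image of the kernel `ℤ_p k` exactly
    -- `ℤ_p`.
    let F : H →ₗ[ℤ_[p]] ℚ_[p] :=
      LinearMap.toSpanSingleton ℤ_[p] ℚ_[p] ((p : ℚ_[p]) ^ (-n)) ∘ₗ ρ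
    have hF : ∀ x, F x = (p : ℚ_[p]) ^ (-n) * ρ x := fun x => mul_comm _ _
    have hFk : ∀ a : ℤ_[p], F (a • k) = ((a * u : ℤ_[p]) : ℚ_[p]) := by
      intro a
      rw [hF, map_smul, smul_eq_mul, PadicInt.coe_mul, hu, PadicInt.coe_mul, zpow_neg]
      have := zpow_ne_zero n (p_ne_zero (p := p))
      field_simp
    have hmem : ∀ x, g x = 0 → ∃ a : ℤ_[p], a • k = x := fun x hx => by
      have : x ∈ LinearMap.ker g := hx
      rw [hk] at this
      exact Submodule.mem_span_singleton.1 this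
    have hgk : g k = 0 := by
      rw [← LinearMap.mem_ker, hk]
      exact Submodule.mem_span_singleton_self k
    obtain ⟨χ, θ, hθ⟩ := exists_equiv_midSub g hg F
      (by
        intro x hx h0
        obtain ⟨a, rfl⟩ := hmem x hx
        rw [hFk] at h0
        have : a * u = 0 := Subtype.ext h0
        rw [(mul_eq_zero.1 this).resolve_right u.ne_zero, zero_smul])
      (by
        intro x hx
        obtain ⟨a, rfl⟩ := hmem x hx
        exact ⟨_, (hFk a).symm⟩)
      (by
        intro a
        refine ⟨(a * (u⁻¹ : ℤ_[p]ˣ)) • k, by rw [map_smul, hgk, smul_zero], ?_⟩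
        rw [hFk, mul_assoc, Units.inv_mul, mul_one])
    refine ⟨⟨⟨χ, ⟨θ⟩⟩, ⟨θ, -n, fun x => ?_⟩⟩, Subtype.ext (Subtype.ext (LinearMap.ext fun x => ?_))⟩
    · rw [hθ, hF]
    · change (θ x).1.2 = g x
      rw [hθ]

/-- Each `χ` whose extension is `H` contributes one torsor under `AutOver ρ`. That factor does not
involve `M`, which is what makes the random walks reversible. -/
theorem card_cycSur (hρ : Function.Surjective ρ) (hT : Finite (LinearMap.ker ρ)) [Finite M] :
    Nat.card (CycSur (p := p) H M) =
      Nat.card {χ : M →ₗ[ℤ_[p]] QZ p // Nonempty (H ≃ₗ[ℤ_[p]] midSub χ)} *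
        Nat.card (AutOver ρ) := by
  rw [← Nat.card_congr (Equiv.ofBijective _ (cycSurOf_bijective (M := M) hρ hT)), ← Nat.card_prod]
  exact Nat.card_congr ((Equiv.sigmaCongrRight fun χ =>
    normEquivEquiv hρ (nonempty_normEquiv hρ hT χ.2.some).some).trans (Equiv.sigmaEquivProd _ _))

/-- The map `α ↦ α - id` embeds these automorphisms in the finite set `Hom(H, ker ρ)`. -/
theorem finite_autOver [Module.Finite ℤ_[p] H] (hT : Finite (LinearMap.ker ρ)) :
    Finite (AutOver ρ) := by
  refine Finite.of_injective (fun α : AutOver ρ =>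
    ((α.1.toLinearMap - LinearMap.id).codRestrict (LinearMap.ker ρ) (fun x => by
      simp [α.2]) : H →ₗ[ℤ_[p]] LinearMap.ker ρ)) ?_
  intro α β h
  refine Subtype.ext (LinearEquiv.ext fun x => ?_)
  have := congrArg Subtype.val (LinearMap.congr_fun h x)
  exact sub_left_injective this

theorem card_autOver_pos [Module.Finite ℤ_[p] H] (hT : Finite (LinearMap.ker ρ)) :
    0 < Nat.card (AutOver ρ) := by
  have := finite_autOver hT
  have : Nonempty (AutOver ρ) := ⟨⟨LinearEquiv.refl _ _, fun _ => rfl⟩⟩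
  exact Nat.card_pos

end

/-! ## Haar measure on a finitely generated module -/

section

variable {p : ℕ} [Fact p.Prime]

theorem card_quotient_span_pow (n : ℕ) :
    Nat.card (ℤ_[p] ⧸ Submodule.span ℤ_[p] {(p : ℤ_[p]) ^ n}) = p ^ n := by
  have e : (ℤ_[p] ⧸ Submodule.span ℤ_[p] {(p : ℤ_[p]) ^ n}) ≃ ZMod (p ^ n) :=
    (Ideal.quotEquivOfEq (PadicInt.ker_toZModPow n).symm).toEquiv.trans
      (RingHom.quotientKerEquivOfSurjective (f := (PadicInt.toZModPow n : ℤ_[p] →+* _))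
        (ZMod.ringHom_surjective _)).toEquiv
  rw [Nat.card_congr e, Nat.card_zmod]

section Topology

variable {H : Type} [AddCommGroup H] [Module ℤ_[p] H] [Module.Finite ℤ_[p] H]

/-- If `a ≠ 0` kills the quotient, the preimage of `N` in `ℤ_p ^ n` contains all multiples of `a`,
hence a ball; a surjective linear map is open for the module topologies. -/
theorem isOpen_of_finite_quotient [TopologicalSpace H] [IsModuleTopology ℤ_[p] H]
    (N : Submodule ℤ_[p] H) [Finite (H ⧸ N)] : IsOpen (N : Set H) := by
  obtain ⟨n, f, hf⟩ := Module.Finite.exists_fin' ℤ_[p] H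
  obtain ⟨a, ha, h⟩ := exists_smul_eq_zero_of_finite (p := p) (M := H ⧸ N)
  have hopen : IsOpen (N.comap f : Set (Fin n → ℤ_[p])) := by
    refine AddSubgroup.isOpen_of_mem_nhds (N.comap f).toAddSubgroup (g := 0) ?_
    have h1 : Set.pi Set.univ (fun _ : Fin n => Metric.ball (0 : ℤ_[p]) ‖a‖) ∈
        nhds (0 : Fin n → ℤ_[p]) := by
      refine set_pi_mem_nhds Set.finite_univ fun i _ => Metric.ball_mem_nhds _ (norm_pos_iff.2 ha)
    refine Filter.mem_of_superset h1 fun x hx => ?_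
    have h2 : ∀ i, ∃ y, x i = a * y := by
      intro i
      have := hx i trivial
      rw [mem_ball_zero_iff] at this
      have h3 : ‖(x i : ℚ_[p]) / a‖ ≤ 1 := by
        rw [norm_div, div_le_one (norm_pos_iff.2 fun h => ha (Subtype.ext h))]
        exact this.le
      refine ⟨⟨_, h3⟩, Subtype.ext ?_⟩
      change (x i : ℚ_[p]) = a * (x i / a)
      rw [mul_div_cancel₀]
      exact fun h => ha (Subtype.ext h)
    choose y hy using h2
    have hxy : x = a • y := funext hy
    change f x ∈ N
    rw [hxy, map_smul, ← Submodule.Quotient.mk_eq_zero]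
    exact h (Submodule.Quotient.mk (f y))
  have := (IsModuleTopology.isOpenMap_of_surjective (R := ℤ_[p]) hf) _ hopen
  rwa [Submodule.comap_coe, Set.image_preimage_eq _ hf] at this

/-- The Haar measure of a submodule of finite index. -/
theorem haarProb_submodule (N : Submodule ℤ_[p] H) (hN : Finite (H ⧸ N)) :
    @MeasurableSet H (@borel H (moduleTopology ℤ_[p] H)) (N : Set H) ∧
      haarProb p H (N : Set H) = (Nat.card (H ⧸ N) : ENNReal)⁻¹ := by
  let : TopologicalSpace H := moduleTopology ℤ_[p] H
  have : IsModuleTopology ℤ_[p] H := ⟨rfl⟩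
  have : IsTopologicalAddGroup H := IsModuleTopology.topologicalAddGroup ℤ_[p] H
  have : CompactSpace H := compactSpace_moduleTopology p H
  let : MeasurableSpace H := borel H
  have : BorelSpace H := ⟨rfl⟩
  have hopen : IsOpen (N : Set H) := isOpen_of_finite_quotient N
  refine ⟨hopen.measurableSet, ?_⟩
  have hfi : N.toAddSubgroup.FiniteIndex :=
    ⟨by rw [AddSubgroup.index]; exact (Nat.card_pos (α := H ⧸ N)).ne'⟩
  let μ : MeasureTheory.Measure H :=
    MeasureTheory.Measure.addHaarMeasure (⊤ : TopologicalSpace.PositiveCompacts H)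
  have h1 : μ Set.univ = 1 := MeasureTheory.Measure.addHaarMeasure_self
  have h2 := MeasureTheory.AddSubgroup.index_mul_measure N.toAddSubgroup hopen.measurableSet μ
  rw [h1] at h2
  change μ (N : Set H) = _
  exact ENNReal.eq_inv_of_mul_eq_one_left ((mul_comm _ _).trans h2)

end Topology

/-! ## The measure of the generators of a cyclic submodule -/

section Measure

open MeasureTheory

variable (H : Type) [AddCommGroup H] [Module ℤ_[p] H]

/-- The cyclic submodules of finite index. -/
abbrev Cyc := {K : Submodule ℤ_[p] H // Finite (H ⧸ K) ∧ ∃ x, K = Submodule.span ℤ_[p] {x}}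

variable {H}

/-- The measure of the set of generators of a cyclic submodule of finite index. -/
def wt (K : Submodule ℤ_[p] H) : ENNReal := (1 - (p : ENNReal)⁻¹) * (Nat.card (H ⧸ K) : ENNReal)⁻¹

theorem wt_pos (K : Cyc (p := p) H) : 0 < wt K.1 := by
  have := K.2.1
  refine ENNReal.mul_pos ?_ (ENNReal.inv_ne_zero.2 (ENNReal.natCast_ne_top _))
  have : (1 : ENNReal) < p := by exact_mod_cast (Fact.out : p.Prime).one_lt
  exact (tsub_pos_of_lt (ENNReal.inv_lt_one.2 this)).ne'

theorem disjoint_generators : Pairwise (Function.onFun Disjoint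
    fun K : Cyc (p := p) H => {h : H | Submodule.span ℤ_[p] {h} = K.1}) := by
  intro K L hKL
  rw [Function.onFun, Set.disjoint_left]
  intro h h1 h2
  exact hKL (Subtype.ext (h1.symm.trans h2))

theorem measure_univ_eq_one {m : MeasurableSpace H} (μ : Measure H)
    (hμ : ∀ N : Submodule ℤ_[p] H, Finite (H ⧸ N) →
      MeasurableSet (N : Set H) ∧ μ (N : Set H) = (Nat.card (H ⧸ N) : ENNReal)⁻¹) : μ Set.univ = 1 := by
  have := (hμ ⊤ inferInstance).2
  rwa [Nat.card_of_subsingleton (0 : H ⧸ (⊤ : Submodule ℤ_[p] H)), Nat.cast_one, inv_one] at this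

theorem isUnit_iff_not_p_dvd (a : ℤ_[p]) : IsUnit a ↔ ¬ (p : ℤ_[p]) ∣ a := by
  rw [← not_iff_not, not_not, ← Ideal.mem_span_singleton, ← PadicInt.maximalIdeal_eq_span_p,
    IsLocalRing.mem_maximalIdeal, mem_nonunits_iff]

/-- Nakayama in its simplest form: `1 - p b` is a unit. -/
theorem eq_zero_of_eq_p_smul {x : H} {b : ℤ_[p]} (h : x = ((p : ℤ_[p]) * b) • x) : x = 0 := by
  have hu : IsUnit (1 - (p : ℤ_[p]) * b) := by
    rw [isUnit_iff_not_p_dvd]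
    intro hd
    have h1 : (p : ℤ_[p]) ∣ 1 := by
      have := dvd_add hd (dvd_mul_right (p : ℤ_[p]) b)
      rwa [sub_add_cancel] at this
    exact PadicInt.prime_p.not_isUnit (isUnit_of_dvd_one h1)
  rw [← hu.smul_eq_zero, sub_smul, one_smul, ← h, sub_self]

variable [Infinite H]

theorem ne_zero_of_finite_quotient {x : H} [Finite (H ⧸ Submodule.span ℤ_[p] {x})] : x ≠ 0 := by
  rintro rfl
  refine not_finite_iff_infinite.2 ‹Infinite H› (Nat.finite_of_card_ne_zero ?_)
  rw [card_eq_card_submodule_mul_card_quotient (Submodule.span ℤ_[p] {(0 : H)}),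
    Submodule.span_zero_singleton]
  refine mul_ne_zero (by simp) ?_
  rw [← Submodule.span_zero_singleton ℤ_[p]]
  exact Nat.card_pos.ne'

/-- A multiple `a x` generates `ℤ_p x` exactly when `a` is a unit, that is, when `a x` does not lie
in `p ℤ_p x`. -/
theorem generators_eq {x : H} [Finite (H ⧸ Submodule.span ℤ_[p] {x})] :
    {h : H | Submodule.span ℤ_[p] {h} = Submodule.span ℤ_[p] {x}} =
      (Submodule.span ℤ_[p] {x} : Set H) \ (Submodule.span ℤ_[p] {(p : ℤ_[p]) • x} : Set H) := by
  have hx := ne_zero_of_finite_quotient (p := p) (x := x)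
  ext h
  simp only [Set.mem_ofPred_eq, Set.mem_sdiff, SetLike.mem_coe]
  constructor
  · intro hh
    refine ⟨hh ▸ Submodule.mem_span_singleton_self h, fun h2 => hx ?_⟩
    obtain ⟨b, hb⟩ := Submodule.mem_span_singleton.1 h2
    obtain ⟨c, hc⟩ := Submodule.mem_span_singleton.1
      (hh.symm ▸ Submodule.mem_span_singleton_self x : x ∈ Submodule.span ℤ_[p] {h})
    refine eq_zero_of_eq_p_smul (b := b * c) ?_
    rw [← hb] at hc
    conv_lhs => rw [← hc]
    rw [smul_smul, smul_smul]
    congr 1; ring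
  · rintro ⟨h1, h2⟩
    obtain ⟨a, rfl⟩ := Submodule.mem_span_singleton.1 h1
    have ha : IsUnit a := by
      rw [isUnit_iff_not_p_dvd]
      rintro ⟨b, rfl⟩
      exact h2 (Submodule.mem_span_singleton.2 ⟨b, by rw [smul_smul, mul_comm]⟩)
    exact Submodule.span_singleton_smul_eq ha x

/-- The quotient of `ℤ_p x` by `p ℤ_p x` is `ℤ_p / p`. With `generators_eq` this produces the factor
`1 - 1 / p` in `wt`. -/
theorem card_quotient_span_p_smul {x : H} [Finite (H ⧸ Submodule.span ℤ_[p] {x})] :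
    Nat.card (H ⧸ Submodule.span ℤ_[p] {(p : ℤ_[p]) • x}) =
      p * Nat.card (H ⧸ Submodule.span ℤ_[p] {x}) := by
  have hx := ne_zero_of_finite_quotient (p := p) (x := x)
  set K := Submodule.span ℤ_[p] {x}
  set L := Submodule.span ℤ_[p] {(p : ℤ_[p]) • x}
  have hLK : L ≤ K := by
    rw [Submodule.span_le, Set.singleton_subset_iff]
    exact K.smul_mem _ (Submodule.mem_span_singleton_self x)
  rw [card_eq_card_submodule_mul_card_quotient (K.map L.mkQ),
    Nat.card_congr (Submodule.quotientQuotientEquivQuotient L K hLK).toEquiv]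
  congr 1
  let f : ℤ_[p] →ₗ[ℤ_[p]] H ⧸ L := L.mkQ ∘ₗ LinearMap.toSpanSingleton ℤ_[p] H x
  have hr : LinearMap.range f = K.map L.mkQ := by
    rw [LinearMap.range_comp, LinearMap.range_toSpanSingleton]
  have hk : LinearMap.ker f = Submodule.span ℤ_[p] {(p : ℤ_[p]) ^ 1} := by
    ext a
    rw [pow_one, LinearMap.mem_ker, LinearMap.comp_apply, Submodule.mkQ_apply,
      Submodule.Quotient.mk_eq_zero, LinearMap.toSpanSingleton_apply]
    constructor
    · intro h
      by_contra hna
      have ha : IsUnit a := by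
        rw [isUnit_iff_not_p_dvd, ← Ideal.mem_span_singleton]
        exact hna
      obtain ⟨u, rfl⟩ := ha
      obtain ⟨b, hb⟩ := Submodule.mem_span_singleton.1 h
      refine hx (eq_zero_of_eq_p_smul (b := b * ((u⁻¹ : ℤ_[p]ˣ) : ℤ_[p])) ?_)
      have h3 : x = ((u⁻¹ : ℤ_[p]ˣ) : ℤ_[p]) • ((u : ℤ_[p]) • x) := by
        rw [smul_smul, Units.inv_mul, one_smul]
      conv_lhs => rw [h3, ← hb]
      rw [smul_smul, smul_smul]
      congr 1; ring
    · intro h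
      obtain ⟨b, rfl⟩ := Submodule.mem_span_singleton.1 h
      exact Submodule.mem_span_singleton.2 ⟨b, by rw [smul_smul, smul_eq_mul]⟩
  rw [← hr, ← Nat.card_congr f.quotKerEquivRange.toEquiv, hk, card_quotient_span_pow, pow_one]

variable {m : MeasurableSpace H} (μ : Measure H)
  (hμ : ∀ N : Submodule ℤ_[p] H, Finite (H ⧸ N) →
    MeasurableSet (N : Set H) ∧ μ (N : Set H) = (Nat.card (H ⧸ N) : ENNReal)⁻¹)

include hμ

/-- Subtract the measure of `p K` from that of `K`. Only the measures of submodules of finite index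
enter, so no topology is needed here. -/
theorem measure_generators (K : Cyc (p := p) H) :
    MeasurableSet {h : H | Submodule.span ℤ_[p] {h} = K.1} ∧
      μ {h : H | Submodule.span ℤ_[p] {h} = K.1} = wt K.1 := by
  obtain ⟨_, hK, x, rfl⟩ := K
  dsimp only
  have hp : p ≠ 0 := (Fact.out : p.Prime).ne_zero
  have hcard := card_quotient_span_p_smul (p := p) (x := x)
  have hL : Finite (H ⧸ Submodule.span ℤ_[p] {(p : ℤ_[p]) • x}) :=
    Nat.finite_of_card_ne_zero (by rw [hcard]; exact mul_ne_zero hp Nat.card_pos.ne')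
  obtain ⟨hm1, h1⟩ := hμ _ hK
  obtain ⟨hm2, h2⟩ := hμ _ hL
  rw [generators_eq]
  refine ⟨hm1.diff hm2, ?_⟩
  rw [measure_sdiff _ hm2.nullMeasurableSet, h1, h2, wt, hcard]
  · have hp' : (p : ENNReal) ≠ 0 := by exact_mod_cast hp
    have hc : (Nat.card (H ⧸ Submodule.span ℤ_[p] {x}) : ENNReal) ≠ 0 := by
      exact_mod_cast Nat.card_pos.ne'
    rw [Nat.cast_mul, ENNReal.mul_inv (Or.inl hp') (Or.inl (ENNReal.natCast_ne_top _)),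
      ENNReal.sub_mul, one_mul]
    intro _ _
    exact ENNReal.inv_ne_top.2 hc
  · rw [h2]
    exact ENNReal.inv_ne_top.2 (by
      exact_mod_cast (Nat.card_pos (α := H ⧸ Submodule.span ℤ_[p] {(p : ℤ_[p]) • x})).ne')
  · intro z hz
    obtain ⟨b, rfl⟩ := Submodule.mem_span_singleton.1 hz
    exact Submodule.smul_mem _ _ (Submodule.smul_mem _ _ (Submodule.mem_span_singleton_self x))

/-- The sets of generators are disjoint and of positive measure in a probability space. -/
theorem countable_cyc : Countable (Cyc (p := p) H) := by
  have : IsFiniteMeasure μ := ⟨by rw [measure_univ_eq_one μ hμ]; exact ENNReal.one_lt_top⟩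
  have h := Measure.countable_meas_pos_of_disjoint_iUnion (μ := μ)
    (fun K => (measure_generators μ hμ K).1) (disjoint_generators)
  have h2 : {K : Cyc (p := p) H | 0 < μ {h : H | Submodule.span ℤ_[p] {h} = K.1}} = Set.univ := by
    ext K
    simp only [Set.mem_ofPred_eq, Set.mem_univ, iff_true, (measure_generators μ hμ K).2]
    exact wt_pos K
  rw [h2] at h
  exact Set.countable_univ_iff.1 h

open Classical in
/-- The measure of a set of elements that generate cyclic submodules of a given kind. -/
theorem measure_iUnion_generators (Q : Cyc (p := p) H → Prop) :
    μ {h : H | ∃ K, Q K ∧ Submodule.span ℤ_[p] {h} = K.1} =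
      ∑' K : Cyc (p := p) H, if Q K then wt K.1 else 0 := by
  have := countable_cyc μ hμ
  have h1 : {h : H | ∃ K, Q K ∧ Submodule.span ℤ_[p] {h} = K.1} =
      ⋃ K : Cyc (p := p) H, {h : H | Q K ∧ Submodule.span ℤ_[p] {h} = K.1} := by
    ext h; simp
  have h2 : ∀ K : Cyc (p := p) H, {h : H | Q K ∧ Submodule.span ℤ_[p] {h} = K.1} =
      if Q K then {h : H | Submodule.span ℤ_[p] {h} = K.1} else ∅ := by
    intro K
    split_ifs with h <;> simp [h]
  rw [h1, measure_iUnion]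
  · refine tsum_congr fun K => ?_
    rw [h2]
    split_ifs
    · exact (measure_generators μ hμ K).2
    · exact measure_empty
  · intro K L hKL
    exact (disjoint_generators hKL).mono (fun _ h => h.2) (fun _ h => h.2)
  · intro K
    rw [h2]
    split_ifs
    · exact (measure_generators μ hμ K).1
    · exact MeasurableSet.empty

end Measure

/-! ### Elements generating a submodule of infinite index form a null set -/

section Null

open MeasureTheory

variable {H : Type} [AddCommGroup H] [Module ℤ_[p] H] {ρ : H →ₗ[ℤ_[p]] ℤ_[p]}

/-- If `t` kills `ker ρ`, then `t ρ(h)` kills the quotient, because `ρ(h) x - ρ(x) h` lies in `ker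
ρ`. -/
theorem finite_quotient_span [Module.Finite ℤ_[p] H] (hT : Finite (LinearMap.ker ρ)) {h : H}
    (hh : ρ h ≠ 0) : Finite (H ⧸ Submodule.span ℤ_[p] {h}) := by
  obtain ⟨t, ht, h0⟩ := exists_smul_eq_zero_of_finite (p := p) (M := LinearMap.ker ρ)
  refine finite_of_smul_eq_zero (t * ρ h) (mul_ne_zero ht hh) fun x => ?_
  obtain ⟨x, rfl⟩ := Submodule.mkQ_surjective _ x
  rw [← map_smul, Submodule.mkQ_apply, Submodule.Quotient.mk_eq_zero]
  have h1 := congrArg Subtype.val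
    (h0 ⟨ρ h • x - ρ x • h, by simp [LinearMap.mem_ker, mul_comm]⟩)
  change t • (ρ h • x - ρ x • h) = 0 at h1
  rw [smul_sub, sub_eq_zero, smul_smul, smul_smul] at h1
  rw [h1]
  exact Submodule.smul_mem _ _ (Submodule.mem_span_singleton_self h)

/-- The kernel lies in the preimage of `p ^ n ℤ_p`, of measure `p ^ (-n)`, for every `n`. -/
theorem measure_ker_eq_zero (hρ : Function.Surjective ρ) {m : MeasurableSpace H} (μ : Measure H)
    (hμ : ∀ N : Submodule ℤ_[p] H, Finite (H ⧸ N) →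
      MeasurableSet (N : Set H) ∧ μ (N : Set H) = (Nat.card (H ⧸ N) : ENNReal)⁻¹) :
    μ {h | ρ h = 0} = 0 := by
  have hle : ∀ n : ℕ, μ {h | ρ h = 0} ≤ ((p : ENNReal)⁻¹) ^ n := by
    intro n
    let I := Submodule.span ℤ_[p] {(p : ℤ_[p]) ^ n}
    have e : (H ⧸ LinearMap.ker (I.mkQ ∘ₗ ρ)) ≃ₗ[ℤ_[p]] ℤ_[p] ⧸ I :=
      LinearMap.quotKerEquivOfSurjective _ (I.mkQ_surjective.comp hρ)
    have hc : Nat.card (H ⧸ LinearMap.ker (I.mkQ ∘ₗ ρ)) = p ^ n := by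
      rw [Nat.card_congr e.toEquiv, card_quotient_span_pow]
    have hf : Finite (H ⧸ LinearMap.ker (I.mkQ ∘ₗ ρ)) := Nat.finite_of_card_ne_zero (by
      rw [hc]; exact pow_ne_zero _ (Fact.out : p.Prime).ne_zero)
    refine (measure_mono (t := (LinearMap.ker (I.mkQ ∘ₗ ρ) : Set H)) fun h hh => ?_).trans ?_
    · change I.mkQ (ρ h) = 0
      rw [show ρ h = 0 from hh, map_zero]
    · rw [(hμ _ hf).2, hc, Nat.cast_pow, ENNReal.inv_pow]
  have hlim := ENNReal.tendsto_pow_atTop_nhds_zero_of_lt_one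
    (ENNReal.inv_lt_one.2 (by exact_mod_cast (Fact.out : p.Prime).one_lt : (1 : ENNReal) < p))
  exact le_antisymm (ge_of_tendsto' hlim hle) zero_le

open Classical in
/-- The weights of the cyclic submodules of a submodule of finite index. -/
theorem tsum_wt_le [Module.Finite ℤ_[p] H] (hρ : Function.Surjective ρ)
    (hT : Finite (LinearMap.ker ρ)) (N : Submodule ℤ_[p] H) (hN : Finite (H ⧸ N)) :
    ∑' K : Cyc (p := p) H, (if K.1 ≤ N then wt K.1 else 0) = (Nat.card (H ⧸ N) : ENNReal)⁻¹ := by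
  have := infinite_of_surjective hρ
  let : MeasurableSpace H := @borel H (moduleTopology ℤ_[p] H)
  have hμ := haarProb_submodule (p := p) (H := H)
  rw [← measure_iUnion_generators (haarProb p H) hμ, ← (hμ N hN).2]
  refine measure_congr ?_
  -- Off the null set `ker ρ` every element generates a submodule of finite index, so up to measure
  -- zero `N` is the union of the generator sets of its cyclic submodules of finite index.
  have h0 := measure_ker_eq_zero hρ (haarProb p H) hμ
  rw [← compl_mem_ae_iff] at h0
  filter_upwards [h0] with h hh
  refine propext ⟨?_, fun hhN => ?_⟩
  · rintro ⟨K, hK, hhK⟩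
    exact hK (hhK ▸ Submodule.mem_span_singleton_self h)
  · refine ⟨⟨_, finite_quotient_span hT hh, h, rfl⟩, ?_, rfl⟩
    rw [Submodule.span_le, Set.singleton_subset_iff]
    exact hhN

end Null

end

/-! ## The transition probabilities -/

section

variable {p : ℕ} [Fact p.Prime]

/-- The number of surjections between two modules. -/
def nSur (p : ℕ) [Fact p.Prime] (M N : Type) [AddCommGroup M] [Module ℤ_[p] M] [AddCommGroup N]
    [Module ℤ_[p] N] : ℕ := Nat.card (Sur ℤ_[p] M N)

theorem nSur_congr {M N A B : Type} [AddCommGroup M] [Module ℤ_[p] M] [AddCommGroup N]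
    [Module ℤ_[p] N] [AddCommGroup A] [Module ℤ_[p] A] [AddCommGroup B] [Module ℤ_[p] B]
    (e : M ≃ₗ[ℤ_[p]] A) (e' : N ≃ₗ[ℤ_[p]] B) : nSur p M N = nSur p A B :=
  Nat.card_congr (surCongr e e')

theorem nSur_of (M N : Type) [AddCommGroup M] [Module ℤ_[p] M] [AddCommGroup N]
    [Module ℤ_[p] N] [Finite M] : nSur p (X0.of (p := p) M).rep N = nSur p M N :=
  nSur_congr (X0.rep_of M).some (LinearEquiv.refl _ _)

instance finite_sur (M N : Type) [AddCommGroup M] [Module ℤ_[p] M] [AddCommGroup N]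
    [Module ℤ_[p] N] [Module.Finite ℤ_[p] M] [Finite N] : Finite (Sur ℤ_[p] M N) :=
  Subtype.finite

instance finite_quotient_submodule {F : Type} [AddCommGroup F] [Module ℤ_[p] F] [Finite F]
    (L : Submodule ℤ_[p] F) : Finite (F ⧸ L) :=
  Finite.of_surjective _ L.mkQ_surjective

theorem tsum_ite_one {ι : Type*} [Finite ι] (Q : ι → Prop) [DecidablePred Q] :
    ∑' i, (if Q i then (1 : ENNReal) else 0) = Nat.card {i // Q i} := by
  have := Fintype.ofFinite ι
  rw [tsum_fintype, Finset.sum_boole, Nat.card_eq_fintype_card, Fintype.card_subtype]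

/-- The probability that the quotient of `H` by a random element is `G`. -/
def pD (H : X1 p) (G : X0 p) : ENNReal :=
  haarProb p H.rep
    {h : H.rep | Nonempty ((H.rep ⧸ Submodule.span ℤ_[p] {h}) ≃ₗ[ℤ_[p]] G.rep)}

theorem probD_eq (H : X1 p) (G : X0 p) : probD H G = (pD H G).toReal := rfl

/-- The isomorphism class of the quotient by a cyclic submodule of finite index. -/
def Cyc.cls {H : Type} [AddCommGroup H] [Module ℤ_[p] H] (K : Cyc (p := p) H) : X0 p :=
  have := K.2.1
  X0.of (H ⧸ K.1)

theorem Cyc.cls_eq_iff {H : Type} [AddCommGroup H] [Module ℤ_[p] H] (K : Cyc (p := p) H)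
    (G : X0 p) : K.cls = G ↔ Nonempty ((H ⧸ K.1) ≃ₗ[ℤ_[p]] G.rep) :=
  have := K.2.1
  X0.of_eq_iff _ _

theorem X1.exists_rho (H : X1 p) : ∃ ρ : H.rep →ₗ[ℤ_[p]] ℤ_[p], Function.Surjective ρ ∧
    Finite (LinearMap.ker ρ) :=
  CohenLenstra.exists_rho H.rep H.finrank_rep

instance X1.infinite_rep (H : X1 p) : Infinite H.rep :=
  infinite_of_surjective H.exists_rho.choose_spec.1

open Classical in
theorem pD_eq_tsum (H : X1 p) (G : X0 p) :
    pD H G = ∑' K : Cyc (p := p) H.rep, if K.cls = G then wt K.1 else 0 := by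
  let : MeasurableSpace H.rep := @borel H.rep (moduleTopology ℤ_[p] H.rep)
  rw [← measure_iUnion_generators (haarProb p H.rep) haarProb_submodule, pD]
  congr 1
  ext h
  constructor
  · rintro ⟨e⟩
    have hf : Finite (H.rep ⧸ Submodule.span ℤ_[p] {h}) := Finite.of_injective _ e.injective
    exact ⟨⟨_, hf, h, rfl⟩, (Cyc.cls_eq_iff _ _).2 ⟨e⟩, rfl⟩
  · rintro ⟨K, hK, hhK⟩
    rw [Cyc.cls_eq_iff, ← hhK] at hK
    exact hK

/-- A surjection from `H / K` to `F` is a surjection `φ` from `H` whose kernel contains `K`. After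
exchanging the sums, each `φ` contributes the Haar measure of its kernel, `1 / #F`. -/
theorem pD_moment (H : X1 p) (F : Type) [AddCommGroup F] [Module ℤ_[p] F] [Finite F] :
    ∑' G : X0 p, pD H G * nSur p G.rep F = nSur p H.rep F * (Nat.card F : ENNReal)⁻¹ := by
  classical
  obtain ⟨ρ, hρ, hT⟩ := H.exists_rho
  have h1 : ∀ K : Cyc (p := p) H.rep, (∑' G : X0 p, (if K.cls = G then wt K.1 else 0) *
      (nSur p G.rep F : ENNReal)) =
        ∑' φ : Sur ℤ_[p] H.rep F, if K.1 ≤ LinearMap.ker φ.1 then wt K.1 else 0 := by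
    intro K
    have := K.2.1
    rw [tsum_eq_single K.cls fun G hG => by rw [if_neg hG.symm, zero_mul], if_pos rfl,
      Cyc.cls, nSur_of, nSur, ← Nat.card_congr (surQuotientEquiv K.1), ← tsum_ite_one,
      ← ENNReal.tsum_mul_left]
    refine tsum_congr fun φ => ?_
    rw [mul_ite, mul_one, mul_zero]
  simp_rw [pD_eq_tsum, ← ENNReal.tsum_mul_right]
  rw [ENNReal.tsum_comm]
  simp_rw [h1]
  rw [ENNReal.tsum_comm]
  have h2 : ∀ φ : Sur ℤ_[p] H.rep F, (∑' K : Cyc (p := p) H.rep,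
      if K.1 ≤ LinearMap.ker φ.1 then wt K.1 else 0) = (Nat.card F : ENNReal)⁻¹ := by
    intro φ
    have e := φ.1.quotKerEquivOfSurjective φ.2
    rw [tsum_wt_le hρ hT _ (Finite.of_injective _ e.injective), Nat.card_congr e.toEquiv]
  simp_rw [h2]
  have := Fintype.ofFinite (Sur ℤ_[p] H.rep F)
  rw [tsum_fintype, Finset.sum_const, nsmul_eq_mul, nSur,
    Nat.card_eq_fintype_card (α := Sur ℤ_[p] H.rep F), Finset.card_univ]

/-- Surjections with cyclic kernel compute the transition probability of `d`. -/
theorem pD_mul_card (H : X1 p) (G : X0 p) :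
    pD H G * (Nat.card G.rep * cardAut G) =
      (1 - (p : ENNReal)⁻¹) * Nat.card (CycSur (p := p) H.rep G.rep) := by
  classical
  have h0 := card_sur_ker (R := ℤ_[p]) H.rep G.rep
    (fun K => ∃ x, K = Submodule.span ℤ_[p] {x})
  have hG0 : (Nat.card G.rep : ENNReal) ≠ 0 := by exact_mod_cast Nat.card_pos.ne'
  let e : {K : Submodule ℤ_[p] H.rep // (∃ x, K = Submodule.span ℤ_[p] {x}) ∧
      Nonempty ((H.rep ⧸ K) ≃ₗ[ℤ_[p]] G.rep)} ≃ {K : Cyc (p := p) H.rep // K.cls = G} :=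
    { toFun := fun K => ⟨⟨K.1, Finite.of_injective _ K.2.2.some.injective, K.2.1⟩,
        (Cyc.cls_eq_iff _ _).2 K.2.2⟩
      invFun := fun K => ⟨K.1.1, K.1.2.2, (Cyc.cls_eq_iff _ _).1 K.2⟩
      left_inv := fun K => rfl
      right_inv := fun K => rfl }
  have hfin : Finite {K : Cyc (p := p) H.rep // K.cls = G} := by
    rw [← e.finite_iff]
    have : Finite {K : Submodule ℤ_[p] H.rep // (∃ φ : Sur ℤ_[p] H.rep G.rep,
        LinearMap.ker φ.1 = K)} := inferInstanceAs (Finite (Set.range _))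
    refine Finite.of_injective (fun K => (⟨K.1, ?_⟩ : {K : Submodule ℤ_[p] H.rep //
      (∃ φ : Sur ℤ_[p] H.rep G.rep, LinearMap.ker φ.1 = K)})) fun K L h => ?_
    · refine ⟨⟨K.2.2.some.toLinearMap ∘ₗ K.1.mkQ,
        K.2.2.some.surjective.comp K.1.mkQ_surjective⟩, ?_⟩
      rw [LinearEquiv.ker_comp, Submodule.ker_mkQ]
    · exact Subtype.ext (Subtype.mk.inj h)
  -- All submodules with quotient `G` have the same index, hence the same weight. There are finitely
  -- many, since each is the kernel of a surjection to a finite group.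
  have h1 : pD H G = (Nat.card {K : Cyc (p := p) H.rep // K.cls = G}) *
      ((1 - (p : ENNReal)⁻¹) * (Nat.card G.rep : ENNReal)⁻¹) := by
    have := Fintype.ofFinite {K : Cyc (p := p) H.rep // K.cls = G}
    rw [pD_eq_tsum, ← tsum_subtype_eq_of_support_subset (s := {K | K.cls = G}) (fun K hK => by
      by_contra h
      exact hK (if_neg h))]
    change ∑' K : {K : Cyc (p := p) H.rep // K.cls = G}, _ = _
    rw [tsum_fintype, Nat.card_eq_fintype_card, ← Finset.card_univ, ← nsmul_eq_mul,
      ← Finset.sum_const]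
    refine Finset.sum_congr rfl fun K _ => ?_
    rw [if_pos K.2, wt, Nat.card_congr ((Cyc.cls_eq_iff _ _).1 K.2).some.toEquiv]
  rw [h1, ← Nat.card_congr e, h0, Nat.cast_mul, cardAut]
  calc _ = (1 - (p : ENNReal)⁻¹) * (Nat.card {K : Submodule ℤ_[p] H.rep //
            (∃ x, K = Submodule.span ℤ_[p] {x}) ∧ Nonempty ((H.rep ⧸ K) ≃ₗ[ℤ_[p]] G.rep)} *
            Nat.card (G.rep ≃ₗ[ℤ_[p]] G.rep)) *
            ((Nat.card G.rep : ENNReal)⁻¹ * Nat.card G.rep) := by ring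
    _ = _ := by rw [ENNReal.inv_mul_cancel hG0 (ENNReal.natCast_ne_top _), mul_one]

/-- The probability that a random extension of `G` by `ℤ_p` is `H`. -/
def pDStar (G : X0 p) (H : X1 p) : ENNReal :=
  Nat.card {χ : G.rep →ₗ[ℤ_[p]] QZ p // Nonempty (H.rep ≃ₗ[ℤ_[p]] midSub χ)} *
    (Nat.card G.rep : ENNReal)⁻¹

theorem probDStar_eq_toReal (G : X0 p) (H : X1 p) : probDStar G H = (pDStar G H).toReal := by
  rw [probDStar_eq, pDStar, ENNReal.toReal_mul, ENNReal.toReal_inv, ENNReal.toReal_natCast,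
    ENNReal.toReal_natCast, div_eq_mul_inv]

theorem tsum_pDStar_mul (G : X0 p) (f : X1 p → ENNReal) :
    ∑' H, pDStar G H * f H = (∑' χ : G.rep →ₗ[ℤ_[p]] QZ p, f (X1.of (midSub χ) (midSub_rank χ))) *
      (Nat.card G.rep : ENNReal)⁻¹ := by
  classical
  have h : ∀ H : X1 p, pDStar G H * f H = (∑' χ : G.rep →ₗ[ℤ_[p]] QZ p,
      if X1.of (midSub χ) (midSub_rank χ) = H then f H else 0) * (Nat.card G.rep : ENNReal)⁻¹ := by
    intro H
    rw [pDStar, mul_right_comm]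
    congr 1
    have : ∀ χ : G.rep →ₗ[ℤ_[p]] QZ p, Nonempty (H.rep ≃ₗ[ℤ_[p]] midSub χ) ↔
        X1.of (midSub χ) (midSub_rank χ) = H := fun χ => by
      rw [X1.of_eq_iff]
      exact ⟨fun h => h.map LinearEquiv.symm, fun h => h.map LinearEquiv.symm⟩
    rw [Nat.card_congr (Equiv.subtypeEquivRight this), ← tsum_ite_one, ← ENNReal.tsum_mul_right]
    refine tsum_congr fun χ => ?_
    rw [ite_mul, one_mul, zero_mul]
  simp_rw [h]
  rw [ENNReal.tsum_mul_right, ENNReal.tsum_comm]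
  congr 1
  refine tsum_congr fun χ => ?_
  rw [tsum_eq_single _ fun H hH => if_neg hH.symm, if_pos rfl]

theorem cardAut_pos (G : X0 p) : 0 < cardAut G := by
  have : Finite (G.rep ≃ₗ[ℤ_[p]] G.rep) :=
    Finite.of_injective (fun e : G.rep ≃ₗ[ℤ_[p]] G.rep => e.toLinearMap)
      LinearEquiv.toLinearMap_injective
  have : Nonempty (G.rep ≃ₗ[ℤ_[p]] G.rep) := ⟨LinearEquiv.refl _ _⟩
  exact Nat.card_pos

/-- Reversibility of the two random walks. -/
theorem exists_reversible : ∃ w : X1 p → ENNReal, ∀ (G : X0 p) (H : X1 p),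
    (cardAut G : ENNReal)⁻¹ * pDStar G H = w H * pD H G := by
  have hex : ∀ H : X1 p, ∃ w : ENNReal, ∀ G : X0 p,
      (cardAut G : ENNReal)⁻¹ * pDStar G H = w * pD H G := by
    intro H
    obtain ⟨ρ, hρ, hT⟩ := H.exists_rho
    set c : ENNReal := 1 - (p : ENNReal)⁻¹
    have hc0 : c ≠ 0 := (tsub_pos_of_lt (ENNReal.inv_lt_one.2
      (by exact_mod_cast (Fact.out : p.Prime).one_lt))).ne'
    have hct : c ≠ ⊤ := ENNReal.sub_ne_top ENNReal.one_ne_top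
    set A : ENNReal := (Nat.card (AutOver ρ) : ENNReal)
    have hA0 : A ≠ 0 := by
      exact Nat.cast_ne_zero.2 (card_autOver_pos hT).ne'
    have hAt : A ≠ ⊤ := ENNReal.natCast_ne_top _
    -- By `pD_mul_card` and `card_cycSur`, both probabilities are multiples of the number of
    -- surjections `H → G` with cyclic kernel; the factors that depend only on `H` are `1 - 1 / p`
    -- and `#AutOver ρ`.
    refine ⟨(c * A)⁻¹, fun G => ?_⟩
    have hG0 : (Nat.card G.rep : ENNReal) ≠ 0 := by exact_mod_cast Nat.card_pos.ne'
    have hU0 : (cardAut G : ENNReal) ≠ 0 := by exact_mod_cast (cardAut_pos G).ne'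
    have h1 := pD_mul_card H G
    have h2 := card_cycSur (M := G.rep) hρ hT
    rw [h2, Nat.cast_mul] at h1
    rw [← ENNReal.mul_right_inj (mul_ne_zero hc0 hA0) (ENNReal.mul_ne_top hct hAt),
      ← mul_assoc (c * A) (c * A)⁻¹, ENNReal.mul_inv_cancel (mul_ne_zero hc0 hA0)
        (ENNReal.mul_ne_top hct hAt), one_mul,
      ← ENNReal.mul_left_inj (mul_ne_zero hG0 hU0)
        (ENNReal.mul_ne_top (ENNReal.natCast_ne_top _) (ENNReal.natCast_ne_top _)), h1, pDStar]
    set X : ENNReal :=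
      (Nat.card {χ : G.rep →ₗ[ℤ_[p]] QZ p // Nonempty (H.rep ≃ₗ[ℤ_[p]] midSub χ)} : ENNReal)
    calc _ = c * (X * A) * ((Nat.card G.rep : ENNReal) * (Nat.card G.rep : ENNReal)⁻¹) *
          ((cardAut G : ENNReal) * (cardAut G : ENNReal)⁻¹) := by ring
      _ = _ := by
        rw [ENNReal.mul_inv_cancel hG0 (ENNReal.natCast_ne_top _),
          ENNReal.mul_inv_cancel hU0 (ENNReal.natCast_ne_top _), mul_one, mul_one]
  choose w hw using hex
  exact ⟨w, fun G H => hw H G⟩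

end

/-! ## Counting surjections from extensions -/

section

variable {p : ℕ} [Fact p.Prime]

theorem exists_comp_eq {R A B C : Type*} [CommRing R] [AddCommGroup A] [AddCommGroup B]
    [AddCommGroup C] [Module R A] [Module R B] [Module R C] (j : A →ₗ[R] B)
    (hj : Function.Surjective j) (h : A →ₗ[R] C) (hk : ∀ x, j x = 0 → h x = 0) :
    ∃ l : B →ₗ[R] C, ∀ x, l (j x) = h x := by
  refine ⟨(LinearMap.ker j).liftQ h hk ∘ₗ (j.quotKerEquivOfSurjective hj).symm.toLinearMap,
    fun x => ?_⟩
  have : (j.quotKerEquivOfSurjective hj).symm (j x) = (LinearMap.ker j).mkQ x := by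
    rw [LinearEquiv.symm_apply_eq]; rfl
  rw [LinearMap.comp_apply, LinearEquiv.coe_coe, this]
  rfl

variable {M F : Type} [AddCommGroup M] [Module ℤ_[p] M] [AddCommGroup F] [Module ℤ_[p] F]

/-! ### Homomorphisms from extensions with prescribed image of `1` and prescribed reduction -/

section Fibre

variable {x : F} (ψ : M →ₗ[ℤ_[p]] F ⧸ Submodule.span ℤ_[p] {x})

/-- The pairs `(g, f)` such that `ψ g` is the class of `f`. -/
def fib : Submodule ℤ_[p] (M × F) :=
  LinearMap.eqLocus (ψ ∘ₗ LinearMap.fst ℤ_[p] M F)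
    ((Submodule.span ℤ_[p] {x}).mkQ ∘ₗ LinearMap.snd ℤ_[p] M F)

variable {ψ}

theorem mem_fib {z : M × F} : z ∈ fib ψ ↔ ψ z.1 = (Submodule.span ℤ_[p] {x}).mkQ z.2 := Iff.rfl

theorem zero_smul_mem_fib (t : ℤ_[p]) : ((0 : M), t • x) ∈ fib ψ := by
  rw [mem_fib, map_zero, eq_comm, Submodule.mkQ_apply, Submodule.Quotient.mk_eq_zero]
  exact Submodule.smul_mem _ _ (Submodule.mem_span_singleton_self x)

variable (ψ) in
/-- The element `(0, x)`. -/
def fibGen : fib ψ := ⟨(0, x), by simpa using zero_smul_mem_fib (ψ := ψ) 1⟩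

theorem exists_smul_fibGen {z w : fib ψ} (h : z.1.1 = w.1.1) : ∃ t : ℤ_[p], z = w + t • fibGen ψ := by
  have hz := mem_fib.1 z.2
  have hw := mem_fib.1 w.2
  rw [h, hw, ← sub_eq_zero, ← map_sub, Submodule.mkQ_apply, Submodule.Quotient.mk_eq_zero,
    Submodule.mem_span_singleton] at hz
  obtain ⟨t, ht⟩ := hz
  refine ⟨-t, Subtype.ext (Prod.ext ?_ ?_)⟩
  · change z.1.1 = w.1.1 + (-t) • (0 : M)
    rw [smul_zero, add_zero, h]
  · change z.1.2 = w.1.2 + (-t) • x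
    rw [neg_smul, ht]; abel

variable (ψ) in
/-- The projection from the fibre product. -/
def fibFst : fib ψ →ₗ[ℤ_[p]] M := LinearMap.fst ℤ_[p] M F ∘ₗ (fib ψ).subtype

variable (ψ) in
theorem fibFst_surjective : Function.Surjective (fibFst ψ) := fun g => by
  obtain ⟨f, hf⟩ := Submodule.mkQ_surjective _ (ψ g)
  exact ⟨⟨(g, f), hf.symm⟩, rfl⟩

variable (ψ) in
theorem ker_fibFst : LinearMap.ker (fibFst ψ) = Submodule.span ℤ_[p] {fibGen ψ} := by
  ext z
  rw [Submodule.mem_span_singleton]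
  constructor
  · intro hz
    have h : z.1.1 = (0 : fib ψ).1.1 := hz
    obtain ⟨t, ht⟩ := exists_smul_fibGen h
    exact ⟨t, by rw [ht, zero_add]⟩
  · rintro ⟨t, rfl⟩
    exact smul_zero t

variable {a : ℤ_[p]}

theorem mkQ_inv_smul (ha0 : a ≠ 0) (t : ℤ_[p]) :
    t • (LinearMap.range (incl p)).mkQ (a : ℚ_[p])⁻¹ = 0 ↔ a ∣ t := by
  have ha' : (a : ℚ_[p]) ≠ 0 := fun h => ha0 (Subtype.ext h)
  rw [← map_smul, mkQ_eq_zero_iff]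
  constructor
  · rintro ⟨b, hb⟩
    refine ⟨b, Subtype.ext ?_⟩
    change (t : ℚ_[p]) = a * b
    rw [hb]
    change (t : ℚ_[p]) = a * (t * (a : ℚ_[p])⁻¹)
    field_simp
  · rintro ⟨b, rfl⟩
    refine ⟨b, ?_⟩
    change (b : ℚ_[p]) = (a * b : ℚ_[p]) * (a : ℚ_[p])⁻¹
    field_simp

variable (ha0 : a ≠ 0) (ha : ∀ t : ℤ_[p], t • x = 0 ↔ a ∣ t)

include ha0 ha

/-- The homomorphisms to `ℚ_p / ℤ_p` with a given value on `(0, x)`. -/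
theorem card_fib_hom [Finite M] [Finite F] :
    Nat.card {l : fib ψ →ₗ[ℤ_[p]] QZ p //
      l (fibGen ψ) = (LinearMap.range (incl p)).mkQ (a : ℚ_[p])⁻¹} = Nat.card M := by
  set N := Submodule.span ℤ_[p] {fibGen ψ}
  let n : N := ⟨fibGen ψ, Submodule.mem_span_singleton_self _⟩
  -- The assignment `(0, x) ↦ 1 / a` is well defined on `N` because `a` generates the annihilator of
  -- `x`; its extensions to `fib ψ` are then counted by the dual of `fib ψ ⧸ N ≅ M`.
  obtain ⟨g, hg⟩ := exists_comp_eq (LinearMap.toSpanSingleton ℤ_[p] (↥N) n)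
    (fun z : N => by
      obtain ⟨t, ht⟩ := Submodule.mem_span_singleton.1 z.2
      exact ⟨t, Subtype.ext ht⟩)
    (LinearMap.toSpanSingleton ℤ_[p] (QZ p) ((LinearMap.range (incl p)).mkQ (a : ℚ_[p])⁻¹))
    (fun t ht => by
      rw [LinearMap.toSpanSingleton_apply, mkQ_inv_smul ha0, ← ha]
      exact congrArg (fun z : N => z.1.1.2) ht)
  have e : (fib ψ ⧸ N) ≃ₗ[ℤ_[p]] M :=
    (Submodule.quotEquivOfEq _ _ (ker_fibFst ψ).symm).trans
      ((fibFst ψ).quotKerEquivOfSurjective (fibFst_surjective ψ))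
  have hg1 : g n = (LinearMap.range (incl p)).mkQ (a : ℚ_[p])⁻¹ := by
    have := hg 1
    rwa [LinearMap.toSpanSingleton_apply, LinearMap.toSpanSingleton_apply, one_smul, one_smul] at this
  rw [← Nat.card_congr e.toEquiv]
  have hfin : Finite (fib ψ ⧸ N) := Finite.of_injective _ e.injective
  rw [← card_hom_QZ (p := p) (fib ψ ⧸ N), ← card_hom_fiber (baer_QZ p) N g]
  refine Nat.card_congr (Equiv.subtypeEquivRight fun l => ?_)
  constructor
  · intro hl
    ext z
    obtain ⟨t, ht⟩ := Submodule.mem_span_singleton.1 z.2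
    obtain rfl : t • n = z := Subtype.ext ht
    rw [map_smul, map_smul, hg1, ← hl]
    rfl
  · intro hl
    rw [← hg1, ← hl]
    rfl

/-- Homomorphisms from extensions of `M` by `ℤ_p` that restrict to `1 ↦ x` and induce `ψ`. -/
abbrev ExtHom {x : F} (ψ : M →ₗ[ℤ_[p]] F ⧸ Submodule.span ℤ_[p] {x}) :=
  {c : (Σ χ : M →ₗ[ℤ_[p]] QZ p, midSub χ →ₗ[ℤ_[p]] F) //
    (∀ h, c.2 ⟨((1 : ℚ_[p]), 0), h⟩ = x) ∧
      ∀ z : midSub c.1, ψ z.1.2 = (Submodule.span ℤ_[p] {x}).mkQ (c.2 z)}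

omit ha0 ha in
theorem one_mem_midSub (χ : M →ₗ[ℤ_[p]] QZ p) : ((1 : ℚ_[p]), (0 : M)) ∈ midSub χ :=
  coe_mem_midSub χ 1

omit ha0 ha in
/-- The element of an extension that comes from `t ∈ ℤ_p`. -/
theorem smul_one_midSub (χ : M →ₗ[ℤ_[p]] QZ p) (t : ℤ_[p]) :
    t • (⟨_, one_mem_midSub χ⟩ : midSub χ) = ⟨_, coe_mem_midSub χ t⟩ :=
  Subtype.ext (Prod.ext (mul_one (t : ℚ_[p])) (smul_zero t))

omit ha in
theorem smul_mkQ_mul_inv (y : ℚ_[p]) :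
    a • (LinearMap.range (incl p)).mkQ (y * (a : ℚ_[p])⁻¹) = (LinearMap.range (incl p)).mkQ y := by
  have ha' : (a : ℚ_[p]) ≠ 0 := fun h => ha0 (Subtype.ext h)
  rw [← map_smul]
  congr 1
  change (a : ℚ_[p]) * (y * (a : ℚ_[p])⁻¹) = y
  field_simp

/-- The extension maps onto `fib ψ` with kernel the `t ∈ ℤ_p` such that `t x = 0`, i.e. `a ∣ t`. On
these the class of `t / a` in `ℚ_p / ℤ_p` vanishes, so division of the first component by `a`
descends to `fib ψ`. -/
theorem exists_fib_hom (c : ExtHom ψ) : ∃ l : fib ψ →ₗ[ℤ_[p]] QZ p, ∀ z : midSub c.1.1,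
    l ⟨(z.1.2, c.1.2 z), c.2.2 z⟩ = (LinearMap.range (incl p)).mkQ (z.1.1 * (a : ℚ_[p])⁻¹) := by
  obtain ⟨⟨χ, φ⟩, h1, h2⟩ := c
  have ha' : (a : ℚ_[p]) ≠ 0 := fun h => ha0 (Subtype.ext h)
  let j : midSub χ →ₗ[ℤ_[p]] fib ψ :=
    ((LinearMap.snd ℤ_[p] ℚ_[p] M ∘ₗ (midSub χ).subtype).prod φ).codRestrict (fib ψ) h2
  have hj1 : ∀ t : ℤ_[p], j ⟨_, coe_mem_midSub χ t⟩ = t • fibGen ψ := by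
    intro t
    rw [← smul_one_midSub, map_smul]
    congr 1
    exact Subtype.ext (Prod.ext rfl (h1 _))
  have hj : Function.Surjective j := by
    intro w
    obtain ⟨z, hz⟩ := midSub_snd_surjective χ w.1.1
    obtain ⟨t, ht⟩ := exists_smul_fibGen (z := w) (w := j z) hz.symm
    exact ⟨z + ⟨_, coe_mem_midSub χ t⟩, by rw [map_add, hj1, ht]⟩
  refine exists_comp_eq j hj ((LinearMap.range (incl p)).mkQ ∘ₗ
    LinearMap.mulRight ℤ_[p] ((a : ℚ_[p])⁻¹) ∘ₗ LinearMap.fst ℤ_[p] ℚ_[p] M ∘ₗ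
      (midSub χ).subtype) (fun z hz => ?_)
  obtain ⟨⟨y, g⟩, hyg⟩ := z
  obtain rfl : g = 0 := congrArg (fun w : fib ψ => w.1.1) hz
  obtain ⟨t, rfl⟩ := exists_coe_of_mem_midSub hyg
  have h3 : t • x = 0 := by
    rw [hj1] at hz
    exact congrArg (fun w : fib ψ => w.1.2) hz
  rw [ha, ← mkQ_inv_smul ha0, ← map_smul] at h3
  exact h3

/-- The descended homomorphism `l` remembers everything: `χ` is `a • l`, which is constant along the
fibres over `M`, and the value of `φ` at `(y, g)` is the only `f` over `ψ g` with `l (g, f) = y /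
a`. The count therefore depends on neither `x` nor `ψ`. -/
theorem card_extHom [Finite M] [Finite F] : Nat.card (ExtHom ψ) = Nat.card M := by
  have ha' : (a : ℚ_[p]) ≠ 0 := fun h => ha0 (Subtype.ext h)
  rw [← card_fib_hom (ψ := ψ) ha0 ha]
  choose L hL using exists_fib_hom (ψ := ψ) ha0 ha
  have hgen : ∀ c, L c (fibGen ψ) = (LinearMap.range (incl p)).mkQ (a : ℚ_[p])⁻¹ := by
    intro c
    have := hL c ⟨_, one_mem_midSub c.1.1⟩
    dsimp only at this
    rw [one_mul] at this
    rw [← this]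
    congr 1
    exact Subtype.ext (Prod.ext rfl (c.2.1 _).symm)
  -- On a fibre over `M`, two elements differ by `t (0, x)`, on which `l` vanishes only if `a ∣ t`,
  -- that is, only if the difference is zero.
  have huniq : ∀ (l : fib ψ →ₗ[ℤ_[p]] QZ p),
      l (fibGen ψ) = (LinearMap.range (incl p)).mkQ (a : ℚ_[p])⁻¹ →
      ∀ z w : fib ψ, z.1.1 = w.1.1 → l z = l w → z = w := by
    intro l hl z w hzw h
    obtain ⟨t, rfl⟩ := exists_smul_fibGen hzw
    rw [map_add, map_smul, hl, add_eq_left, mkQ_inv_smul ha0, ← ha] at h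
    have : t • fibGen ψ = 0 := Subtype.ext (Prod.ext (smul_zero t) h)
    rw [this, add_zero]
  have hconst : ∀ (l : fib ψ →ₗ[ℤ_[p]] QZ p),
      l (fibGen ψ) = (LinearMap.range (incl p)).mkQ (a : ℚ_[p])⁻¹ →
      ∀ z w : fib ψ, z.1.1 = w.1.1 → a • l z = a • l w := by
    intro l hl z w hzw
    obtain ⟨t, rfl⟩ := exists_smul_fibGen hzw
    rw [map_add, map_smul, hl, smul_add, smul_comm a t, (mkQ_inv_smul ha0 a).2 dvd_rfl, smul_zero,
      add_zero]
  refine Nat.card_congr (Equiv.ofBijective (fun c => ⟨L c, hgen c⟩) ⟨?_, ?_⟩)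
  · intro c c' hcc
    replace hcc : L c = L c' := congrArg Subtype.val hcc
    have hc := hL c
    have hc' := hL c'
    have hg := hgen c
    rw [← hcc] at hc'
    generalize L c = l at hc hc' hg
    obtain ⟨⟨χ, φ⟩, h1, h2⟩ := c
    obtain ⟨⟨χ', φ'⟩, h1', h2'⟩ := c'
    dsimp only at hc hc'
    have key : ∀ (χ : M →ₗ[ℤ_[p]] QZ p) (φ : midSub χ →ₗ[ℤ_[p]] F)
        (h2 : ∀ z : midSub χ, ψ z.1.2 = (Submodule.span ℤ_[p] {x}).mkQ (φ z)),
        (∀ z : midSub χ, l ⟨(z.1.2, φ z), h2 z⟩ =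
          (LinearMap.range (incl p)).mkQ (z.1.1 * (a : ℚ_[p])⁻¹)) →
        ∀ w : fib ψ, χ w.1.1 = a • l w := by
      intro χ φ h2 h w
      obtain ⟨z, hz⟩ := midSub_snd_surjective χ w.1.1
      rw [hconst l hg w ⟨(z.1.2, φ z), h2 z⟩ hz.symm, h, smul_mkQ_mul_inv ha0, ← hz]
      exact (mem_midSub.1 z.2).symm
    obtain rfl : χ = χ' := by
      ext g
      obtain ⟨w, rfl⟩ := fibFst_surjective ψ g
      exact (key χ φ h2 hc w).trans (key χ' φ' h2' hc' w).symm
    obtain rfl : φ = φ' := by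
      ext z
      have := huniq l hg ⟨(z.1.2, φ z), h2 z⟩ ⟨(z.1.2, φ' z), h2' z⟩ rfl
        ((hc z).trans (hc' z).symm)
      exact congrArg (fun w : fib ψ => w.1.2) this
    rfl
  · rintro ⟨l, hl⟩
    obtain ⟨χ, hχ⟩ := exists_comp_eq (fibFst ψ) (fibFst_surjective ψ) (a • l) (fun w hw => by
      have := hconst l hl w 0 hw
      rwa [map_zero, smul_zero] at this)
    have hex : ∀ z : midSub χ, ∃ f, ∃ hf : (z.1.2, f) ∈ fib ψ, l ⟨(z.1.2, f), hf⟩ =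
        (LinearMap.range (incl p)).mkQ (z.1.1 * (a : ℚ_[p])⁻¹) := by
      rintro ⟨⟨y, g⟩, hyg⟩
      obtain ⟨w, rfl⟩ := fibFst_surjective ψ g
      obtain ⟨v, hv⟩ := Submodule.mkQ_surjective _ (l w)
      have h3 := mem_midSub.1 hyg
      dsimp only at h3
      rw [hχ, LinearMap.smul_apply, ← hv, ← map_smul, eq_comm, ← sub_eq_zero, ← map_sub,
        mkQ_eq_zero_iff] at h3
      obtain ⟨s, hs⟩ := h3
      -- Here `s = a v - y`, so subtracting `s (0, x)` changes the value of `l` from `v` to `v - s /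
      -- a = y / a`.
      refine ⟨(w - s • fibGen ψ).1.2, ?_, ?_⟩
      · have : (w - s • fibGen ψ).1.1 = fibFst ψ w := by
          change w.1.1 - s • (0 : M) = _
          rw [smul_zero, sub_zero]; rfl
        change (fibFst ψ w, (w - s • fibGen ψ).1.2) ∈ fib ψ
        rw [← this]
        exact (w - s • fibGen ψ).2
      · have : (⟨(fibFst ψ w, (w - s • fibGen ψ).1.2), by
            have h4 : (w - s • fibGen ψ).1.1 = fibFst ψ w := by
              change w.1.1 - s • (0 : M) = _
              rw [smul_zero, sub_zero]; rfl
            rw [← h4]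
            exact (w - s • fibGen ψ).2⟩ : fib ψ) = w - s • fibGen ψ := by
          refine Subtype.ext (Prod.ext ?_ rfl)
          change w.1.1 = w.1.1 - s • (0 : M)
          rw [smul_zero, sub_zero]
        rw [this, map_sub, map_smul, hl, ← hv, ← map_smul, ← map_sub]
        congr 1
        change v - (s : ℚ_[p]) * (a : ℚ_[p])⁻¹ = y * (a : ℚ_[p])⁻¹
        rw [hs]
        change v - ((a : ℚ_[p]) * v - y) * (a : ℚ_[p])⁻¹ = y * (a : ℚ_[p])⁻¹
        field_simp
        ring
    choose φ hφ hφl using hex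
    have huniq' : ∀ (z : midSub χ) (f : F) (hf : (z.1.2, f) ∈ fib ψ), l ⟨(z.1.2, f), hf⟩ =
        (LinearMap.range (incl p)).mkQ (z.1.1 * (a : ℚ_[p])⁻¹) → φ z = f := by
      intro z f hf h
      have := huniq l hl ⟨_, hφ z⟩ ⟨_, hf⟩ rfl ((hφl z).trans h.symm)
      exact congrArg (fun w : fib ψ => w.1.2) this
    let φ' : midSub χ →ₗ[ℤ_[p]] F :=
      { toFun := φ
        map_add' := fun z w => by
          refine huniq' _ _ ((fib ψ).add_mem (hφ z) (hφ w)) ?_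
          refine (map_add l ⟨_, hφ z⟩ ⟨_, hφ w⟩).trans ?_
          rw [hφl, hφl, ← map_add, ← add_mul]
          rfl
        map_smul' := fun t z => by
          refine huniq' _ _ ((fib ψ).smul_mem t (hφ z)) ?_
          refine (map_smul l t ⟨_, hφ z⟩).trans ?_
          rw [hφl, ← map_smul, ← smul_mul_assoc]
          rfl }
    refine ⟨⟨⟨χ, φ'⟩, fun h => huniq' _ _ (fibGen ψ).2 ?_, hφ⟩, Subtype.ext (LinearMap.ext fun w => ?_)⟩
    · dsimp only
      rw [one_mul]
      exact hl
    · dsimp only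
      set c : ExtHom ψ := ⟨⟨χ, φ'⟩, fun h => huniq' _ _ (fibGen ψ).2 (by
        dsimp only
        rw [one_mul]
        exact hl), hφ⟩
      obtain ⟨z, hz⟩ := midSub_snd_surjective χ w.1.1
      obtain ⟨t, rfl⟩ := exists_smul_fibGen (z := w) (w := ⟨_, hφ z⟩) hz.symm
      rw [map_add, map_add, map_smul, map_smul, hgen, hl, hφl]
      congr 1
      exact hL c z

end Fibre

end

/-! ## The action on moments -/

section

variable {p : ℕ} [Fact p.Prime]

variable {M F : Type} [AddCommGroup M] [Module ℤ_[p] M] [AddCommGroup F] [Module ℤ_[p] F]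

theorem exists_annihilator [Finite F] (x : F) :
    ∃ a : ℤ_[p], a ≠ 0 ∧ ∀ t : ℤ_[p], t • x = 0 ↔ a ∣ t := by
  obtain ⟨a, ha⟩ := IsPrincipalIdealRing.principal (LinearMap.ker (LinearMap.toSpanSingleton ℤ_[p] F x))
  have ha1 : ∀ t : ℤ_[p], t • x = 0 ↔ a ∣ t := by
    intro t
    rw [← Ideal.mem_span_singleton, Ideal.span, ← ha]
    rfl
  refine ⟨a, ?_, ha1⟩
  rintro rfl
  obtain ⟨b, hb, h⟩ := exists_smul_eq_zero_of_finite (p := p) (M := F)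
  exact hb (zero_dvd_iff.1 ((ha1 b).1 (h x)))

/-- The submodule `ℤ_p` of the extension has image generated by that of `1`, so modulo this element
the surjection factors through `M`. -/
theorem exists_induced (c : Σ χ : M →ₗ[ℤ_[p]] QZ p, Sur ℤ_[p] (midSub χ) F) :
    ∃ ψ : Sur ℤ_[p] M (F ⧸ Submodule.span ℤ_[p] {c.2.1 ⟨_, one_mem_midSub c.1⟩}),
      ∀ z : midSub c.1, ψ.1 z.1.2 =
        (Submodule.span ℤ_[p] {c.2.1 ⟨_, one_mem_midSub c.1⟩}).mkQ (c.2.1 z) := by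
  obtain ⟨χ, φ, hφ⟩ := c
  dsimp only
  set x := φ ⟨_, one_mem_midSub χ⟩
  obtain ⟨ψ, hψ⟩ := exists_comp_eq (LinearMap.snd ℤ_[p] ℚ_[p] M ∘ₗ (midSub χ).subtype)
    (midSub_snd_surjective χ) ((Submodule.span ℤ_[p] {x}).mkQ ∘ₗ φ) (by
      rintro ⟨⟨y, g⟩, hyg⟩ hg
      obtain rfl : g = 0 := hg
      obtain ⟨t, rfl⟩ := exists_coe_of_mem_midSub hyg
      rw [← smul_one_midSub χ t, LinearMap.comp_apply, map_smul, Submodule.mkQ_apply,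
        Submodule.Quotient.mk_eq_zero]
      exact Submodule.smul_mem _ _ (Submodule.mem_span_singleton_self x))
  refine ⟨⟨ψ, fun y => ?_⟩, hψ⟩
  obtain ⟨f, rfl⟩ := Submodule.mkQ_surjective _ y
  obtain ⟨z, rfl⟩ := hφ f
  exact ⟨z.1.2, hψ z⟩

theorem extHom_surjective {x : F} {ψ : M →ₗ[ℤ_[p]] F ⧸ Submodule.span ℤ_[p] {x}}
    (hψ : Function.Surjective ψ) (c : ExtHom ψ) : Function.Surjective c.1.2 := by
  obtain ⟨⟨χ, φ⟩, h1, h2⟩ := c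
  intro f
  obtain ⟨g, hg⟩ := hψ ((Submodule.span ℤ_[p] {x}).mkQ f)
  obtain ⟨z, rfl⟩ := midSub_snd_surjective χ g
  have h3 := (h2 z).symm.trans hg
  rw [← sub_eq_zero, ← map_sub, Submodule.mkQ_apply, Submodule.Quotient.mk_eq_zero,
    Submodule.mem_span_singleton] at h3
  obtain ⟨t, ht⟩ := h3
  refine ⟨z - t • ⟨_, one_mem_midSub χ⟩, ?_⟩
  change φ _ = _
  rw [map_sub, map_smul]
  change φ z - t • φ ⟨_, one_mem_midSub χ⟩ = f
  rw [show φ ⟨_, one_mem_midSub χ⟩ = x from h1 _, ht]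
  abel

/-- The number of surjections from all extensions of `M` by `ℤ_p` to `F`. -/
theorem card_sigma_sur [Finite M] [Fintype F] :
    Nat.card (Σ χ : M →ₗ[ℤ_[p]] QZ p, Sur ℤ_[p] (midSub χ) F) =
      Nat.card M * ∑ x : F, nSur p M (F ⧸ Submodule.span ℤ_[p] {x}) := by
  let B := Σ x : F, Sur ℤ_[p] M (F ⧸ Submodule.span ℤ_[p] {x})
  choose I hI using exists_induced (p := p) (M := M) (F := F)
  let J : (Σ χ : M →ₗ[ℤ_[p]] QZ p, Sur ℤ_[p] (midSub χ) F) → B := fun c => ⟨_, I c⟩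
  -- Sort the surjections by the image `x` of `1` and the induced `ψ`; each fibre is `ExtHom ψ`,
  -- surjectivity being automatic when `ψ` is surjective.
  have hfib : ∀ b : B, Nat.card {c // J c = b} = Nat.card M := by
    rintro ⟨x, ψ, hψ⟩
    obtain ⟨a, ha0, ha⟩ := exists_annihilator (p := p) x
    rw [← card_extHom (ψ := ψ) ha0 ha]
    have hto : ∀ c : {c // J c = ⟨x, ψ, hψ⟩}, (∀ h, c.1.2.1 ⟨((1 : ℚ_[p]), 0), h⟩ = x) ∧
        ∀ z : midSub c.1.1, ψ z.1.2 = (Submodule.span ℤ_[p] {x}).mkQ (c.1.2.1 z) := by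
      rintro ⟨c, hc⟩
      have h1 : c.2.1 ⟨_, one_mem_midSub c.1⟩ = x := congrArg Sigma.fst hc
      subst h1
      have h2 : I c = ⟨ψ, hψ⟩ := eq_of_heq (Sigma.mk.inj hc).2
      refine ⟨fun _ => rfl, fun z => ?_⟩
      have h3 := hI c z
      rw [h2] at h3
      exact h3
    have hinv : ∀ c : ExtHom ψ, J ⟨c.1.1, c.1.2, extHom_surjective hψ c⟩ = ⟨x, ψ, hψ⟩ := by
      rintro ⟨⟨χ, φ⟩, h1, h2⟩
      obtain rfl := h1 (one_mem_midSub χ)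
      have hs := extHom_surjective hψ ⟨⟨χ, φ⟩, h1, h2⟩
      have h4 : I ⟨χ, φ, hs⟩ = ⟨ψ, hψ⟩ := by
        refine Subtype.ext (LinearMap.ext fun g => ?_)
        obtain ⟨z, rfl⟩ := midSub_snd_surjective χ g
        exact (hI ⟨χ, φ, hs⟩ z).trans (h2 z).symm
      exact congrArg (Sigma.mk (β := fun x : F =>
        Sur ℤ_[p] M (F ⧸ Submodule.span ℤ_[p] {x})) (φ ⟨_, one_mem_midSub χ⟩)) h4
    exact Nat.card_congr
      { toFun := fun c => ⟨⟨c.1.1, c.1.2.1⟩, hto c⟩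
        invFun := fun c => ⟨⟨c.1.1, c.1.2, extHom_surjective hψ c⟩, hinv c⟩
        left_inv := fun c => rfl
        right_inv := fun c => rfl }
  have hB : Finite B := inferInstance
  have : Fintype B := Fintype.ofFinite B
  have hff : ∀ b : B, Finite {c // J c = b} := fun b =>
    Nat.finite_of_card_ne_zero (by rw [hfib]; exact Nat.card_pos.ne')
  rw [← Nat.card_congr (Equiv.sigmaFiberEquiv J), Nat.card_sigma]
  simp_rw [hfib]
  rw [Finset.sum_const, smul_eq_mul, mul_comm, Finset.card_univ, ← Nat.card_eq_fintype_card,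
    Nat.card_sigma]
  rfl

theorem pDStar_moment (G : X0 p) [Fintype F] :
    ∑' H : X1 p, pDStar G H * nSur p H.rep F =
      ∑ x : F, (nSur p G.rep (F ⧸ Submodule.span ℤ_[p] {x}) : ENNReal) := by
  have hG0 : (Nat.card G.rep : ENNReal) ≠ 0 := by exact_mod_cast Nat.card_pos.ne'
  have : Fintype (G.rep →ₗ[ℤ_[p]] QZ p) := Fintype.ofFinite _
  have h1 : ∀ χ : G.rep →ₗ[ℤ_[p]] QZ p,
      nSur p (X1.of (midSub χ) (midSub_rank χ)).rep F = Nat.card (Sur ℤ_[p] (midSub χ) F) :=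
    fun χ => nSur_congr (X1.rep_of _ _).some (LinearEquiv.refl _ _)
  have h2 : ∀ χ : G.rep →ₗ[ℤ_[p]] QZ p, Finite (Sur ℤ_[p] (midSub χ) F) := fun χ => by
    have := (midSub_rank χ).1
    infer_instance
  rw [tsum_pDStar_mul, tsum_fintype]
  simp_rw [h1]
  rw [← Nat.cast_sum, ← Nat.card_sigma, card_sigma_sur, Nat.cast_mul, mul_comm, ← mul_assoc,
    ENNReal.inv_mul_cancel hG0 (ENNReal.natCast_ne_top _), one_mul, Nat.cast_sum]

/-- The average of a function after one step of the random walk on `X₀`. -/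
def walk (h : X0 p → ENNReal) (G : X0 p) : ENNReal :=
  ∑' H : X1 p, pDStar G H * ∑' G' : X0 p, pD H G' * h G'

/-- The function `G ↦ #Sur(G, F)`. -/
def surFun (F : Type) [AddCommGroup F] [Module ℤ_[p] F] (G : X0 p) : ENNReal := nSur p G.rep F

/-- The term `x = 0` returns `#Sur(·, F)` with factor `1 / #F`, and all other terms involve strictly
smaller groups. This triangularity governs the rest of the proof. -/
theorem walk_surFun [Fintype F] (G : X0 p) :
    walk (surFun F) G = (Nat.card F : ENNReal)⁻¹ *
      ∑ x : F, surFun (F ⧸ Submodule.span ℤ_[p] {x}) G := by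
  simp_rw [walk, surFun, pD_moment, ← mul_assoc]
  rw [ENNReal.tsum_mul_right, pDStar_moment, mul_comm]

end

/-! ## Surjections to elementary abelian groups -/

section

variable {p : ℕ} [Fact p.Prime]

variable (p) in
/-- The residue field of `ℤ_p`. -/
abbrev Res : Type := IsLocalRing.ResidueField ℤ_[p]

theorem card_res : Nat.card (Res p) = p := by
  have h := card_quotient_span_pow (p := p) 1
  rw [pow_one, pow_one] at h
  have e : Res p ≃ ℤ_[p] ⧸ Submodule.span ℤ_[p] {(p : ℤ_[p])} :=
    (Ideal.quotEquivOfEq (PadicInt.maximalIdeal_eq_span_p (p := p))).toEquiv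
  rw [Nat.card_congr e, h]

instance : Finite (Res p) :=
  Nat.finite_of_card_ne_zero (by rw [card_res]; exact (Fact.out : p.Prime).ne_zero)

instance : Fintype (Res p) := Fintype.ofFinite _

theorem residue_smul (a : ℤ_[p]) (x : Res p) : a • x = IsLocalRing.residue ℤ_[p] a * x :=
  Algebra.smul_def a x

variable (N : Type) [AddCommGroup N] [Module ℤ_[p] N]

variable (p) in
/-- The rank of the quotient of a module by its multiples of `p`. -/
def rk : ℕ := Module.finrank (Res p) (N →ₗ[ℤ_[p]] Res p)

theorem card_hom_res [Module.Finite ℤ_[p] N] : Nat.card (N →ₗ[ℤ_[p]] Res p) = p ^ rk p N := by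
  have : Module.Finite (Res p) (N →ₗ[ℤ_[p]] Res p) := Module.Finite.of_finite
  rw [Module.natCard_eq_pow_finrank (K := Res p), card_res, rk]

variable {N} in
-- The image is a subspace over the residue field, and it is proper exactly when a nonzero linear
-- form vanishes on it, which is a linear relation among the coordinates.
theorem surjective_pi_iff {k : ℕ} (φ : N →ₗ[ℤ_[p]] (Fin k → Res p)) :
    Function.Surjective φ ↔
      LinearIndependent (Res p) fun i => LinearMap.proj (R := ℤ_[p]) (φ := fun _ => Res p) i ∘ₗ φ := by
  rw [Fintype.linearIndependent_iff]
  have hsum : ∀ (g : Fin k → Res p) (x : N),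
      (∑ i, g i • (LinearMap.proj (R := ℤ_[p]) (φ := fun _ => Res p) i ∘ₗ φ)) x =
        ∑ i, g i * φ x i := by
    intro g x
    rw [LinearMap.sum_apply]
    rfl
  constructor
  · intro h g hg i
    obtain ⟨x, hx⟩ := h (Pi.single i 1)
    have := hsum g x
    rw [hg, LinearMap.zero_apply, hx] at this
    simpa [Pi.single_apply] using this.symm
  · intro h
    let W : Submodule (Res p) (Fin k → Res p) :=
      { carrier := Set.range φ
        add_mem' := by
          rintro _ _ ⟨x, rfl⟩ ⟨y, rfl⟩
          exact ⟨x + y, map_add _ _ _⟩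
        zero_mem' := ⟨0, map_zero _⟩
        smul_mem' := by
          rintro c _ ⟨x, rfl⟩
          obtain ⟨a, rfl⟩ := IsLocalRing.residue_surjective c
          refine ⟨a • x, ?_⟩
          rw [map_smul]
          ext i
          exact residue_smul a _ }
    by_contra hns
    have hW : W < ⊤ := by
      rw [lt_top_iff_ne_top]
      intro hW
      exact hns fun y => by
        have : y ∈ W := hW ▸ Submodule.mem_top
        exact this
    obtain ⟨f, hf0, hf⟩ := W.exists_le_ker_of_lt_top hW
    refine hf0 (LinearMap.pi_ext' fun i => LinearMap.ext_ring ?_)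
    refine h (fun i => f (Pi.single i 1)) ?_ i
    ext x
    rw [hsum, LinearMap.zero_apply]
    have h1 : f (φ x) = 0 := hf (show φ x ∈ W from ⟨x, rfl⟩)
    rw [← h1]
    conv_rhs => rw [← Finset.univ_sum_single (φ x), map_sum]
    refine Finset.sum_congr rfl fun i _ => ?_
    rw [show (Pi.single i (φ x i) : Fin k → Res p) = φ x i • Pi.single i 1 by
      rw [← Pi.single_smul, smul_eq_mul, mul_one], map_smul, smul_eq_mul, mul_comm]

theorem nSur_pi [Module.Finite ℤ_[p] N] (k : ℕ) :
    nSur p N (Fin k → Res p) = ∏ i ∈ Finset.range k, (p ^ rk p N - p ^ i) := by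
  have hV : Module.Finite (Res p) (N →ₗ[ℤ_[p]] Res p) := Module.Finite.of_finite
  have : Fintype (N →ₗ[ℤ_[p]] Res p) := Fintype.ofFinite _
  let e : (N →ₗ[ℤ_[p]] (Fin k → Res p)) ≃ (Fin k → (N →ₗ[ℤ_[p]] Res p)) :=
    { toFun := fun φ i => LinearMap.proj i ∘ₗ φ
      invFun := fun f => LinearMap.pi f
      left_inv := fun φ => rfl
      right_inv := fun f => rfl }
  rw [nSur, Nat.card_congr (Equiv.subtypeEquiv (q := fun f => LinearIndependent (Res p) f) e
    fun φ => surjective_pi_iff φ)]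
  by_cases hk : k ≤ rk p N
  · have h := card_linearIndependent (K := Res p) (V := N →ₗ[ℤ_[p]] Res p) hk
    rw [h, ← Nat.card_eq_fintype_card, card_res, ← Fin.prod_univ_eq_prod_range]
    rfl
  -- For `k > rk` the factor with `i = rk` is zero, so the truncated subtractions after it are
  -- harmless.
  · rw [Finset.prod_eq_zero (f := fun i => p ^ rk p N - p ^ i)
      (Finset.mem_range.2 (not_le.1 hk)) (Nat.sub_self _), Nat.card_eq_zero]
    left
    refine ⟨fun f => hk ?_⟩
    have := f.2.fintype_card_le_finrank
    rwa [Fintype.card_fin] at this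

theorem nSur_pi_cast [Module.Finite ℤ_[p] N] (k : ℕ) :
    (nSur p N (Fin k → Res p) : ℝ) = ∏ i ∈ Finset.range k, ((p : ℝ) ^ rk p N - (p : ℝ) ^ i) := by
  have hp : 0 < p := (Fact.out : p.Prime).pos
  rw [nSur_pi]
  by_cases hk : k ≤ rk p N
  · rw [Nat.cast_prod]
    refine Finset.prod_congr rfl fun i hi => ?_
    rw [Nat.cast_sub (Nat.pow_le_pow_right hp ((Finset.mem_range.1 hi).le.trans hk)), Nat.cast_pow,
      Nat.cast_pow]
  · rw [Finset.prod_eq_zero (f := fun i => p ^ rk p N - p ^ i)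
        (Finset.mem_range.2 (not_le.1 hk)) (Nat.sub_self _),
      Finset.prod_eq_zero (f := fun i => (p : ℝ) ^ rk p N - (p : ℝ) ^ i)
        (Finset.mem_range.2 (not_le.1 hk)) (sub_self _), Nat.cast_zero]

theorem rk_pi (k : ℕ) : rk p (Fin k → Res p) = k := by
  have hp : 1 < p := (Fact.out : p.Prime).one_lt
  refine Nat.pow_right_injective hp ?_
  change p ^ _ = p ^ k
  rw [← card_hom_res]
  have e : ((Fin k → Res p) →ₗ[ℤ_[p]] Res p) ≃ (Fin k → Res p) :=
    { toFun := fun f i => f (Pi.single i 1)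
      invFun := fun g => ∑ i, g i • LinearMap.proj (R := ℤ_[p]) (φ := fun _ => Res p) i
      left_inv := fun f => by
        refine LinearMap.pi_ext fun i x => ?_
        obtain ⟨a, rfl⟩ := IsLocalRing.residue_surjective x
        have h : (Pi.single i (IsLocalRing.residue ℤ_[p] a) : Fin k → Res p) =
            a • Pi.single i 1 := by
          rw [← Pi.single_smul, residue_smul, mul_one]
        rw [h, map_smul, map_smul]
        simp [LinearMap.sum_apply, Pi.single_apply]
      right_inv := fun g => by
        ext i
        simp [LinearMap.sum_apply, Pi.single_apply] }
  rw [Nat.card_congr e, Nat.card_fun, card_res, Nat.card_eq_fintype_card, Fintype.card_fin]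

theorem card_aut_eq_nSur [Finite N] : Nat.card (N ≃ₗ[ℤ_[p]] N) = nSur p N N := by
  refine Nat.card_congr
    { toFun := fun e => ⟨e.toLinearMap, e.surjective⟩
      invFun := fun f => LinearEquiv.ofBijective f.1 ⟨Finite.injective_iff_surjective.2 f.2, f.2⟩
      left_inv := fun e => by ext; rfl
      right_inv := fun f => by ext; rfl }

variable (p) in
/-- The order of the general linear group of rank `k` over the field with `p` elements. -/
def gl (k : ℕ) : ℝ := ∏ i ∈ Finset.range k, ((p : ℝ) ^ k - (p : ℝ) ^ i)

theorem card_aut_pi (k : ℕ) :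
    (Nat.card ((Fin k → Res p) ≃ₗ[ℤ_[p]] (Fin k → Res p)) : ℝ) = gl p k := by
  rw [card_aut_eq_nSur, nSur_pi_cast, rk_pi, gl]

theorem one_lt_p : (1 : ℝ) < p := by exact_mod_cast (Fact.out : p.Prime).one_lt

theorem gl_pos (k : ℕ) : 0 < gl p k :=
  Finset.prod_pos fun _ hi => sub_pos.2 (pow_lt_pow_right₀ one_lt_p (Finset.mem_range.1 hi))

theorem gl_succ {p : ℕ} (k : ℕ) : gl p (k + 1) = ((p : ℝ) ^ (k + 1) - 1) * (p : ℝ) ^ k * gl p k := by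
  rw [gl, Finset.prod_range_succ', pow_zero, gl, mul_comm, mul_assoc]
  congr 1
  have (i : ℕ) (_ : i ∈ Finset.range k) : (p : ℝ) ^ (k + 1) - (p : ℝ) ^ (i + 1) =
      p * ((p : ℝ) ^ k - (p : ℝ) ^ i) := by ring
  rw [Finset.prod_congr rfl this, Finset.prod_mul_distrib, Finset.prod_const, Finset.card_range]

variable (p) in
/-- The coefficients of the Möbius inversion. -/
def mob (k : ℕ) : ℝ := (p : ℝ) ^ (k.choose 2) / gl p k

theorem mob_succ (k : ℕ) : mob p k = mob p (k + 1) * ((p : ℝ) ^ (k + 1) - 1) := by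
  have h1 := (gl_pos (p := p) k).ne'
  have hp : (p : ℝ) ≠ 0 := by exact_mod_cast (Fact.out : p.Prime).ne_zero
  have h2 : ((p : ℝ) ^ (k + 1) - 1) ≠ 0 := by
    have := one_lt_pow₀ (one_lt_p (p := p)) (Nat.succ_ne_zero k)
    exact (sub_pos.2 this).ne'
  rw [mob, mob, gl_succ, Nat.choose_succ_succ' k 1, Nat.choose_one_right, pow_add]
  field_simp

/-- A telescoping `q`-binomial identity: every partial sum is a single product, whose roots are `p,
…, p ^ n`. -/
theorem sum_mob (n : ℕ) (y : ℝ) :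
    ∑ k ∈ Finset.range (n + 1), (-1) ^ k * mob p k * ∏ i ∈ Finset.range k, (y - (p : ℝ) ^ i) =
      (-1) ^ n * mob p n * ∏ i ∈ Finset.range n, (y - (p : ℝ) ^ (i + 1)) := by
  induction n with
  | zero => simp
  | succ n ih =>
    rw [Finset.sum_range_succ, ih, Finset.prod_range_succ' (fun i => y - (p : ℝ) ^ i),
      Finset.prod_range_succ (fun i => y - (p : ℝ) ^ (i + 1)), mob_succ n]
    ring

/-- Möbius inversion on the lattice of subgroups. -/
theorem sum_mob_nSur [Module.Finite ℤ_[p] N] (n : ℕ) (hn : rk p N ≤ n) :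
    ∑ k ∈ Finset.range (n + 1), (-1) ^ k * mob p k * (nSur p N (Fin k → Res p) : ℝ) =
      if rk p N = 0 then 1 else 0 := by
  have h : ∀ n, rk p N ≤ n → ∑ k ∈ Finset.range (n + 1), (-1) ^ k * mob p k *
      (nSur p N (Fin k → Res p) : ℝ) = ∑ k ∈ Finset.range (rk p N + 1), (-1) ^ k * mob p k *
        (nSur p N (Fin k → Res p) : ℝ) := by
    intro n hn
    refine (Finset.sum_subset (Finset.range_subset_range.2 (by omega)) fun k _ hk => ?_).symm
    have hk' : rk p N < k := by simpa using hk
    rw [nSur_pi_cast, Finset.prod_eq_zero (Finset.mem_range.2 hk') (sub_self _), mul_zero]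
  rw [h n hn]
  simp_rw [nSur_pi_cast]
  rw [sum_mob]
  split_ifs with h0
  · rw [h0]; simp [mob, gl]
  -- At `y = p ^ rk` with `rk ≥ 1`, the factor with index `rk - 1` of the product is zero.
  · have : rk p N - 1 ∈ Finset.range (rk p N) := by simp; omega
    rw [Finset.prod_eq_zero this (by rw [Nat.sub_add_cancel (by omega)]; exact sub_self _), mul_zero]

/-- A finitely generated module that is not trivial has a simple quotient. -/
theorem exists_quotient_equiv_res [Module.Finite ℤ_[p] N] [Nontrivial N] :
    ∃ K : Submodule ℤ_[p] N, K ≠ ⊤ ∧ Nonempty ((N ⧸ K) ≃ₗ[ℤ_[p]] Res p) := by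
  obtain ⟨K, hK, -⟩ :=
    (eq_top_or_exists_le_coatom (⊥ : Submodule ℤ_[p] N)).resolve_left bot_ne_top
  have hsimple : IsSimpleModule ℤ_[p] (N ⧸ K) := isSimpleModule_iff_isCoatom.2 hK
  obtain ⟨I, hI, e⟩ := isSimpleModule_iff_quot_maximal.1 hsimple
  obtain rfl := IsLocalRing.eq_maximalIdeal hI
  exact ⟨K, hK.1, e⟩

variable {N} in
theorem subsingleton_of_rk_eq_zero [Module.Finite ℤ_[p] N] (h : rk p N = 0) : Subsingleton N := by
  have hc := card_hom_res (p := p) N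
  rw [h, pow_zero, Nat.card_eq_one_iff_unique] at hc
  have hs := hc.1
  by_contra hN
  rw [not_subsingleton_iff_nontrivial] at hN
  obtain ⟨K, hK, ⟨e⟩⟩ := exists_quotient_equiv_res (p := p) N
  have h0 : e.toLinearMap ∘ₗ K.mkQ = 0 := Subsingleton.elim _ _
  refine hK (eq_top_iff.2 fun x _ => ?_)
  have h1 := LinearMap.congr_fun h0 x
  rw [LinearMap.comp_apply, LinearMap.zero_apply] at h1
  rw [← Submodule.Quotient.mk_eq_zero]
  exact e.injective (h1.trans (map_zero e).symm)

end

/-! ## The averages of the random walk and the summability of the moments -/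

section

variable {p : ℕ} [Fact p.Prime]

open Filter Topology

/-- By reversibility both sides equal the sum over `H` of `w H` times the averages of `h` and of `k`
after the step `d`. -/
theorem walk_symm (h k : X0 p → ENNReal) :
    ∑' G, (cardAut G : ENNReal)⁻¹ * (h G * walk k G) =
      ∑' G, (cardAut G : ENNReal)⁻¹ * (k G * walk h G) := by
  obtain ⟨w, hw⟩ := exists_reversible (p := p)
  have key : ∀ h k : X0 p → ENNReal, ∑' G, (cardAut G : ENNReal)⁻¹ * (h G * walk k G) =
      ∑' H, w H * ((∑' G, pD H G * h G) * ∑' G, pD H G * k G) := by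
    intro h k
    have h1 : ∀ G, (cardAut G : ENNReal)⁻¹ * (h G * walk k G) =
        ∑' H, w H * ((pD H G * h G) * ∑' G', pD H G' * k G') := by
      intro G
      rw [walk, ← ENNReal.tsum_mul_left, ← ENNReal.tsum_mul_left]
      refine tsum_congr fun H => ?_
      rw [← mul_assoc, ← mul_assoc, ← mul_assoc, ← mul_assoc, ← hw]
      ring
    simp_rw [h1]
    rw [ENNReal.tsum_comm]
    refine tsum_congr fun H => ?_
    rw [ENNReal.tsum_mul_left, ENNReal.tsum_mul_right]
  rw [key, key]
  exact tsum_congr fun H => by rw [mul_comm (∑' G, pD H G * h G)]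

theorem walk_iterate_symm (n : ℕ) (h k : X0 p → ENNReal) :
    ∑' G, (cardAut G : ENNReal)⁻¹ * (h G * walk^[n] k G) =
      ∑' G, (cardAut G : ENNReal)⁻¹ * (k G * walk^[n] h G) := by
  induction n generalizing h k with
  | zero => exact tsum_congr fun G => by rw [Function.iterate_zero, id, id, mul_comm (h G)]
  | succ n ih =>
    rw [Function.iterate_succ_apply, ih, Function.iterate_succ_apply' walk n h, ← walk_symm]
    exact tsum_congr fun G => by rw [mul_comm (walk k G)]

theorem walk_mono : Monotone (walk (p := p)) := fun _ _ hk _ =>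
  ENNReal.tsum_le_tsum fun _ => mul_le_mul_right (ENNReal.tsum_le_tsum fun G' =>
    mul_le_mul_right (hk G') _) _

theorem walk_add (h k : X0 p → ENNReal) : walk (h + k) = walk h + walk k := by
  ext G
  simp only [walk, Pi.add_apply, mul_add, ENNReal.tsum_add]

theorem walk_smul (c : ENNReal) (h : X0 p → ENNReal) : walk (c • h) = c • walk h := by
  ext G
  simp only [walk, Pi.smul_apply, smul_eq_mul, mul_left_comm _ c, ENNReal.tsum_mul_left]

variable (p) in
/-- The averaging operator as a linear map. -/
def walkHom : (X0 p → ENNReal) →ₗ[ENNReal] (X0 p → ENNReal) where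
  toFun := walk
  map_add' := walk_add
  map_smul' := walk_smul

theorem walkHom_pow (n : ℕ) (h : X0 p → ENNReal) : (walkHom p ^ n) h = walk^[n] h := by
  rw [Module.End.pow_apply]
  rfl

theorem surFun_congr {F F' : Type} [AddCommGroup F] [Module ℤ_[p] F] [AddCommGroup F']
    [Module ℤ_[p] F'] (e : F ≃ₗ[ℤ_[p]] F') : surFun (p := p) F = surFun F' := by
  ext G
  rw [surFun, surFun, nSur_congr (LinearEquiv.refl _ _) e]

theorem nSur_zero_target (G : Type) [AddCommGroup G] [Module ℤ_[p] G] (F : Type) [AddCommGroup F]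
    [Module ℤ_[p] F] [Subsingleton F] : nSur p G F = 1 := by
  have : Unique (Sur ℤ_[p] G F) :=
    { default := ⟨0, fun x => ⟨0, Subsingleton.elim _ _⟩⟩
      uniq := fun f => Subtype.ext (LinearMap.ext fun x => Subsingleton.elim _ _) }
  exact Nat.card_unique

theorem surFun_of_subsingleton (F : Type) [AddCommGroup F] [Module ℤ_[p] F] [Subsingleton F] :
    surFun (p := p) F = 1 := by
  ext G
  rw [surFun, nSur_zero_target, Nat.cast_one, Pi.one_apply]

theorem card_quotient_span_lt {F : Type} [AddCommGroup F] [Module ℤ_[p] F] [Finite F] {x : F}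
    (hx : x ≠ 0) : Nat.card (F ⧸ Submodule.span ℤ_[p] {x}) < Nat.card F := by
  rw [card_eq_card_submodule_mul_card_quotient (R := ℤ_[p]) (Submodule.span ℤ_[p] {x})]
  have : Nontrivial (Submodule.span ℤ_[p] {x}) :=
    Submodule.nontrivial_span_singleton hx
  exact lt_mul_of_one_lt_left Nat.card_pos Finite.one_lt_card

/-- A sequence that is contracted by a factor, with a perturbation tending to zero. -/
theorem tendsto_zero_of_contraction {r : ℝ} (hr0 : 0 ≤ r) (hr : r < 1) {v e : ℕ → ℝ}
    (hv : ∀ n, v (n + 1) = r * v n + e n) (he : Tendsto e atTop (𝓝 0)) :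
    Tendsto v atTop (𝓝 0) := by
  rw [Metric.tendsto_atTop]
  intro ε hε
  have h1 : 0 < ε / 2 * (1 - r) := mul_pos (by linarith) (by linarith)
  obtain ⟨N, hN⟩ := Metric.tendsto_atTop.1 he _ h1
  have h2 : ∀ k, |v (N + k)| ≤ ε / 2 + r ^ k * |v N| := by
    intro k
    induction k with
    | zero => simp only [add_zero, pow_zero, one_mul]; linarith
    | succ k ih =>
      have h3 := hN (N + k) (Nat.le_add_right _ _)
      rw [Real.dist_eq, sub_zero] at h3
      rw [← add_assoc, hv]
      calc |r * v (N + k) + e (N + k)| ≤ |r * v (N + k)| + |e (N + k)| := abs_add_le _ _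
        _ = r * |v (N + k)| + |e (N + k)| := by rw [abs_mul, abs_of_nonneg hr0]
        _ ≤ r * (ε / 2 + r ^ k * |v N|) + ε / 2 * (1 - r) := by gcongr
        _ = _ := by ring
  have h4 : Tendsto (fun k => r ^ k * |v N|) atTop (𝓝 (0 * |v N|)) :=
    (tendsto_pow_atTop_nhds_zero_of_lt_one hr0 hr).mul_const _
  rw [zero_mul] at h4
  obtain ⟨K, hK⟩ := Metric.tendsto_atTop.1 h4 (ε / 2) (by linarith)
  refine ⟨N + K, fun n hn => ?_⟩
  obtain ⟨k, rfl⟩ := Nat.exists_eq_add_of_le ((Nat.le_add_right N K).trans hn)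
  have h5 := hK k (by omega)
  rw [Real.dist_eq, sub_zero, abs_of_nonneg (by positivity)] at h5
  rw [Real.dist_eq, sub_zero]
  linarith [h2 k]

/-- The fixed point of `u ↦ (u + q - 1) / q` is `1`, and the deviation from it shrinks by the factor
`1 / q` at each step. -/
theorem tendsto_one_of_average {q : ℕ} (hq : 1 < q) {u b : ℕ → ENNReal} (hu : ∀ n, u n ≠ ⊤)
    (hb : ∀ n, b n ≠ ⊤) (h : ∀ n, u (n + 1) = (q : ENNReal)⁻¹ * (u n + b n))
    (hb' : Tendsto b atTop (𝓝 ((q - 1 : ℕ) : ENNReal))) : Tendsto u atTop (𝓝 1) := by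
  have hq' : (1 : ℝ) < q := by exact_mod_cast hq
  rw [← ENNReal.tendsto_toReal_iff hu ENNReal.one_ne_top, ENNReal.toReal_one,
    ← tendsto_sub_nhds_zero_iff]
  refine tendsto_zero_of_contraction (r := (q : ℝ)⁻¹) (by positivity) (inv_lt_one_of_one_lt₀ hq')
    (e := fun n => (q : ℝ)⁻¹ * ((b n).toReal - (q - 1))) (fun n => ?_) ?_
  · rw [h, ENNReal.toReal_mul, ENNReal.toReal_inv, ENNReal.toReal_natCast,
      ENNReal.toReal_add (hu n) (hb n)]
    field_simp
    ring
  · rw [← ENNReal.tendsto_toReal_iff hb (ENNReal.natCast_ne_top _), ENNReal.toReal_natCast,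
      Nat.cast_sub hq.le, Nat.cast_one, ← tendsto_sub_nhds_zero_iff] at hb'
    simpa using hb'.const_mul (q : ℝ)⁻¹

/-- The averages of the number of surjections converge to one. -/
theorem walk_iterate_surFun (n : ℕ) : ∀ (F : Type) [AddCommGroup F] [Module ℤ_[p] F] [Finite F],
    Nat.card F = n → ∀ G : X0 p, (∀ k, walk^[k] (surFun F) G ≠ ⊤) ∧
      Tendsto (fun k => walk^[k] (surFun F) G) atTop (𝓝 1) := by
  induction n using Nat.strong_induction_on with
  | _ n ih =>
    intro F _ _ _ hn G
    classical
    have : Fintype F := Fintype.ofFinite F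
    have h0 : surFun (p := p) (F ⧸ Submodule.span ℤ_[p] {(0 : F)}) = surFun F :=
      surFun_congr (Submodule.quotEquivOfEqBot _ (Submodule.span_zero_singleton _))
    -- Separate `x = 0`; the remaining `n - 1` terms belong to smaller groups, whose averages tend
    -- to `1` by induction.
    have hstep : walk (surFun (p := p) F) = (n : ENNReal)⁻¹ • (surFun F +
        ∑ x ∈ Finset.univ.erase (0 : F), surFun (F ⧸ Submodule.span ℤ_[p] {x})) := by
      ext G'
      rw [walk_surFun, ← Finset.add_sum_erase _ _ (Finset.mem_univ (0 : F)), h0, hn,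
        Pi.smul_apply, Pi.add_apply, Finset.sum_apply, smul_eq_mul]
    have hrec : ∀ k, walk^[k + 1] (surFun (p := p) F) G = (n : ENNReal)⁻¹ *
        (walk^[k] (surFun F) G + ∑ x ∈ Finset.univ.erase (0 : F),
          walk^[k] (surFun (F ⧸ Submodule.span ℤ_[p] {x})) G) := by
      intro k
      simp only [Function.iterate_succ_apply, hstep, ← walkHom_pow]
      rw [map_smul, map_add, map_sum, Pi.smul_apply, Pi.add_apply, Finset.sum_apply, smul_eq_mul]
    have hx : ∀ x ∈ Finset.univ.erase (0 : F), ∀ G : X0 p,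
        (∀ k, walk^[k] (surFun (F ⧸ Submodule.span ℤ_[p] {x})) G ≠ ⊤) ∧
        Tendsto (fun k => walk^[k] (surFun (F ⧸ Submodule.span ℤ_[p] {x})) G) atTop (𝓝 1) :=
      fun x hx => ih _ (hn ▸ card_quotient_span_lt (Finset.ne_of_mem_erase hx)) _ rfl
    have hb : ∀ k, (∑ x ∈ Finset.univ.erase (0 : F),
        walk^[k] (surFun (F ⧸ Submodule.span ℤ_[p] {x})) G) ≠ ⊤ := fun k =>
      ENNReal.sum_ne_top.2 fun x h => (hx x h G).1 k
    have hn0 : n ≠ 0 := hn ▸ Nat.card_pos.ne'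
    have hu : ∀ k, walk^[k] (surFun F) G ≠ ⊤ := by
      intro k
      induction k with
      | zero => exact ENNReal.natCast_ne_top _
      | succ k ihk =>
        rw [hrec]
        exact ENNReal.mul_ne_top (ENNReal.inv_ne_top.2 (Nat.cast_ne_zero.2 hn0))
          (ENNReal.add_ne_top.2 ⟨ihk, hb k⟩)
    refine ⟨hu, ?_⟩
    have hne : ∀ x ∈ Finset.univ.erase (0 : F), x ≠ 0 := fun x => Finset.ne_of_mem_erase
    rcases Nat.lt_or_ge 1 n with h1 | h1
    · refine tendsto_one_of_average h1 hu hb hrec ?_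
      have := tendsto_finsetSum (Finset.univ.erase (0 : F)) fun x h => (hx x h G).2
      rwa [Finset.sum_const, Finset.card_erase_of_mem (Finset.mem_univ _), Finset.card_univ,
        ← Nat.card_eq_fintype_card, hn, nsmul_eq_mul, mul_one] at this
    · have hs : Subsingleton F := Finite.card_le_one_iff_subsingleton.1 (hn ▸ h1)
      have hn1 : n = 1 := by omega
      have hc : ∀ k, walk^[k] (surFun F) G = 1 := by
        intro k
        induction k with
        | zero => exact congrFun (surFun_of_subsingleton F) G
        | succ k ihk =>
          rw [hrec, ihk, Finset.sum_eq_zero fun x hx =>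
            absurd (Subsingleton.elim x 0) (hne x hx), hn1]
          simp
      simp_rw [hc]
      exact tendsto_const_nhds

/-! ### Return to the trivial group and finiteness of the moments -/

variable (p) in
/-- The class of the trivial group. -/
def X0.zero : X0 p := X0.of PUnit

theorem X0.eq_zero (G : X0 p) [Subsingleton G.rep] : G = X0.zero p :=
  ((X0.of_eq_iff _ _).2 ⟨LinearEquiv.ofSubsingleton _ _⟩).symm

open Classical in
/-- A lower bound for the indicator function of the trivial group. -/
theorem indicator_bound (G : X0 p) :
    (p ^ 3 - 1) * (p ^ 2 - 1) * (p - 1) + (p ^ 3 - 1) * nSur p G.rep (Fin 2 → Res p) ≤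
      (p ^ 3 - 1) * (p ^ 2 - 1) * (p - 1) * (if G = X0.zero p then 1 else 0) +
      (p ^ 3 - 1) * (p ^ 2 - 1) * nSur p G.rep (Fin 1 → Res p) +
        nSur p G.rep (Fin 3 → Res p) := by
  have hp : 1 ≤ p := (Fact.out : p.Prime).one_lt.le
  have hp1 := one_lt_p (p := p)
  rw [← Nat.cast_le (α := ℝ)]
  push_cast [Nat.cast_sub hp, Nat.cast_sub (Nat.one_le_pow 2 p hp),
    Nat.cast_sub (Nat.one_le_pow 3 p hp)]
  simp only [nSur_pi_cast, Finset.prod_range_succ, Finset.prod_range_zero, one_mul, pow_zero,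
    pow_one]
  split_ifs with h
  · have hs : Subsingleton G.rep := by
      rw [h]
      exact (X0.rep_of PUnit).some.toEquiv.subsingleton
    have hr : rk p G.rep = 0 := by
      have : Subsingleton (G.rep →ₗ[ℤ_[p]] Res p) := ⟨fun f g => LinearMap.ext fun x => by
        rw [Subsingleton.elim x 0, map_zero, map_zero]⟩
      exact Module.finrank_zero_of_subsingleton
    simp [hr]
  · have hr : rk p G.rep ≠ 0 := fun hr => h (by
      have := subsingleton_of_rk_eq_zero hr
      exact X0.eq_zero G)
    -- This is Möbius inversion truncated at `k = 3`: in terms of `y = p ^ rk` the claim for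
    -- nontrivial groups reads `(y - p) (y - p ^ 2) (y - p ^ 3) ≥ 0`, expanded in the counts of
    -- surjections to `𝔽_p ^ k`.
    have key : 0 ≤ ((p : ℝ) ^ rk p G.rep - p) * ((p : ℝ) ^ rk p G.rep - p ^ 2) *
        ((p : ℝ) ^ rk p G.rep - p ^ 3) := by
      obtain hr1 | hr1 | hr1 : rk p G.rep = 1 ∨ rk p G.rep = 2 ∨ 3 ≤ rk p G.rep := by omega
      · rw [hr1]; simp
      · rw [hr1]; simp
      · have h1 := pow_le_pow_right₀ hp1.le (show 1 ≤ rk p G.rep by omega)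
        have h2 := pow_le_pow_right₀ hp1.le (show 2 ≤ rk p G.rep by omega)
        have h3 := pow_le_pow_right₀ hp1.le hr1
        rw [pow_one] at h1
        exact mul_nonneg (mul_nonneg (sub_nonneg.2 h1) (sub_nonneg.2 h2)) (sub_nonneg.2 h3)
    nlinarith [key]

open Classical in
/-- The walk returns to the trivial group with a probability bounded below. -/
theorem exists_walk_zero_bound : ∃ D : ENNReal, D ≠ ⊤ ∧ ∀ G : X0 p, ∀ᶠ n in atTop,
    1 ≤ D * walk^[n] (Pi.single (X0.zero p) 1) G := by
  have hp2 : 2 ≤ p := (Fact.out : p.Prime).two_le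
  set B : ℕ := p ^ 3 - 1
  set A : ℕ := B * (p ^ 2 - 1)
  set D : ℕ := A * (p - 1)
  refine ⟨(D : ENNReal), ENNReal.natCast_ne_top _, fun G => ?_⟩
  have hDA : A ≤ D := Nat.le_mul_of_pos_right _ (by omega)
  have hB : 7 ≤ B := by
    have : 2 ^ 3 ≤ p ^ 3 := Nat.pow_le_pow_left hp2 3
    omega
  have hlim := fun k : ℕ => (walk_iterate_surFun (p := p) _ (Fin k → Res p) rfl G).2
  have hone : Tendsto (fun n => walk^[n] (1 : X0 p → ENNReal) G) atTop (𝓝 1) := by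
    rw [← surFun_of_subsingleton PUnit]
    exact (walk_iterate_surFun (p := p) _ PUnit rfl G).2
  -- The inequality is arranged without subtraction, as needed in `ENNReal`. Truncation at `k = 1`
  -- would not suffice: for `p = 2` its limit gives the lower bound `0`.
  have hineq : (D : ENNReal) • (1 : X0 p → ENNReal) + (B : ENNReal) • surFun (Fin 2 → Res p) ≤
      (D : ENNReal) • Pi.single (X0.zero p) 1 + (A : ENNReal) • surFun (Fin 1 → Res p) +
        surFun (Fin 3 → Res p) := by
    intro G
    have := indicator_bound G
    simp only [Pi.add_apply, Pi.smul_apply, Pi.one_apply, smul_eq_mul, surFun, Pi.single_apply,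
      mul_one]
    exact_mod_cast this
  have hw : ∀ n, (D : ENNReal) * walk^[n] 1 G + B * walk^[n] (surFun (Fin 2 → Res p)) G ≤
      D * walk^[n] (Pi.single (X0.zero p) 1) G + (A * walk^[n] (surFun (Fin 1 → Res p)) G +
        walk^[n] (surFun (Fin 3 → Res p)) G) := by
    intro n
    have := walk_mono.iterate n hineq G
    simp only [← walkHom_pow, map_add, map_smul] at this ⊢
    rw [← add_assoc]
    exact this
  have hl : Tendsto (fun n => (D : ENNReal) * walk^[n] 1 G +
      B * walk^[n] (surFun (Fin 2 → Res p)) G) atTop (𝓝 (D * 1 + B * 1)) :=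
    (ENNReal.Tendsto.const_mul hone (Or.inl one_ne_zero)).add
      (ENNReal.Tendsto.const_mul (hlim 2) (Or.inl one_ne_zero))
  have hr : Tendsto (fun n => (A : ENNReal) * walk^[n] (surFun (Fin 1 → Res p)) G +
        walk^[n] (surFun (Fin 3 → Res p)) G) atTop (𝓝 (A * 1 + 1)) :=
    (ENNReal.Tendsto.const_mul (hlim 1) (Or.inl one_ne_zero)).add (hlim 3)
  -- The limits of the two sides are `D + B` and `A + 1`. Since `D ≥ A` and `B ≥ 7`, they are
  -- separated by the values `A + 3` and `A + 2`, and the gap of `1` is left for the indicator term.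
  have h1 : ((A + 3 : ℕ) : ENNReal) < D * 1 + B * 1 := by
    rw [mul_one, mul_one, ← Nat.cast_add, Nat.cast_lt]
    omega
  have h2 : (A * 1 + 1 : ENNReal) < ((A + 2 : ℕ) : ENNReal) := by
    rw [mul_one, ← Nat.cast_one, ← Nat.cast_add, Nat.cast_lt]
    omega
  filter_upwards [hl.eventually (lt_mem_nhds h1), hr.eventually (gt_mem_nhds h2)] with n hn1 hn2
  have h3 := (hn1.le.trans (hw n)).trans (add_le_add_right hn2.le _)
  have h4 : ((A + 3 : ℕ) : ENNReal) = 1 + ((A + 2 : ℕ) : ENNReal) := by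
    push_cast
    ring
  rw [h4] at h3
  exact (ENNReal.add_le_add_iff_right (ENNReal.natCast_ne_top _)).1 h3

/-- The moments of the Cohen–Lenstra weights are finite. -/
theorem tsum_surFun_ne_top (F : Type) [AddCommGroup F] [Module ℤ_[p] F] [Finite F] :
    ∑' G : X0 p, (cardAut G : ENNReal)⁻¹ * surFun F G ≠ ⊤ := by
  classical
  obtain ⟨D, hD, hw⟩ := exists_walk_zero_bound (p := p)
  refine ne_top_of_le_ne_top (b := D * 2) (ENNReal.mul_ne_top hD ENNReal.ofNat_ne_top) ?_
  rw [ENNReal.tsum_eq_iSup_sum]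
  refine iSup_le fun s => ?_
  have h1 : ∀ᶠ n in atTop, ∀ G ∈ s, 1 ≤ D * walk^[n] (Pi.single (X0.zero p) 1) G :=
    (Filter.eventually_all_finset s).2 fun G _ => hw G
  have h2 : ∀ᶠ n in atTop, walk^[n] (surFun F) (X0.zero p) < 2 :=
    (walk_iterate_surFun (p := p) _ F rfl (X0.zero p)).2.eventually
      (gt_mem_nhds ENNReal.one_lt_two)
  obtain ⟨n, hn1, hn2⟩ := (h1.and h2).exists
  -- Insert the lower bound for the return to the trivial group and move the iterated walk to
  -- `surFun F` by symmetry. There it is evaluated at the trivial group, where it is eventually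
  -- below `2`, so the bound does not depend on `s`.
  calc ∑ G ∈ s, (cardAut G : ENNReal)⁻¹ * surFun F G
      ≤ ∑ G ∈ s, D * ((cardAut G : ENNReal)⁻¹ *
          (surFun F G * walk^[n] (Pi.single (X0.zero p) 1) G)) := by
        refine Finset.sum_le_sum fun G hG => ?_
        calc (cardAut G : ENNReal)⁻¹ * surFun F G = (cardAut G : ENNReal)⁻¹ * surFun F G * 1 :=
              (mul_one _).symm
          _ ≤ (cardAut G : ENNReal)⁻¹ * surFun F G *
                (D * walk^[n] (Pi.single (X0.zero p) 1) G) := mul_le_mul_right (hn1 G hG) _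
          _ = _ := by ring
    _ ≤ ∑' G, D * ((cardAut G : ENNReal)⁻¹ *
          (surFun F G * walk^[n] (Pi.single (X0.zero p) 1) G)) := ENNReal.sum_le_tsum s
    _ = D * ((cardAut (X0.zero p) : ENNReal)⁻¹ * walk^[n] (surFun F) (X0.zero p)) := by
        rw [ENNReal.tsum_mul_left, walk_iterate_symm, tsum_eq_single (X0.zero p) fun G hG => by
          rw [Pi.single_eq_of_ne hG, zero_mul, mul_zero], Pi.single_eq_same, one_mul]
    _ ≤ D * (1 * 2) := by
        gcongr
        exact ENNReal.inv_le_one.2 (by exact_mod_cast cardAut_pos _)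
    _ = D * 2 := by rw [one_mul]

end

/-! ## Square-summable measures -/

section

variable {p : ℕ} [Fact p.Prime]

theorem summable_nSur (F : Type) [AddCommGroup F] [Module ℤ_[p] F] [Finite F] :
    Summable fun G : X0 p => (cardAut G : ℝ)⁻¹ * nSur p G.rep F := by
  convert ENNReal.summable_toReal (tsum_surFun_ne_top (p := p) F) with G
  rw [ENNReal.toReal_mul, ENNReal.toReal_inv, ENNReal.toReal_natCast, surFun,
    ENNReal.toReal_natCast]

-- The moment for the trivial group makes the sum of `1 / #Aut` converge; a divergent series would
-- have the default sum `0` and make `c0` vanish.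
variable (p) in
theorem c0_pos : 0 < c0 p := by
  refine inv_pos.2 (Summable.tsum_pos ?_ (fun G => by positivity) (X0.zero p)
    (inv_pos.2 (Nat.cast_pos.2 (cardAut_pos _))))
  have := summable_nSur (p := p) PUnit
  simpa only [nSur_zero_target, Nat.cast_one, mul_one] using this

theorem mu0_pos (G : X0 p) : 0 < mu0 G :=
  div_pos (c0_pos p) (Nat.cast_pos.2 (cardAut_pos _))

theorem summable_mu0_nSur (F : Type) [AddCommGroup F] [Module ℤ_[p] F] [Finite F] :
    Summable fun G : X0 p => (nSur p G.rep F : ℝ) * mu0 G := by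
  refine ((summable_nSur (p := p) F).mul_left (c0 p)).congr fun G => ?_
  rw [mu0]
  ring

theorem card_hom_le (G F : Type) [AddCommGroup G] [Module ℤ_[p] G] [Finite G] [AddCommGroup F]
    [Module ℤ_[p] F] [Finite F] [Fintype (Submodule ℤ_[p] F)] :
    Nat.card (G →ₗ[ℤ_[p]] F) ≤ ∑ V : Submodule ℤ_[p] F, nSur p G V := by
  simp only [nSur]
  rw [← Nat.card_sigma]
  refine Nat.card_le_card_of_injective (fun f : G →ₗ[ℤ_[p]] F =>
    (⟨LinearMap.range f, f.rangeRestrict, f.surjective_rangeRestrict⟩ :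
      Σ V : Submodule ℤ_[p] F, Sur ℤ_[p] G V)) ?_
  refine Function.LeftInverse.injective (g := fun s => s.1.subtype ∘ₗ s.2.1) fun f => ?_
  rfl

/-- A pair of surjections is a homomorphism to `F × F`, and homomorphisms are sorted by their image.
Second moments are thus bounded by finitely many first moments. -/
theorem nSur_sq_le (G F : Type) [AddCommGroup G] [Module ℤ_[p] G] [Finite G] [AddCommGroup F]
    [Module ℤ_[p] F] [Finite F] [Fintype (Submodule ℤ_[p] (F × F))] :
    nSur p G F * nSur p G F ≤ ∑ V : Submodule ℤ_[p] (F × F), nSur p G V := by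
  refine le_trans ?_ (card_hom_le G (F × F))
  rw [nSur, ← Nat.card_prod]
  refine Nat.card_le_card_of_injective (fun f => f.1.1.prod f.2.1) ?_
  intro f g h
  have h' := fun x => Prod.ext_iff.1 (LinearMap.congr_fun h x)
  exact Prod.ext (Subtype.ext (LinearMap.ext fun x => (h' x).1))
    (Subtype.ext (LinearMap.ext fun x => (h' x).2))

theorem summable_nSur_sq (F : Type) [AddCommGroup F] [Module ℤ_[p] F] [Finite F] :
    Summable fun G : X0 p => (nSur p G.rep F : ℝ) * nSur p G.rep F * mu0 G := by
  have : Fintype (Submodule ℤ_[p] (F × F)) := Fintype.ofFinite _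
  refine Summable.of_nonneg_of_le (fun G => by have := mu0_pos G; positivity) (fun G => ?_)
    (summable_sum (s := Finset.univ) fun V _ => summable_mu0_nSur (p := p) (V : Submodule ℤ_[p] (F × F)))
  rw [← Finset.sum_mul]
  refine mul_le_mul_of_nonneg_right ?_ (mu0_pos G).le
  exact_mod_cast nSur_sq_le G.rep F

variable (p) in
/-- The space of square-summable measures. -/
def L2 : Submodule ℝ (X0 p → ℝ) where
  carrier := {ν | SquareSummable ν}
  zero_mem' := by
    change Summable _
    simp
  add_mem' := by
    intro a b ha hb
    change Summable _
    refine Summable.of_nonneg_of_le (fun G => div_nonneg (mul_self_nonneg _) (mu0_pos G).le)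
      (fun G => ?_) ((ha.add hb).mul_left 2)
    have := mu0_pos G
    rw [← add_div, mul_div_assoc']
    refine div_le_div_of_nonneg_right ?_ this.le
    rw [Pi.add_apply]
    nlinarith [sq_nonneg (a G - b G)]
  smul_mem' := by
    intro c a ha
    change Summable _
    refine (Summable.mul_left (c * c) ha).congr fun G => ?_
    rw [Pi.smul_apply, smul_eq_mul]
    ring

/-- Pointwise `|ν| s ≤ ν ^ 2 / μ₀ + s ^ 2 μ₀`, and both terms on the right are summable. -/
theorem L2.summable_mul {ν : X0 p → ℝ} (hν : ν ∈ L2 p) (F : Type) [AddCommGroup F]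
    [Module ℤ_[p] F] [Finite F] : Summable fun G => ν G * nSur p G.rep F := by
  have hν' : SquareSummable ν := hν
  refine Summable.of_norm_bounded (hν'.add (summable_nSur_sq F)) fun G => ?_
  have h := mu0_pos G
  rw [Real.norm_eq_abs, abs_mul, Nat.abs_cast, div_add' _ _ _ h.ne', le_div_iff₀ h]
  have h1 : ν G * ν G = |ν G| * |ν G| := (abs_mul_abs_self _).symm
  rw [h1]
  nlinarith [sq_nonneg (|ν G| - nSur p G.rep F * mu0 G), mul_self_nonneg (|ν G|),
    mul_self_nonneg (nSur p G.rep F * mu0 G)]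

theorem L2.summable {ν : X0 p → ℝ} (hν : ν ∈ L2 p) : Summable ν := by
  simpa only [nSur_zero_target, Nat.cast_one, mul_one] using L2.summable_mul hν PUnit

theorem L2.abs {ν : X0 p → ℝ} (hν : ν ∈ L2 p) : (fun G => |ν G|) ∈ L2 p := by
  change Summable _
  simp only [abs_mul_abs_self]
  exact hν

theorem moment_mem_L2 (F : X0 p) : moment F ∈ L2 p := by
  change Summable _
  convert summable_nSur_sq (p := p) F.rep using 2 with G
  have := (mu0_pos G).ne'
  rw [moment, cardSur, nSur]
  field_simp

/-! ## The operator on measures -/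

theorem tsum_pDStar (G : X0 p) : ∑' H, pDStar G H = 1 := by
  have := pDStar_moment G (F := PUnit)
  simpa [nSur_zero_target] using this

theorem tsum_pD (H : X1 p) : ∑' G, pD H G = 1 := by
  have := pD_moment H PUnit
  simpa [nSur_zero_target] using this

theorem pDStar_ne_top (G : X0 p) (H : X1 p) : pDStar G H ≠ ⊤ :=
  ne_top_of_le_ne_top ENNReal.one_ne_top ((ENNReal.le_tsum H).trans (tsum_pDStar G).le)

theorem pD_ne_top (H : X1 p) (G : X0 p) : pD H G ≠ ⊤ :=
  ne_top_of_le_ne_top ENNReal.one_ne_top ((ENNReal.le_tsum G).trans (tsum_pD H).le)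

theorem probDStar_le_one (G : X0 p) (H : X1 p) : probDStar G H ≤ 1 := by
  rw [probDStar_eq_toReal, ← ENNReal.toReal_one]
  exact ENNReal.toReal_mono ENNReal.one_ne_top ((ENNReal.le_tsum H).trans (tsum_pDStar G).le)

theorem probD_le_one (H : X1 p) (G : X0 p) : probD H G ≤ 1 := by
  rw [probD_eq, ← ENNReal.toReal_one]
  exact ENNReal.toReal_mono ENNReal.one_ne_top ((ENNReal.le_tsum G).trans (tsum_pD H).le)

theorem summable_mul_of_le_one {ι : Type*} {f g : ι → ℝ} (hf : Summable f) (h0 : ∀ i, 0 ≤ g i)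
    (h1 : ∀ i, g i ≤ 1) : Summable fun i => f i * g i := by
  refine Summable.of_norm_bounded hf.norm fun i => ?_
  rw [norm_mul, Real.norm_of_nonneg (h0 i)]
  exact mul_le_of_le_one_right (norm_nonneg _) (h1 i)

theorem summable_mul_probDStar {ν : X0 p → ℝ} (h : Summable ν) (H : X1 p) :
    Summable fun G => ν G * probDStar G H :=
  summable_mul_of_le_one h (fun G => by rw [probDStar_eq_toReal]; exact ENNReal.toReal_nonneg)
    fun G => probDStar_le_one G H

theorem summable_mul_probD {ν : X1 p → ℝ} (h : Summable ν) (G : X0 p) :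
    Summable fun H => ν H * probD H G :=
  summable_mul_of_le_one h (fun H => by rw [probD_eq]; exact ENNReal.toReal_nonneg)
    fun H => probD_le_one H G

/-- The measure with a given density with respect to the Cohen–Lenstra weights. -/
def dens (h : X0 p → ENNReal) (G : X0 p) : ℝ := ((cardAut G : ENNReal)⁻¹ * h G).toReal

theorem dStar_dens {h : X0 p → ENNReal} (hh : ∑' G, (cardAut G : ENNReal)⁻¹ * h G ≠ ⊤) (H : X1 p) :
    dStar (dens h) H = (∑' G, (cardAut G : ENNReal)⁻¹ * h G * pDStar G H).toReal := by
  rw [ENNReal.tsum_toReal_eq fun G => ENNReal.mul_ne_top (ENNReal.ne_top_of_tsum_ne_top hh G)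
    (pDStar_ne_top G H)]
  refine tsum_congr fun G => ?_
  rw [ENNReal.toReal_mul, dens, probDStar_eq_toReal]

theorem tsum_tsum_pDStar (h : X0 p → ENNReal) :
    ∑' H, ∑' G, (cardAut G : ENNReal)⁻¹ * h G * pDStar G H =
      ∑' G, (cardAut G : ENNReal)⁻¹ * h G := by
  rw [ENNReal.tsum_comm]
  refine tsum_congr fun G => ?_
  rw [ENNReal.tsum_mul_left, tsum_pDStar, mul_one]

theorem summable_dStar_dens {h : X0 p → ENNReal}
    (hh : ∑' G, (cardAut G : ENNReal)⁻¹ * h G ≠ ⊤) : Summable (dStar (dens h)) := by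
  have := ENNReal.summable_toReal ((tsum_tsum_pDStar h).trans_ne hh)
  exact this.congr fun H => (dStar_dens hh H).symm

/-- Reversibility, used once for each step, turns the push-forward of the measure `h / #Aut` into
the average of its density `h`. -/
theorem Delta0_dens {h : X0 p → ENNReal} (hh : ∑' G, (cardAut G : ENNReal)⁻¹ * h G ≠ ⊤) :
    Delta0 (dens h) = dens (walk h) := by
  obtain ⟨w, hw⟩ := exists_reversible (p := p)
  ext G
  have hfin := ENNReal.ne_top_of_tsum_ne_top ((tsum_tsum_pDStar h).trans_ne hh)
  have h1 : ∀ H, dStar (dens h) H * probD H G =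
      ((∑' G, (cardAut G : ENNReal)⁻¹ * h G * pDStar G H) * pD H G).toReal := fun H => by
    rw [ENNReal.toReal_mul, dStar_dens hh, probD_eq]
  rw [Delta0, d]
  simp_rw [h1]
  rw [← ENNReal.tsum_toReal_eq fun H => ENNReal.mul_ne_top (hfin H) (pD_ne_top H G), dens, walk,
    ← ENNReal.tsum_mul_left]
  congr 1
  refine tsum_congr fun H => ?_
  have h2 : ∀ G, (cardAut G : ENNReal)⁻¹ * h G * pDStar G H = w H * (pD H G * h G) := fun G => by
    rw [mul_right_comm, hw, mul_assoc]
  simp_rw [h2]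
  rw [ENNReal.tsum_mul_left, ← mul_assoc, hw]
  ring

/-- The density of the positive part of a measure. -/
def posDens (ν : X0 p → ℝ) (G : X0 p) : ENNReal := cardAut G * ENNReal.ofReal (ν G)

theorem inv_mul_posDens (ν : X0 p → ℝ) (G : X0 p) :
    (cardAut G : ENNReal)⁻¹ * posDens ν G = ENNReal.ofReal (ν G) := by
  rw [posDens, ← mul_assoc, ENNReal.inv_mul_cancel (by exact_mod_cast (cardAut_pos G).ne')
    (ENNReal.natCast_ne_top _), one_mul]

theorem eq_dens_sub (ν : X0 p → ℝ) : ν = dens (posDens ν) - dens (posDens (-ν)) := by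
  ext G
  rw [Pi.sub_apply, dens, dens, inv_mul_posDens, inv_mul_posDens, ENNReal.toReal_ofReal',
    ENNReal.toReal_ofReal', Pi.neg_apply, max_zero_sub_max_neg_zero_eq_self]

theorem tsum_posDens_ne_top {ν k : X0 p → ℝ} (hk : ∀ G, 0 ≤ k G)
    (hν : Summable fun G => ν G * k G) :
    ∑' G, (cardAut G : ENNReal)⁻¹ * (posDens ν G * ENNReal.ofReal (k G)) ≠ ⊤ := by
  simp_rw [← mul_assoc, inv_mul_posDens]
  refine ne_top_of_le_ne_top hν.norm.tsum_ofReal_ne_top (ENNReal.tsum_le_tsum fun G => ?_)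
  rw [← ENNReal.ofReal_mul' (hk G)]
  exact ENNReal.ofReal_le_ofReal (le_abs_self _)

theorem tsum_posDens_ne_top' {ν : X0 p → ℝ} (hν : Summable ν) :
    ∑' G, (cardAut G : ENNReal)⁻¹ * posDens ν G ≠ ⊤ := by
  have := tsum_posDens_ne_top (ν := ν) (k := fun _ => 1) (fun _ => zero_le_one) (by simpa using hν)
  simpa using this

theorem summable_dStar {ν : X0 p → ℝ} (hν : Summable ν) : Summable (dStar ν) := by
  have h1 := tsum_posDens_ne_top' hν
  have h2 := tsum_posDens_ne_top' (ν := -ν) hν.neg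
  have hd : ∀ {h : X0 p → ENNReal}, ∑' G, (cardAut G : ENNReal)⁻¹ * h G ≠ ⊤ →
      Summable (dens h) := fun h => ENNReal.summable_toReal h
  have : dStar ν = fun H => dStar (dens (posDens ν)) H - dStar (dens (posDens (-ν))) H := by
    ext H
    conv_lhs => rw [eq_dens_sub ν]
    rw [dStar, dStar, dStar, ← (summable_mul_probDStar (hd h1) H).tsum_sub
      (summable_mul_probDStar (hd h2) H)]
    simp only [Pi.sub_apply, sub_mul]
  rw [this]
  exact (summable_dStar_dens h1).sub (summable_dStar_dens h2)

theorem Delta0_add {ν ν' : X0 p → ℝ} (h : Summable ν) (h' : Summable ν') :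
    Delta0 (ν + ν') = Delta0 ν + Delta0 ν' := by
  have h1 : dStar (ν + ν') = dStar ν + dStar ν' := by
    ext H
    rw [Pi.add_apply, dStar, dStar, dStar, ← (summable_mul_probDStar h H).tsum_add
      (summable_mul_probDStar h' H)]
    simp only [Pi.add_apply, add_mul]
  ext G
  rw [Delta0, h1, Pi.add_apply, Delta0, Delta0, d, d, d,
    ← (summable_mul_probD (summable_dStar h) G).tsum_add
      (summable_mul_probD (summable_dStar h') G)]
  simp only [Pi.add_apply, add_mul]

theorem Delta0_smul (c : ℝ) (ν : X0 p → ℝ) : Delta0 (c • ν) = c • Delta0 ν := by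
  have h1 : dStar (c • ν) = c • dStar ν := by
    ext H
    simp only [dStar, Pi.smul_apply, smul_eq_mul, mul_assoc, tsum_mul_left]
  ext G
  simp only [Delta0, h1, d, Pi.smul_apply, smul_eq_mul, mul_assoc, tsum_mul_left]

variable (p) in
/-- The operator `Δ₀` on square-summable measures. -/
def Delta0Hom : L2 p →ₗ[ℝ] (X0 p → ℝ) where
  toFun ν := Delta0 ν.1
  map_add' ν ν' := Delta0_add (L2.summable ν.2) (L2.summable ν'.2)
  map_smul' c ν := Delta0_smul c ν.1

/-- The operator on the moment measures. -/
theorem Delta0_moment (F : X0 p) [Fintype F.rep] :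
    Delta0 (moment F) = (Nat.card F.rep : ℝ)⁻¹ • ∑ x : F.rep,
      moment (X0.of (F.rep ⧸ Submodule.span ℤ_[p] {x})) := by
  have hm : ∀ F : X0 p, moment F = c0 p • dens (surFun F.rep) := by
    intro F
    ext G
    rw [moment, Pi.smul_apply, dens, surFun, ENNReal.toReal_mul, ENNReal.toReal_inv,
      ENNReal.toReal_natCast, ENNReal.toReal_natCast, mu0, smul_eq_mul, cardSur, nSur]
    ring
  rw [hm, Delta0_smul, Delta0_dens (tsum_surFun_ne_top F.rep)]
  simp_rw [hm]
  ext G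
  simp only [Pi.smul_apply, Finset.sum_apply, dens, walk_surFun, smul_eq_mul]
  rw [← Finset.mul_sum, mul_left_comm (Nat.card F.rep : ℝ)⁻¹]
  congr 1
  rw [mul_left_comm (cardAut G : ENNReal)⁻¹, ENNReal.toReal_mul, ENNReal.toReal_inv, ENNReal.toReal_natCast]
  congr 1
  rw [ENNReal.toReal_mul, ENNReal.toReal_sum fun x _ =>
    show surFun _ G ≠ ⊤ from ENNReal.natCast_ne_top _, Finset.mul_sum]
  refine Finset.sum_congr rfl fun x _ => ?_
  rw [surFun_congr (X0.rep_of (F.rep ⧸ Submodule.span ℤ_[p] {x})).some, ENNReal.toReal_mul]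

/-! ## Moments of a measure -/

/-- The moment of a measure, the integral of the number of surjections to `F`. -/
def mom (F : Type) [AddCommGroup F] [Module ℤ_[p] F] (ν : X0 p → ℝ) : ℝ :=
  ∑' G, ν G * nSur p G.rep F

theorem mom_congr {F F' : Type} [AddCommGroup F] [Module ℤ_[p] F] [AddCommGroup F']
    [Module ℤ_[p] F'] (e : F ≃ₗ[ℤ_[p]] F') (ν : X0 p → ℝ) : mom F ν = mom F' ν :=
  tsum_congr fun G => by rw [nSur_congr (LinearEquiv.refl _ _) e]

theorem mom_dens (F : Type) [AddCommGroup F] [Module ℤ_[p] F] (h : X0 p → ENNReal)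
    (hh : ∀ G, (cardAut G : ENNReal)⁻¹ * h G ≠ ⊤) :
    mom F (dens h) = (∑' G, (cardAut G : ENNReal)⁻¹ * (h G * surFun F G)).toReal := by
  simp_rw [← mul_assoc]
  rw [ENNReal.tsum_toReal_eq fun G => ENNReal.mul_ne_top (hh G)
    (show surFun F G ≠ ⊤ from ENNReal.natCast_ne_top _)]
  refine tsum_congr fun G => ?_
  rw [ENNReal.toReal_mul, dens, surFun, ENNReal.toReal_natCast]

/-- By `walk_symm` the operator moves from the density to `#Sur(·, F)`, where `walk_surFun` applies.
-/
theorem mom_Delta0_dens (F : Type) [AddCommGroup F] [Module ℤ_[p] F] [Fintype F]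
    {h : X0 p → ENNReal} (hh : ∀ (F : Type) [AddCommGroup F] [Module ℤ_[p] F] [Finite F],
      ∑' G, (cardAut G : ENNReal)⁻¹ * (h G * surFun F G) ≠ ⊤) :
    (Summable fun G => Delta0 (dens h) G * nSur p G.rep F) ∧
    mom F (Delta0 (dens h)) = (Nat.card F : ℝ)⁻¹ *
      ∑ x : F, mom (F ⧸ Submodule.span ℤ_[p] {x}) (dens h) := by
  have h0 : ∑' G, (cardAut G : ENNReal)⁻¹ * h G ≠ ⊤ := by
    have := hh PUnit
    simpa only [surFun_of_subsingleton, Pi.one_apply, mul_one] using this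
  have hsum : ∑' G, (cardAut G : ENNReal)⁻¹ * (walk h G * surFun F G) = (Nat.card F : ENNReal)⁻¹ *
      ∑ x : F, ∑' G, (cardAut G : ENNReal)⁻¹ *
        (h G * surFun (F ⧸ Submodule.span ℤ_[p] {x}) G) := by
    simp_rw [mul_comm (walk h _)]
    rw [walk_symm]
    simp_rw [walk_surFun]
    rw [← Summable.tsum_finsetSum fun _ _ => ENNReal.summable, ← ENNReal.tsum_mul_left]
    refine tsum_congr fun G => ?_
    rw [← Finset.mul_sum, ← Finset.mul_sum]
    ring
  have hne : ∑' G, (cardAut G : ENNReal)⁻¹ * (walk h G * surFun F G) ≠ ⊤ := by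
    rw [hsum]
    exact ENNReal.mul_ne_top (ENNReal.inv_ne_top.2 (Nat.cast_ne_zero.2 Nat.card_pos.ne'))
      (ENNReal.sum_ne_top.2 fun x _ => hh _)
  have hw : ∀ G, (cardAut G : ENNReal)⁻¹ * walk h G ≠ ⊤ := by
    refine ENNReal.ne_top_of_tsum_ne_top ?_
    have h1 := walk_symm 1 h
    have h2 : walk (1 : X0 p → ENNReal) = 1 := by
      ext G
      simp [walk, tsum_pD, tsum_pDStar]
    rw [h2] at h1
    simp only [Pi.one_apply, one_mul, mul_one] at h1
    rwa [h1]
  rw [Delta0_dens h0]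
  constructor
  · convert ENNReal.summable_toReal hne using 2 with G
    rw [← mul_assoc, ENNReal.toReal_mul, surFun, ENNReal.toReal_natCast, dens]
  · rw [mom_dens F _ hw, hsum, ENNReal.toReal_mul, ENNReal.toReal_inv, ENNReal.toReal_natCast,
      ENNReal.toReal_sum fun x _ => hh _]
    congr 1
    refine Finset.sum_congr rfl fun x _ => ?_
    rw [mom_dens _ _ (ENNReal.ne_top_of_tsum_ne_top h0)]

/-- The operator on the moments of a square-summable measure. -/
theorem mom_Delta0 {ν : X0 p → ℝ} (hν : ν ∈ L2 p) (F : Type) [AddCommGroup F] [Module ℤ_[p] F]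
    [Fintype F] : (Summable fun G => Delta0 ν G * nSur p G.rep F) ∧
      mom F (Delta0 ν) = (Nat.card F : ℝ)⁻¹ *
        ∑ x : F, mom (F ⧸ Submodule.span ℤ_[p] {x}) ν := by
  have hpos : ∀ {ν : X0 p → ℝ}, ν ∈ L2 p → ∀ (F : Type) [AddCommGroup F] [Module ℤ_[p] F]
      [Finite F], ∑' G, (cardAut G : ENNReal)⁻¹ * (posDens ν G * surFun F G) ≠ ⊤ := by
    intro ν hν F _ _ _
    have := tsum_posDens_ne_top (k := fun G => (nSur p G.rep F : ℝ)) (fun G => Nat.cast_nonneg _)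
      (L2.summable_mul hν F)
    simpa only [ENNReal.ofReal_natCast, surFun] using this
  have hpos0 : ∀ {ν : X0 p → ℝ}, ν ∈ L2 p → Summable (dens (posDens ν)) := fun hν =>
    ENNReal.summable_toReal (tsum_posDens_ne_top' (L2.summable hν))
  have hposS : ∀ {ν : X0 p → ℝ}, ν ∈ L2 p → ∀ (F : Type) [AddCommGroup F] [Module ℤ_[p] F]
      [Finite F], Summable fun G => dens (posDens ν) G * nSur p G.rep F := by
    intro ν hν F _ _ _
    convert ENNReal.summable_toReal (hpos hν F) using 2 with G
    rw [← mul_assoc, ENNReal.toReal_mul, surFun, ENNReal.toReal_natCast, dens]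
  have hν' : -ν ∈ L2 p := (L2 p).neg_mem hν
  have hadd := Delta0_add (ν := dens (posDens ν)) (ν' := (-1 : ℝ) • dens (posDens (-ν)))
    (hpos0 hν) (Summable.const_smul (-1 : ℝ) (hpos0 hν'))
  have hD : Delta0 ν = Delta0 (dens (posDens ν)) - Delta0 (dens (posDens (-ν))) := by
    conv_lhs => rw [eq_dens_sub ν]
    rw [sub_eq_add_neg, ← neg_one_smul ℝ, hadd, Delta0_smul, neg_one_smul, sub_eq_add_neg]
  have hsub : ∀ {ν₁ ν₂ : X0 p → ℝ} (F : Type) [AddCommGroup F] [Module ℤ_[p] F],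
      (Summable fun G => ν₁ G * nSur p G.rep F) → (Summable fun G => ν₂ G * nSur p G.rep F) →
      mom F (ν₁ - ν₂) = mom F ν₁ - mom F ν₂ := by
    intro ν₁ ν₂ F _ _ h1 h2
    rw [mom, mom, mom, ← h1.tsum_sub h2]
    simp only [Pi.sub_apply, sub_mul]
  obtain ⟨s1, m1⟩ := mom_Delta0_dens F (hpos hν)
  obtain ⟨s2, m2⟩ := mom_Delta0_dens F (hpos hν')
  rw [hD]
  refine ⟨(s1.sub s2).congr fun G => by rw [Pi.sub_apply, sub_mul], ?_⟩
  rw [hsub F s1 s2, m1, m2, ← mul_sub, ← Finset.sum_sub_distrib]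
  congr 1
  refine Finset.sum_congr rfl fun x _ => ?_
  rw [← hsub _ (hposS hν _) (hposS hν' _), ← eq_dens_sub]

end

/-! ## The leading eigenfunctions -/

section

variable {p : ℕ} [Fact p.Prime]

theorem X0.card_of (M : Type) [AddCommGroup M] [Module ℤ_[p] M] [Finite M] :
    Nat.card (X0.of (p := p) M).rep = Nat.card M :=
  Nat.card_congr (X0.rep_of M).some.toEquiv

theorem card_lt_of_surjective {F F' : X0 p} (f : F.rep →ₗ[ℤ_[p]] F'.rep)
    (hf : Function.Surjective f) (hne : F' ≠ F) : Nat.card F'.rep < Nat.card F.rep := by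
  refine lt_of_le_of_ne (Nat.card_le_card_of_surjective f hf) fun h => hne ?_
  have hb : Function.Bijective f :=
    (Nat.bijective_iff_surjective_and_card f).2 ⟨hf, h.symm⟩
  exact ((X0.eq_iff F F').2 ⟨LinearEquiv.ofBijective f hb⟩).symm

theorem Below.card_lt {F' F : X0 p} (h : Below F' F) : Nat.card F'.rep < Nat.card F.rep := by
  obtain ⟨⟨f, hf⟩, hne⟩ := h
  exact card_lt_of_surjective f hf hne

theorem Below.trans {F'' F' F : X0 p} (h : Below F'' F') (h' : Below F' F) : Below F'' F := by
  refine ⟨?_, fun he => (h.card_lt.trans h'.card_lt).ne (by rw [he])⟩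
  obtain ⟨⟨f, hf⟩, -⟩ := h
  obtain ⟨⟨g, hg⟩, -⟩ := h'
  exact ⟨f ∘ₗ g, hf.comp hg⟩

theorem below_quotient_span (F : X0 p) {x : F.rep} (hx : x ≠ 0) :
    Below (X0.of (F.rep ⧸ Submodule.span ℤ_[p] {x})) F := by
  refine ⟨⟨(X0.rep_of _).some.symm.toLinearMap ∘ₗ (Submodule.span ℤ_[p] {x}).mkQ,
    (X0.rep_of _).some.symm.surjective.comp (Submodule.mkQ_surjective _)⟩, fun h => ?_⟩
  have h1 := card_quotient_span_lt (p := p) hx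
  rw [← X0.card_of (p := p), h] at h1
  exact lt_irrefl _ h1

-- Every group of order `n` is a quotient of `(ℤ_p / n) ^ n`, with one generator for each element.
variable (p) in
theorem finite_card_eq (n : ℕ) : {F : X0 p | Nat.card F.rep = n}.Finite := by
  rcases Nat.eq_zero_or_pos n with rfl | hn
  · convert Set.finite_empty
    exact Set.eq_empty_of_forall_notMem fun F hF => (Nat.card_pos (α := F.rep)).ne' hF
  have hn0 : (n : ℤ_[p]) ≠ 0 := Nat.cast_ne_zero.2 hn.ne'
  have := finite_quotient_of_ne_bot (Ideal.span {(n : ℤ_[p])}) (by simpa using hn.ne')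
  let Q : Type := Fin n → ℤ_[p] ⧸ Ideal.span {(n : ℤ_[p])}
  refine (Set.finite_range fun V : Submodule ℤ_[p] Q => X0.of (Q ⧸ V)).subset fun F hF => ?_
  have hF' : Nat.card F.rep = n := hF
  have e : Fin n ≃ F.rep := (Finite.equivFinOfCardEq hF').symm
  let f : Q →ₗ[ℤ_[p]] F.rep := ∑ i, (Submodule.liftQ (Ideal.span {(n : ℤ_[p])})
    (LinearMap.toSpanSingleton ℤ_[p] F.rep (e i)) (by
      rw [Ideal.span, Submodule.span_singleton_le_iff_mem, LinearMap.mem_ker,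
        LinearMap.toSpanSingleton_apply, Nat.cast_smul_eq_nsmul]
      exact (congrArg (· • e i) hF'.symm).trans card_nsmul_eq_zero')) ∘ₗ LinearMap.proj i
  have hf : Function.Surjective f := by
    intro x
    refine ⟨Pi.single (e.symm x) (Submodule.Quotient.mk 1), ?_⟩
    rw [LinearMap.sum_apply, Finset.sum_eq_single (e.symm x)]
    · rw [LinearMap.comp_apply, LinearMap.proj_apply, Pi.single_eq_same, Submodule.liftQ_apply,
        LinearMap.toSpanSingleton_apply, one_smul, e.apply_symm_apply]
    · intro i _ hi
      rw [LinearMap.comp_apply, LinearMap.proj_apply, Pi.single_eq_of_ne hi, map_zero]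
    · exact fun h => absurd (Finset.mem_univ _) h
  exact ⟨LinearMap.ker f, (X0.of_eq_iff _ _).2 ⟨f.quotKerEquivOfSurjective hf⟩⟩

theorem moment_eq (F G : X0 p) : moment F G = nSur p G.rep F.rep * mu0 G := rfl

/-- Evaluated at the group `F`, the moment measure of `F'` vanishes unless `F` surjects onto `F'`;
the matrix is triangular with respect to the order of the group. -/
theorem linearIndependent_moment : LinearIndependent ℝ (moment : X0 p → X0 p → ℝ) := by
  rw [linearIndependent_iff']
  intro s g hg
  have key : ∀ n, ∀ F ∈ s, Nat.card F.rep = n → g F = 0 := by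
    intro n
    induction n using Nat.strong_induction_on with
    | _ n ih =>
      intro F hF hn
      have h1 := congrFun hg F
      rw [Finset.sum_apply, Pi.zero_apply, Finset.sum_eq_single F] at h1
      · rw [Pi.smul_apply, smul_eq_mul, moment_eq] at h1
        have hpos : 0 < nSur p F.rep F.rep := by
          have : Nonempty (Sur ℤ_[p] F.rep F.rep) := ⟨⟨LinearMap.id, Function.surjective_id⟩⟩
          exact Nat.card_pos
        have hpos' : (nSur p F.rep F.rep : ℝ) * mu0 F ≠ 0 :=
          mul_ne_zero (Nat.cast_ne_zero.2 hpos.ne') (mu0_pos F).ne'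
        exact (mul_eq_zero.1 h1).resolve_right hpos'
      · intro F' hF' hne
        rw [Pi.smul_apply, smul_eq_mul, moment_eq]
        rcases isEmpty_or_nonempty (Sur ℤ_[p] F.rep F'.rep) with he | ⟨⟨f, hf⟩⟩
        · rw [nSur, Nat.card_of_isEmpty, Nat.cast_zero, zero_mul, mul_zero]
        · rw [ih _ (hn ▸ card_lt_of_surjective f hf hne) F' hF' rfl, zero_mul]
      · exact fun h => absurd hF h
  exact fun F hF => key _ F hF rfl

-- Linearity of `Δ₀` depends on the convergence of its series. A linear map on all functions that
-- agrees with it on `L2` allows images, preimages and powers of linear algebra without subtypes.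
variable (p) in
theorem exists_linear_extension : ∃ T : (X0 p → ℝ) →ₗ[ℝ] (X0 p → ℝ), ∀ ν ∈ L2 p,
    Delta0 ν = T ν := by
  obtain ⟨T, hT⟩ := LinearMap.exists_extend (Delta0Hom p)
  exact ⟨T, fun ν hν => (LinearMap.congr_fun hT ⟨ν, hν⟩).symm⟩

/-- The span of the moment measures of the groups below a given one. -/
def below (F : X0 p) : Submodule ℝ (X0 p → ℝ) :=
  Submodule.span ℝ (moment '' {F' : X0 p | Below F' F})

variable (p) in
/-- The span of the moment measures of the groups of bounded order. -/
def spanLE (n : ℕ) : Submodule ℝ (X0 p → ℝ) :=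
  Submodule.span ℝ (moment '' {F : X0 p | Nat.card F.rep ≤ n})

theorem moment_mem_below {F' F : X0 p} (h : Below F' F) : moment F' ∈ below F :=
  Submodule.subset_span ⟨F', h, rfl⟩

theorem below_mono {F' F : X0 p} (h : Below F' F) : below F' ≤ below F :=
  Submodule.span_mono (Set.image_mono fun _ h' => Below.trans h' h)

theorem below_le_spanLE {F : X0 p} {n : ℕ} (h : Nat.card F.rep ≤ n + 1) : below F ≤ spanLE p n :=
  Submodule.span_mono (Set.image_mono fun F' (h' : Below F' F) => by
    have := h'.card_lt
    change Nat.card F'.rep ≤ n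
    omega)

theorem spanLE_le_L2 (n : ℕ) : spanLE p n ≤ L2 p :=
  Submodule.span_le.2 (by rintro _ ⟨F, -, rfl⟩; exact moment_mem_L2 F)

theorem below_le_L2 (F : X0 p) : below F ≤ L2 p :=
  Submodule.span_le.2 (by rintro _ ⟨F, -, rfl⟩; exact moment_mem_L2 F)

theorem Delta0_moment_sub_mem (F : X0 p) :
    Delta0 (moment F) - (1 / (Nat.card F.rep : ℝ)) • moment F ∈ below F := by
  classical
  have := Fintype.ofFinite F.rep
  have h0 : X0.of (F.rep ⧸ Submodule.span ℤ_[p] {(0 : F.rep)}) = F :=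
    (X0.of_eq_iff _ _).2 ⟨Submodule.quotEquivOfEqBot _ (Submodule.span_zero_singleton _)⟩
  rw [Delta0_moment, ← Finset.add_sum_erase _ _ (Finset.mem_univ (0 : F.rep)), h0, one_div,
    ← smul_sub, add_sub_cancel_left]
  exact Submodule.smul_mem _ _ (Submodule.sum_mem _ fun x hx =>
    moment_mem_below (below_quotient_span F (Finset.ne_of_mem_erase hx)))

/-- The operator has no eigenvalues on the span of the moment measures other than the diagonal
entries of its triangular matrix. -/
theorem eq_zero_of_mem_spanLE {c : ℝ} (n : ℕ) (hc : ∀ m : ℕ, 0 < m → m ≤ n → c ≠ 1 / m)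
    {v : X0 p → ℝ} (hv : v ∈ spanLE p n) (h : Delta0 v = c • v) : v = 0 := by
  obtain ⟨T, hT⟩ := exists_linear_extension p
  have hT' : T v = c • v := by rw [← hT v (spanLE_le_L2 n hv), h]
  clear h
  induction n with
  | zero =>
    have : {F : X0 p | Nat.card F.rep ≤ 0} = ∅ :=
      Set.eq_empty_of_forall_notMem fun F hF => (Nat.card_pos (α := F.rep)).not_ge hF
    rwa [spanLE, this, Set.image_empty, Submodule.span_empty, Submodule.mem_bot] at hv
  | succ n ih =>
    -- By triangularity `T - 1 / (n + 1)` lowers the bound on the order by one. For an eigenvector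
    -- it is multiplication by the nonzero scalar `c - 1 / (n + 1)`.
    have h1 : spanLE p (n + 1) ≤ (spanLE p n).comap (T - (1 / ((n + 1 : ℕ) : ℝ)) • LinearMap.id) := by
      refine Submodule.span_le.2 ?_
      rintro _ ⟨F, hF, rfl⟩
      have hF' : Nat.card F.rep ≤ n + 1 := hF
      have h2 := below_le_spanLE hF' (Delta0_moment_sub_mem F)
      rw [hT _ (moment_mem_L2 F)] at h2
      change T (moment F) - (1 / ((n + 1 : ℕ) : ℝ)) • moment F ∈ spanLE p n
      rcases hF'.eq_or_lt with h3 | h3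
      · rwa [h3] at h2
      · have h4 : moment F ∈ spanLE p n := Submodule.subset_span ⟨F, Nat.le_of_lt_succ h3, rfl⟩
        have := (spanLE p n).sub_mem ((spanLE p n).add_mem h2 ((spanLE p n).smul_mem
          (1 / (Nat.card F.rep : ℝ)) h4)) ((spanLE p n).smul_mem (1 / ((n + 1 : ℕ) : ℝ)) h4)
        rwa [sub_add_cancel] at this
    have h2 : T v - (1 / ((n + 1 : ℕ) : ℝ)) • v ∈ spanLE p n := h1 hv
    rw [hT', ← sub_smul] at h2
    have h3 := ((spanLE p n).smul_mem_iff (sub_ne_zero.2 (hc (n + 1) n.succ_pos le_rfl))).1 h2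
    exact ih (fun m hm hmn => hc m hm (hmn.trans n.le_succ)) h3

theorem one_div_ne_one_div {m n : ℕ} (hm : 0 < m) (h : m < n) : (1 / (n : ℝ)) ≠ 1 / m := by
  have h1 : (0 : ℝ) < m := Nat.cast_pos.2 hm
  have h2 : (m : ℝ) < n := Nat.cast_lt.2 h
  exact (one_div_lt_one_div_of_lt h1 h2).ne

/-- Solve `(Δ₀ - 1 / #F) v = (Δ₀ - 1 / #F) Moment[F]` with `v` in the span below `F` and take
`Moment[F] - v`. The operator is onto that span because the diagonal entries below `F` differ from
`1 / #F`. -/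
theorem exists_leading (F : X0 p) : ∃ E : X0 p → ℝ,
    Delta0 E = (1 / (Nat.card F.rep : ℝ)) • E ∧ E - moment F ∈ below F := by
  obtain ⟨T, hT⟩ := exists_linear_extension p
  induction hn : Nat.card F.rep using Nat.strong_induction_on generalizing F with
  | _ n ih =>
    subst hn
    set c : ℝ := 1 / (Nat.card F.rep : ℝ)
    -- The leading eigenfunctions of the smaller groups, given by the outer induction, lie in the
    -- image since their eigenvalues differ from `c`; subtracting their lower terms, handled by the
    -- inner induction, leaves the moment measure.
    have key : ∀ m, ∀ F' : X0 p, Below F' F → Nat.card F'.rep = m →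
        moment F' ∈ (below F).map (T - c • LinearMap.id) := by
      intro m
      induction m using Nat.strong_induction_on with
      | _ m ihm =>
        intro F' hF' hm
        obtain ⟨E, hE, hE'⟩ := ih _ hF'.card_lt F' rfl
        have hEF : E ∈ below F := by
          have := (below F).add_mem (below_mono hF' hE') (moment_mem_below hF')
          rwa [sub_add_cancel] at this
        have h1 : E - moment F' ∈ (below F).map (T - c • LinearMap.id) := by
          refine Submodule.span_le.2 ?_ hE'
          rintro _ ⟨F'', hF'', rfl⟩
          exact ihm _ (hm ▸ hF''.card_lt) F'' (Below.trans hF'' hF') rfl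
        have h2 : (1 / (Nat.card F'.rep : ℝ) - c) • E ∈ (below F).map (T - c • LinearMap.id) := by
          refine ⟨E, hEF, ?_⟩
          rw [LinearMap.sub_apply, LinearMap.smul_apply, LinearMap.id_apply,
            ← hT E (below_le_L2 F hEF), hE, sub_smul]
        have h3 := (Submodule.smul_mem_iff _ (sub_ne_zero.2
          (one_div_ne_one_div Nat.card_pos hF'.card_lt).symm)).1 h2
        have h4 := Submodule.sub_mem _ h3 h1
        rwa [sub_sub_cancel] at h4
    have h5 : below F ≤ (below F).map (T - c • LinearMap.id) := by
      refine Submodule.span_le.2 ?_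
      rintro _ ⟨F', hF', rfl⟩
      exact key _ F' hF' rfl
    obtain ⟨v, hv, hv'⟩ := h5 (Delta0_moment_sub_mem F)
    have hv2 : v ∈ below F := hv
    refine ⟨moment F - v, ?_, ?_⟩
    · rw [hT _ ((L2 p).sub_mem (moment_mem_L2 F) (below_le_L2 F hv2)), map_sub,
        ← hT _ (moment_mem_L2 F)]
      have h6 : T v - c • v = Delta0 (moment F) - c • moment F := hv'
      rw [smul_sub]
      linear_combination (exp := 1) -h6
    · rw [sub_sub_cancel_left]
      exact (below F).neg_mem hv2

theorem leading_mem_L2 {F : X0 p} {E : X0 p → ℝ} (h : E - moment F ∈ below F) : E ∈ L2 p := by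
  have := (L2 p).add_mem (below_le_L2 F h) (moment_mem_L2 F)
  rwa [sub_add_cancel] at this

theorem leading_ne_zero {F : X0 p} {E : X0 p → ℝ} (h : E - moment F ∈ below F) : E ≠ 0 := by
  rintro rfl
  rw [zero_sub, neg_mem_iff] at h
  exact linearIndependent_moment.notMem_span_image (fun h : Below F F => h.2 rfl) h

/-- The difference lies in a span of moment measures of smaller groups, on which `1 / #F` is not an
eigenvalue. -/
theorem leading_unique {F : X0 p} {E E' : X0 p → ℝ}
    (h : IsLeadingEigenfunction F E) (h' : IsLeadingEigenfunction F E') : E = E' := by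
  obtain ⟨T, hT⟩ := exists_linear_extension p
  obtain ⟨n, hn⟩ := Nat.exists_eq_succ_of_ne_zero (Nat.card_pos (α := F.rep)).ne'
  have h1 : E - E' ∈ below F := by
    have := (below F).sub_mem h.2 h'.2
    rwa [sub_sub_sub_cancel_right] at this
  rw [← sub_eq_zero]
  refine eq_zero_of_mem_spanLE (c := 1 / (Nat.card F.rep : ℝ)) n (fun m hm hmn =>
    one_div_ne_one_div hm (by omega)) (below_le_spanLE hn.le h1) ?_
  rw [hT _ (below_le_L2 F h1), map_sub, ← hT _ (leading_mem_L2 h.2), ← hT _ (leading_mem_L2 h'.2),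
    h.1.2, h'.1.2, smul_sub]

end

/-! ## Bounds in terms of the rank -/

section

variable {p : ℕ} [Fact p.Prime]

variable (N : Type) [AddCommGroup N] [Module ℤ_[p] N]

theorem card_quotient_maximalIdeal_smul [Module.Finite ℤ_[p] N] :
    Nat.card (N ⧸ IsLocalRing.maximalIdeal ℤ_[p] • (⊤ : Submodule ℤ_[p] N)) = p ^ rk p N := by
  let K : Submodule ℤ_[p] N := IsLocalRing.maximalIdeal ℤ_[p] • ⊤
  let m : Module (ℤ_[p] ⧸ IsLocalRing.maximalIdeal ℤ_[p]) (N ⧸ K) := inferInstance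
  have tower : IsScalarTower ℤ_[p] (ℤ_[p] ⧸ IsLocalRing.maximalIdeal ℤ_[p]) (N ⧸ K) := inferInstance
  let : Module (Res p) (N ⧸ K) := m
  have : IsScalarTower ℤ_[p] (Res p) (N ⧸ K) := tower
  have hK : ∀ f : N →ₗ[ℤ_[p]] Res p, K ≤ LinearMap.ker f := fun f => by
    refine Submodule.smul_le.2 fun a ha x _ => ?_
    rw [LinearMap.mem_ker, map_smul, residue_smul, (IsLocalRing.residue_eq_zero_iff a).2 ha,
      zero_mul]
  have hfin : Module.Finite (Res p) (N ⧸ K) := Module.Finite.of_restrictScalars_finite ℤ_[p] _ _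
  change Nat.card (N ⧸ K) = _
  rw [← card_hom_res, Nat.card_congr ((Equiv.subtypeUnivEquiv hK).symm.trans (homQuotientEquiv K)),
    Nat.card_congr (LinearMap.extendScalarsOfSurjectiveEquiv (R := ℤ_[p]) (S := Res p)
      (M := N ⧸ K) (N := Res p) IsLocalRing.residue_surjective).toEquiv,
    Module.natCard_eq_pow_finrank (K := Res p), Module.natCard_eq_pow_finrank (K := Res p)
      (V := (N ⧸ K) →ₗ[Res p] Res p)]
  congr 1
  exact (Subspace.dual_finrank_eq (K := Res p)).symm

/-- The rank counts the elements that are killed by `p`. -/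
theorem pow_rk [Finite N] :
    p ^ rk p N = Nat.card (LinearMap.ker (LinearMap.lsmul ℤ_[p] N (p : ℤ_[p]))) := by
  set f := LinearMap.lsmul ℤ_[p] N (p : ℤ_[p])
  have hK : IsLocalRing.maximalIdeal ℤ_[p] • (⊤ : Submodule ℤ_[p] N) = LinearMap.range f := by
    rw [PadicInt.maximalIdeal_eq_span_p, Submodule.ideal_span_singleton_smul]
    ext x
    rw [Submodule.mem_smul_pointwise_iff_exists]
    simp [f]
  -- For multiplication by `p` on a finite module, kernel and cokernel have the same order.
  rw [← card_quotient_maximalIdeal_smul, hK]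
  have h1 := card_eq_card_submodule_mul_card_quotient (LinearMap.range f)
  have h2 := card_eq_card_submodule_mul_card_quotient (LinearMap.ker f)
  rw [Nat.card_congr f.quotKerEquivRange.toEquiv, mul_comm, h1] at h2
  exact Nat.eq_of_mul_eq_mul_left Nat.card_pos h2

/-- Monotonicity is visible on elements killed by `p`, though not on the quotient modulo `p`. -/
theorem rk_submodule_le [Finite N] (M : Submodule ℤ_[p] N) : rk p M ≤ rk p N := by
  rw [← Nat.pow_le_pow_iff_right (Fact.out : p.Prime).one_lt, pow_rk, pow_rk]
  refine Nat.card_le_card_of_injective (fun x => ⟨x.1.1, ?_⟩) fun x y h => ?_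
  · have := x.2
    rw [LinearMap.mem_ker, LinearMap.lsmul_apply] at this ⊢
    exact congrArg Subtype.val this
  · exact Subtype.ext (Subtype.ext (Subtype.mk.inj h))

theorem card_hom_le_mul (G K : Type) [AddCommGroup G] [Module ℤ_[p] G] [Finite G] [AddCommGroup K]
    [Module ℤ_[p] K] [Finite K] (K' : Submodule ℤ_[p] K) :
    Nat.card (G →ₗ[ℤ_[p]] K) ≤ Nat.card (G →ₗ[ℤ_[p]] K') * Nat.card (G →ₗ[ℤ_[p]] (K ⧸ K')) := by
  let f : (G →ₗ[ℤ_[p]] K) →+ (G →ₗ[ℤ_[p]] (K ⧸ K')) :=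
    AddMonoidHom.mk' (fun g => K'.mkQ ∘ₗ g) fun a b => LinearMap.comp_add _ _ _
  rw [card_eq_card_ker_mul_card f.rangeRestrict f.rangeRestrict_surjective,
    AddMonoidHom.ker_rangeRestrict]
  refine Nat.mul_le_mul ?_ (Nat.card_le_card_of_injective _ Subtype.val_injective)
  have hmem : ∀ g : f.ker, ∀ x, g.1 x ∈ K' := fun g x => by
    have := LinearMap.congr_fun ((AddMonoidHom.mem_ker).1 g.2) x
    exact (Submodule.Quotient.mk_eq_zero K').1 this
  refine Nat.card_le_card_of_injective (fun g => LinearMap.codRestrict K' g.1 (hmem g))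
    fun g g' h => ?_
  refine Subtype.ext (LinearMap.ext fun x => ?_)
  exact congrArg Subtype.val (LinearMap.congr_fun h x)

/-- The number of homomorphisms to a given group is polynomial in the order of the largest
elementary abelian quotient. -/
theorem exists_card_hom_le (n : ℕ) : ∀ (K : Type) [AddCommGroup K] [Module ℤ_[p] K] [Finite K],
    Nat.card K = n → ∃ l : ℕ, ∀ (G : Type) [AddCommGroup G] [Module ℤ_[p] G] [Finite G],
      Nat.card (G →ₗ[ℤ_[p]] K) ≤ (p ^ rk p G) ^ l := by
  induction n using Nat.strong_induction_on with
  | _ n ih =>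
    intro K _ _ _ hn
    rcases subsingleton_or_nontrivial K with hK | hK
    · refine ⟨0, fun G _ _ _ => ?_⟩
      rw [pow_zero, Finite.card_le_one_iff_subsingleton]
      exact ⟨fun f g => LinearMap.ext fun x => Subsingleton.elim _ _⟩
    -- Peel off a simple quotient of `K`; each composition factor contributes one factor `p ^ rk`.
    · obtain ⟨K', hK', ⟨e⟩⟩ := exists_quotient_equiv_res (p := p) K
      have hlt : Nat.card K' < n := by
        rw [← hn, card_eq_card_submodule_mul_card_quotient K', Nat.card_congr e.toEquiv, card_res]
        exact lt_mul_of_one_lt_right Nat.card_pos (Fact.out : p.Prime).one_lt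
      obtain ⟨l, hl⟩ := ih _ hlt K' rfl
      refine ⟨l + 1, fun G _ _ _ => (card_hom_le_mul G K K').trans ?_⟩
      rw [pow_succ]
      refine Nat.mul_le_mul (hl G) ?_
      rw [← card_hom_res, Nat.card_congr ((LinearEquiv.refl ℤ_[p] G).arrowCongr e).toEquiv]

/-! ## Growth of the moments of an eigenfunction -/

/-- Eliminate a coordinate where `x` is nonzero. All nonzero `x` give the same quotient, so the
recursion for moments stays within the elementary abelian groups. -/
theorem pi_quotient_span {n : ℕ} {x : Fin (n + 1) → Res p} (hx : x ≠ 0) :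
    Nonempty (((Fin (n + 1) → Res p) ⧸ Submodule.span ℤ_[p] {x}) ≃ₗ[ℤ_[p]] (Fin n → Res p)) := by
  obtain ⟨i, hi⟩ := Function.ne_iff.1 hx
  have hi' : x i ≠ 0 := hi
  let f : (Fin (n + 1) → Res p) →ₗ[ℤ_[p]] (Fin n → Res p) := LinearMap.pi fun j =>
    LinearMap.proj (i.succAbove j) - (x (i.succAbove j) / x i) • LinearMap.proj i
  have hf : ∀ y j, f y j = y (i.succAbove j) - x (i.succAbove j) / x i * y i := fun y j => rfl
  have hker : LinearMap.ker f = Submodule.span ℤ_[p] {x} := by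
    refine le_antisymm (fun y hy => ?_) ?_
    · obtain ⟨t, ht⟩ := IsLocalRing.residue_surjective (y i / x i)
      refine Submodule.mem_span_singleton.2 ⟨t, ?_⟩
      ext j
      rw [Pi.smul_apply, residue_smul, ht]
      rcases Fin.eq_self_or_eq_succAbove i j with rfl | ⟨j, rfl⟩
      · exact div_mul_cancel₀ _ hi'
      · have h1 := congrFun (LinearMap.mem_ker.1 hy) j
        rw [hf, Pi.zero_apply, sub_eq_zero] at h1
        rw [h1]
        ring
    · rw [Submodule.span_singleton_le_iff_mem, LinearMap.mem_ker]
      ext j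
      rw [hf, div_mul_cancel₀ _ hi', sub_self, Pi.zero_apply]
  have hsurj : Function.Surjective f := fun z => by
    refine ⟨i.insertNth (α := fun _ => Res p) 0 z, ?_⟩
    ext j
    rw [hf, Fin.insertNth_apply_same, Fin.insertNth_apply_succAbove, mul_zero, sub_zero]
  exact ⟨(Submodule.quotEquivOfEq _ _ hker.symm).trans (f.quotKerEquivOfSurjective hsurj)⟩

theorem mom_nonneg {F : Type} [AddCommGroup F] [Module ℤ_[p] F] {ν : X0 p → ℝ}
    (h : ∀ G, 0 ≤ ν G) : 0 ≤ mom F ν :=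
  tsum_nonneg fun G => mul_nonneg (h G) (Nat.cast_nonneg _)

theorem abs_Delta0_le {ν : X0 p → ℝ} (h : Summable ν) (G : X0 p) :
    |Delta0 ν G| ≤ Delta0 (fun G => |ν G|) G := by
  have hP : ∀ G H, 0 ≤ probDStar (p := p) G H := fun G H => by
    rw [probDStar_eq_toReal]
    exact ENNReal.toReal_nonneg
  have hD : ∀ H G, 0 ≤ probD (p := p) H G := fun H G => by
    rw [probD_eq]
    exact ENNReal.toReal_nonneg
  have h1 : ∀ H, |dStar ν H| ≤ dStar (fun G => |ν G|) H := fun H => by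
    refine (norm_tsum_le_tsum_norm (summable_mul_probDStar h H).norm).trans_eq ?_
    exact tsum_congr fun G => by rw [norm_mul, Real.norm_eq_abs, Real.norm_of_nonneg (hP G H)]
  have h2 := summable_mul_probD (summable_dStar h) G
  have h3 := summable_mul_probD (summable_dStar h.abs) G
  refine (norm_tsum_le_tsum_norm h2.norm).trans ?_
  refine h2.norm.tsum_le_tsum (fun H => ?_) h3
  rw [norm_mul, Real.norm_eq_abs, Real.norm_of_nonneg (hD H G)]
  exact mul_le_mul_of_nonneg_right (h1 H) (hD H G)

/-- The moments of an eigenfunction satisfy a recursive inequality. -/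
theorem mom_abs_succ_le {ν : X0 p → ℝ} (hν : ν ∈ L2 p) {c : ℝ} (h : Delta0 ν = c • ν) (n : ℕ) :
    |c| * mom (Fin (n + 1) → Res p) (fun G => |ν G|) ≤
      ((p : ℝ) ^ (n + 1))⁻¹ * mom (Fin (n + 1) → Res p) (fun G => |ν G|) +
        mom (Fin n → Res p) (fun G => |ν G|) := by
  classical
  have hcard : Nat.card (Fin (n + 1) → Res p) = p ^ (n + 1) := by
    rw [Nat.card_fun, card_res, Nat.card_eq_fintype_card, Fintype.card_fin]
  obtain ⟨hs, hm⟩ := mom_Delta0 (L2.abs hν) (Fin (n + 1) → Res p)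
  have h0 : 0 ≤ mom (Fin n → Res p) (fun G => |ν G|) := mom_nonneg fun G => abs_nonneg _
  have hp : (0 : ℝ) < (p : ℝ) ^ (n + 1) := pow_pos (zero_lt_one.trans one_lt_p) _
  calc |c| * mom (Fin (n + 1) → Res p) (fun G => |ν G|)
      = ∑' G, |c| * (|ν G| * nSur p G.rep (Fin (n + 1) → Res p)) := tsum_mul_left.symm
    _ ≤ mom (Fin (n + 1) → Res p) (Delta0 fun G => |ν G|) := by
        refine ((L2.summable_mul (L2.abs hν) _).mul_left _).tsum_le_tsum (fun G => ?_) hs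
        rw [← mul_assoc]
        refine mul_le_mul_of_nonneg_right ?_ (Nat.cast_nonneg _)
        rw [← abs_mul]
        have := abs_Delta0_le (L2.summable hν) G
        rwa [h] at this
    _ = ((p : ℝ) ^ (n + 1))⁻¹ * (mom (Fin (n + 1) → Res p) (fun G => |ν G|) +
          ((p : ℝ) ^ (n + 1) - 1) * mom (Fin n → Res p) (fun G => |ν G|)) := by
        rw [hm, hcard, Nat.cast_pow, ← Finset.add_sum_erase _ _ (Finset.mem_univ 0),
          mom_congr (Submodule.quotEquivOfEqBot _ (Submodule.span_zero_singleton _)),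
          Finset.sum_congr rfl fun x hx =>
            mom_congr (pi_quotient_span (Finset.ne_of_mem_erase hx)).some (fun G => |ν G|),
          Finset.sum_const, Finset.card_erase_of_mem (Finset.mem_univ _), Finset.card_univ,
          ← Nat.card_eq_fintype_card, hcard, nsmul_eq_mul,
          Nat.cast_sub (Nat.one_le_pow _ _ (Fact.out : p.Prime).pos), Nat.cast_one, Nat.cast_pow]
    _ ≤ _ := by
        rw [mul_add, ← mul_assoc]
        refine add_le_add_right ?_ _
        refine mul_le_of_le_one_left h0 ?_
        rw [inv_mul_le_iff₀ hp]
        linarith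

/-- Once `r n < c / 2`, the inequality becomes `a (n + 1) ≤ (2 / c) a n`; the finitely many earlier
terms go into the constant `A`. -/
theorem exists_geometric_bound {a r : ℕ → ℝ} {c : ℝ} (hc : 0 < c) (ha : ∀ n, 0 ≤ a n)
    (hr : Filter.Tendsto r Filter.atTop (nhds 0))
    (h : ∀ n, c * a (n + 1) ≤ r n * a (n + 1) + a n) :
    ∃ A B : ℝ, 0 ≤ A ∧ 1 ≤ B ∧ ∀ n, a n ≤ A * B ^ n := by
  obtain ⟨N, hN⟩ := Filter.eventually_atTop.1 (hr.eventually (gt_mem_nhds (half_pos hc)))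
  set B := max 1 (2 / c)
  have hB : 1 ≤ B := le_max_left _ _
  have hsum : 0 ≤ ∑ i ∈ Finset.range (N + 1), a i := Finset.sum_nonneg fun i _ => ha i
  refine ⟨∑ i ∈ Finset.range (N + 1), a i, B, hsum, hB, fun n => ?_⟩
  have hsmall : ∀ n ≤ N, a n ≤ (∑ i ∈ Finset.range (N + 1), a i) * B ^ n := fun n hn =>
    (Finset.single_le_sum (fun i _ => ha i) (Finset.mem_range.2 (Nat.lt_succ_of_le hn))).trans
      (le_mul_of_one_le_right hsum (one_le_pow₀ hB))
  rcases le_total n N with hn | hn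
  · exact hsmall n hn
  · induction n, hn using Nat.le_induction with
    | base => exact hsmall N le_rfl
    | succ n hn ih =>
      have h1 : c / 2 * a (n + 1) ≤ a n := by
        have := mul_le_mul_of_nonneg_right (hN n hn).le (ha (n + 1))
        linarith [h n]
      have h2 : a (n + 1) ≤ 2 / c * a n := by
        rw [div_mul_eq_mul_div, le_div_iff₀ hc]
        linarith
      calc a (n + 1) ≤ 2 / c * a n := h2
        _ ≤ B * a n := mul_le_mul_of_nonneg_right (le_max_right _ _) (ha n)
        _ ≤ B * ((∑ i ∈ Finset.range (N + 1), a i) * B ^ n) :=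
            mul_le_mul_of_nonneg_left ih (zero_le_one.trans hB)
        _ = _ := by ring

/-- The moments of an eigenfunction, weighted by the rank, grow at most geometrically. -/
theorem exists_weighted_bound {ν : X0 p → ℝ} (hν : ν ∈ L2 p) {c : ℝ} (hc : c ≠ 0)
    (h : Delta0 ν = c • ν) (j : ℕ) : ∃ A B : ℝ, 0 ≤ A ∧ 1 ≤ B ∧ ∀ k,
      (Summable fun G => |ν G| * ((p : ℝ) ^ rk p G.rep) ^ j * nSur p G.rep (Fin k → Res p)) ∧
      ∑' G, |ν G| * ((p : ℝ) ^ rk p G.rep) ^ j * nSur p G.rep (Fin k → Res p) ≤ A * B ^ k := by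
  have hp1 := one_lt_p (p := p)
  induction j with
  | zero =>
    have hr : Filter.Tendsto (fun n : ℕ => ((p : ℝ) ^ (n + 1))⁻¹) Filter.atTop (nhds 0) := by
      have := (tendsto_pow_atTop_nhds_zero_of_lt_one (inv_nonneg.2 (zero_le_one.trans hp1.le))
        (inv_lt_one_of_one_lt₀ hp1)).comp (Filter.tendsto_add_atTop_nat 1)
      refine this.congr fun n => ?_
      rw [Function.comp_apply, inv_pow]
    obtain ⟨A, B, hA, hB, hAB⟩ := exists_geometric_bound (abs_pos.2 hc)
      (fun n => mom_nonneg (F := Fin n → Res p) fun G => abs_nonneg (ν G)) hr (mom_abs_succ_le hν h)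
    refine ⟨A, B, hA, hB, fun k => ?_⟩
    simp only [pow_zero, mul_one]
    exact ⟨L2.summable_mul (L2.abs hν) _, hAB k⟩
  | succ j ih =>
    obtain ⟨A, B, hA, hB, hAB⟩ := ih
    refine ⟨A * (B + 1), p * B, mul_nonneg hA (by linarith), one_le_mul_of_one_le_of_one_le hp1.le hB,
      fun k => ?_⟩
    -- Write one factor `p ^ rk` as `(p ^ rk - p ^ k) + p ^ k`; the bracket turns the count for `𝔽_p
    -- ^ k` into that for `𝔽_p ^ (k + 1)`.
    have hS : ∀ G : X0 p, |ν G| * ((p : ℝ) ^ rk p G.rep) ^ (j + 1) * nSur p G.rep (Fin k → Res p) =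
        |ν G| * ((p : ℝ) ^ rk p G.rep) ^ j * nSur p G.rep (Fin (k + 1) → Res p) +
        (p : ℝ) ^ k * (|ν G| * ((p : ℝ) ^ rk p G.rep) ^ j * nSur p G.rep (Fin k → Res p)) := by
      intro G
      rw [nSur_pi_cast, nSur_pi_cast, Finset.prod_range_succ]
      ring
    simp_rw [hS]
    have s1 := (hAB (k + 1)).1
    have s2 := (hAB k).1.mul_left ((p : ℝ) ^ k)
    refine ⟨s1.add s2, ?_⟩
    rw [s1.tsum_add s2, tsum_mul_left]
    have hpk : (1 : ℝ) ≤ (p : ℝ) ^ k := one_le_pow₀ hp1.le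
    have hBk : 0 ≤ B ^ k := pow_nonneg (zero_le_one.trans hB) _
    calc _ ≤ A * B ^ (k + 1) + (p : ℝ) ^ k * (A * B ^ k) :=
          add_le_add (hAB (k + 1)).2 (mul_le_mul_of_nonneg_left (hAB k).2 (by linarith))
      _ ≤ (p : ℝ) ^ k * (A * B ^ (k + 1)) + (p : ℝ) ^ k * (A * B ^ k) := by
          refine add_le_add_left (le_mul_of_one_le_left ?_ hpk) _
          exact mul_nonneg hA (pow_nonneg (zero_le_one.trans hB) _)
      _ = _ := by ring

end

/-! ## Uniqueness of the measure with vanishing moments -/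

section

variable {p : ℕ} [Fact p.Prime]

theorem sum_card_comm {α β : Type*} [Fintype α] [Fintype β] (P : α → β → Prop) :
    ∑ a, Nat.card {b // P a b} = ∑ b, Nat.card {a // P a b} := by
  classical
  simp only [Nat.card_eq_fintype_card, Fintype.card_subtype, Finset.card_filter]
  exact Finset.sum_comm

/-! ### Intervals in the lattice of submodules -/

section Lattice

variable {G : Type} [AddCommGroup G] [Module ℤ_[p] G]

/-- Submodules contained in a given one. -/
def submoduleLEEquiv (M : Submodule ℤ_[p] G) (Q : Submodule ℤ_[p] M → Prop) :
    {L : Submodule ℤ_[p] G // L ≤ M ∧ Q (L.comap M.subtype)} ≃ {L : Submodule ℤ_[p] M // Q L} where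
  toFun L := ⟨L.1.comap M.subtype, L.2.2⟩
  invFun L := ⟨L.1.map M.subtype, Submodule.map_subtype_le M L.1, by
    rw [Submodule.comap_map_eq_of_injective M.injective_subtype]
    exact L.2⟩
  left_inv L := Subtype.ext (by
    change (L.1.comap M.subtype).map M.subtype = L.1
    rw [Submodule.map_comap_subtype, inf_eq_right.2 L.2.1])
  right_inv L := Subtype.ext (Submodule.comap_map_eq_of_injective M.injective_subtype L.1)

/-- Submodules containing a given one. -/
def submoduleGEEquiv (L : Submodule ℤ_[p] G) (Q : Submodule ℤ_[p] G → Prop) :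
    {M : Submodule ℤ_[p] G // L ≤ M ∧ Q M} ≃
      {M : Submodule ℤ_[p] (G ⧸ L) // Q (M.comap L.mkQ)} where
  toFun M := ⟨M.1.map L.mkQ, by
    rw [Submodule.comap_map_mkQ, sup_eq_right.2 M.2.1]
    exact M.2.2⟩
  invFun M := ⟨M.1.comap L.mkQ, L.le_comap_mkQ M.1, M.2⟩
  left_inv M := Subtype.ext (by
    change (M.1.map L.mkQ).comap L.mkQ = M.1
    rw [Submodule.comap_map_mkQ, sup_eq_right.2 M.2.1])
  right_inv M := Subtype.ext (Submodule.map_comap_eq_of_surjective L.mkQ_surjective M.1)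

theorem comap_mkQ_quotient (L : Submodule ℤ_[p] G) (M : Submodule ℤ_[p] (G ⧸ L)) :
    Nonempty ((G ⧸ M.comap L.mkQ) ≃ₗ[ℤ_[p]] ((G ⧸ L) ⧸ M)) := by
  have hker : LinearMap.ker (M.mkQ ∘ₗ L.mkQ) = M.comap L.mkQ := by
    rw [LinearMap.ker_comp, Submodule.ker_mkQ]
  exact ⟨(Submodule.quotEquivOfEq _ _ hker.symm).trans
    ((M.mkQ ∘ₗ L.mkQ).quotKerEquivOfSurjective (M.mkQ_surjective.comp L.mkQ_surjective))⟩

theorem comap_mkQ_self_quotient (L : Submodule ℤ_[p] G) (M : Submodule ℤ_[p] (G ⧸ L)) :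
    Nonempty ((M.comap L.mkQ ⧸ L.comap (M.comap L.mkQ).subtype) ≃ₗ[ℤ_[p]] M) := by
  let f : M.comap L.mkQ →ₗ[ℤ_[p]] M := L.mkQ.restrict fun x hx => hx
  have hker : LinearMap.ker f = L.comap (M.comap L.mkQ).subtype := by
    ext x
    rw [LinearMap.mem_ker, Subtype.ext_iff]
    exact Submodule.Quotient.mk_eq_zero L
  have hf : Function.Surjective f := fun y => by
    obtain ⟨x, hx⟩ := L.mkQ_surjective y.1
    exact ⟨⟨x, by rw [Submodule.mem_comap, hx]; exact y.2⟩, Subtype.ext hx⟩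
  exact ⟨(Submodule.quotEquivOfEq _ _ hker.symm).trans (f.quotKerEquivOfSurjective hf)⟩

end Lattice

variable (K : X0 p) (k : ℕ)

open Classical in
/-- The sum of the numbers of surjections to an elementary abelian group, over the submodules with
a given quotient. -/
def subSur (G : X0 p) : ℕ :=
  ∑' M : Submodule ℤ_[p] G.rep,
    if Nonempty ((G.rep ⧸ M) ≃ₗ[ℤ_[p]] K.rep) then nSur p M (Fin k → Res p) else 0

/-- The number of elementary abelian subgroups with a given quotient. -/
def numSub (Q : X0 p) : ℕ :=
  Nat.card {M : Submodule ℤ_[p] Q.rep // Nonempty ((Q.rep ⧸ M) ≃ₗ[ℤ_[p]] K.rep) ∧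
    Nonempty (M ≃ₗ[ℤ_[p]] (Fin k → Res p))}

theorem card_of_numSub_ne_zero {Q : X0 p} (h : numSub K k Q ≠ 0) :
    Nat.card Q.rep = p ^ k * Nat.card K.rep := by
  obtain ⟨⟨M, ⟨e⟩, ⟨e'⟩⟩⟩ := (Nat.card_ne_zero.1 h).1
  rw [card_eq_card_submodule_mul_card_quotient M, Nat.card_congr e.toEquiv,
    Nat.card_congr e'.toEquiv, Nat.card_fun, card_res, Nat.card_eq_fintype_card, Fintype.card_fin]

theorem numSub_of (Q : Type) [AddCommGroup Q] [Module ℤ_[p] Q] [Finite Q] :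
    numSub K k (X0.of Q) = Nat.card {M : Submodule ℤ_[p] Q //
      Nonempty ((Q ⧸ M) ≃ₗ[ℤ_[p]] K.rep) ∧ Nonempty (M ≃ₗ[ℤ_[p]] (Fin k → Res p))} := by
  obtain ⟨e⟩ := X0.rep_of (p := p) Q
  refine Nat.card_congr (Equiv.subtypeEquiv (Submodule.orderIsoMapComap e).toEquiv fun M => ?_)
  have e1 : ((X0.of (p := p) Q).rep ⧸ M) ≃ₗ[ℤ_[p]] (Q ⧸ M.map e.toLinearMap) :=
    Submodule.Quotient.equiv M _ e rfl
  have e2 : M ≃ₗ[ℤ_[p]] M.map e.toLinearMap := e.submoduleMap M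
  exact and_congr ⟨fun ⟨f⟩ => ⟨e1.symm.trans f⟩, fun ⟨f⟩ => ⟨e1.trans f⟩⟩
    ⟨fun ⟨f⟩ => ⟨e2.symm.trans f⟩, fun ⟨f⟩ => ⟨e2.trans f⟩⟩

theorem card_quotient_eq_div (G F : X0 p) :
    (Nat.card {L : Submodule ℤ_[p] G.rep // X0.of (G.rep ⧸ L) = F} : ℝ) =
      nSur p G.rep F.rep / cardAut F := by
  have hF : (cardAut F : ℝ) ≠ 0 := Nat.cast_ne_zero.2 (cardAut_pos F).ne'
  rw [eq_div_iff hF, nSur, card_sur, Nat.cast_mul, cardAut]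
  congr 2
  exact Nat.card_congr (Equiv.subtypeEquivRight fun L => X0.of_eq_iff _ _)

/-- The function `subSur` is a finite linear combination of numbers of surjections. -/
theorem subSur_eq (G : X0 p) : (subSur K k G : ℝ) =
    gl p k * ∑ F ∈ (finite_card_eq p (p ^ k * Nat.card K.rep)).toFinset,
      (numSub K k F : ℝ) * ((nSur p G.rep F.rep : ℝ) / cardAut F) := by
  classical
  have : Fintype (Submodule ℤ_[p] G.rep) := Fintype.ofFinite _
  -- Count pairs `L ≤ M` with `G / M ≅ K` and `M / L ≅ 𝔽_p ^ k`. Fixing `M` gives `subSur` up to the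
  -- order of the general linear group; fixing `L` gives a number depending only on `G / L`, a group
  -- of order `p ^ k #K`.
  let Q : Submodule ℤ_[p] G.rep → Submodule ℤ_[p] G.rep → Prop := fun L M =>
    Nonempty ((G.rep ⧸ M) ≃ₗ[ℤ_[p]] K.rep) ∧
      Nonempty ((M ⧸ L.comap M.subtype) ≃ₗ[ℤ_[p]] (Fin k → Res p))
  have h1 : ∀ M : Submodule ℤ_[p] G.rep, ((if Nonempty ((G.rep ⧸ M) ≃ₗ[ℤ_[p]] K.rep) then
      nSur p M (Fin k → Res p) else 0 : ℕ) : ℝ) = gl p k * Nat.card {L // L ≤ M ∧ Q L M} := by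
    intro M
    split_ifs with hM
    · rw [nSur, card_sur, Nat.cast_mul, card_aut_pi, mul_comm,
        ← Nat.card_congr (submoduleLEEquiv M fun L =>
          Nonempty ((M ⧸ L) ≃ₗ[ℤ_[p]] (Fin k → Res p)))]
      congr 2
      exact Nat.card_congr (Equiv.subtypeEquivRight fun L => by simp only [Q, hM, true_and])
    · have : IsEmpty {L // L ≤ M ∧ Q L M} := ⟨fun L => hM L.2.2.1⟩
      rw [Nat.card_of_isEmpty, Nat.cast_zero, mul_zero]
  have h2 : ∀ L : Submodule ℤ_[p] G.rep,
      Nat.card {M // L ≤ M ∧ Q L M} = numSub K k (X0.of (G.rep ⧸ L)) := by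
    intro L
    rw [numSub_of, Nat.card_congr (submoduleGEEquiv L (Q L))]
    refine Nat.card_congr (Equiv.subtypeEquivRight fun M => ?_)
    obtain ⟨e1⟩ := comap_mkQ_quotient L M
    obtain ⟨e2⟩ := comap_mkQ_self_quotient L M
    exact and_congr ⟨fun ⟨f⟩ => ⟨e1.symm.trans f⟩, fun ⟨f⟩ => ⟨e1.trans f⟩⟩
      ⟨fun ⟨f⟩ => ⟨e2.symm.trans f⟩, fun ⟨f⟩ => ⟨e2.trans f⟩⟩
  have h3 := sum_card_comm fun M L : Submodule ℤ_[p] G.rep => L ≤ M ∧ Q L M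
  rw [subSur, tsum_fintype, Nat.cast_sum]
  simp_rw [h1]
  rw [← Finset.mul_sum, ← Nat.cast_sum, h3]
  simp_rw [h2]
  congr 1
  have h4 : ∀ L : Submodule ℤ_[p] G.rep, (numSub K k (X0.of (G.rep ⧸ L)) : ℝ) =
      ∑ F ∈ (finite_card_eq p (p ^ k * Nat.card K.rep)).toFinset,
        if X0.of (G.rep ⧸ L) = F then (numSub K k F : ℝ) else 0 := by
    intro L
    rw [Finset.sum_ite_eq]
    split_ifs with h
    · rfl
    · rw [Set.Finite.mem_toFinset] at h
      by_contra h0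
      exact h (card_of_numSub_ne_zero K k fun h' => h0 (by rw [h', Nat.cast_zero]))
  rw [Nat.cast_sum]
  simp_rw [h4]
  rw [Finset.sum_comm]
  refine Finset.sum_congr rfl fun F _ => ?_
  rw [← card_quotient_eq_div, Finset.sum_ite, Finset.sum_const_zero, add_zero, Finset.sum_const,
    nsmul_eq_mul, mul_comm, Nat.card_eq_fintype_card, Fintype.card_subtype]

theorem tsum_mul_subSur {ν : X0 p → ℝ} (hν : ν ∈ L2 p)
    (h : ∀ (F : Type) [AddCommGroup F] [Module ℤ_[p] F] [Finite F], mom F ν = 0) :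
    ∑' G, ν G * subSur K k G = 0 := by
  have h1 : ∀ G, ν G * subSur K k G =
      ∑ F ∈ (finite_card_eq p (p ^ k * Nat.card K.rep)).toFinset,
        gl p k * numSub K k F / cardAut F * (ν G * nSur p G.rep F.rep) := by
    intro G
    rw [subSur_eq, Finset.mul_sum, Finset.mul_sum]
    exact Finset.sum_congr rfl fun F _ => by ring
  have h2 : ∀ F : X0 p, HasSum (fun G => gl p k * numSub K k F / cardAut F *
      (ν G * nSur p G.rep F.rep)) 0 := by
    intro F
    have h3 := (L2.summable_mul hν F.rep).hasSum
    have h4 : ∑' G : X0 p, ν G * nSur p G.rep F.rep = 0 := h F.rep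
    rw [h4] at h3
    have h5 := h3.mul_left (gl p k * numSub K k F / cardAut F)
    rwa [mul_zero] at h5
  have h6 := hasSum_sum (s := (finite_card_eq p (p ^ k * Nat.card K.rep)).toFinset)
    fun F _ => h2 F
  rw [Finset.sum_const_zero] at h6
  rw [tsum_congr h1]
  exact h6.tsum_eq

theorem nSur_pi_eq_zero {M : Type} [AddCommGroup M] [Module ℤ_[p] M] [Module.Finite ℤ_[p] M]
    {k : ℕ} (h : rk p M < k) : nSur p M (Fin k → Res p) = 0 := by
  have := nSur_pi_cast (p := p) M k
  rw [Finset.prod_eq_zero (Finset.mem_range.2 h) (sub_self _)] at this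
  exact_mod_cast this

theorem nSur_pi_le {M N : Type} [AddCommGroup M] [Module ℤ_[p] M] [Module.Finite ℤ_[p] M]
    [AddCommGroup N] [Module ℤ_[p] N] [Module.Finite ℤ_[p] N] (h : rk p M ≤ rk p N) :
    nSur p M (Fin k → Res p) ≤ nSur p N (Fin k → Res p) := by
  rw [nSur_pi, nSur_pi]
  exact Finset.prod_le_prod' fun i _ =>
    Nat.sub_le_sub_right (Nat.pow_le_pow_right (Fact.out : p.Prime).pos h) _

theorem subSur_eq_zero {G : X0 p} (h : rk p G.rep < k) : subSur K k G = 0 := by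
  classical
  rw [subSur]
  refine (tsum_congr fun M => ?_).trans tsum_zero
  rw [nSur_pi_eq_zero ((rk_submodule_le _ M).trans_lt h), ite_self]

/-- There are at most `#Hom(G, K)` submodules with quotient `K`, and passing to a submodule does not
raise the rank. The majorant is of the kind controlled by `exists_weighted_bound`. -/
theorem subSur_le (G : X0 p) :
    subSur K k G ≤ Nat.card (G.rep →ₗ[ℤ_[p]] K.rep) * nSur p G.rep (Fin k → Res p) := by
  classical
  have : Fintype (Submodule ℤ_[p] G.rep) := Fintype.ofFinite _
  have h1 : Nat.card {M : Submodule ℤ_[p] G.rep // Nonempty ((G.rep ⧸ M) ≃ₗ[ℤ_[p]] K.rep)} ≤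
      Nat.card (G.rep →ₗ[ℤ_[p]] K.rep) :=
    calc _ ≤ nSur p G.rep K.rep := by
          rw [nSur, card_sur]
          exact Nat.le_mul_of_pos_right _ (cardAut_pos K)
      _ ≤ _ := Nat.card_le_card_of_injective _ Subtype.val_injective
  rw [subSur, tsum_fintype, ← Finset.sum_filter]
  refine (Finset.sum_le_card_nsmul _ _ _ fun M _ => nSur_pi_le k (rk_submodule_le _ M)).trans ?_
  rw [smul_eq_mul, ← Fintype.card_subtype, ← Nat.card_eq_fintype_card]
  exact Nat.mul_le_mul_right _ h1

open Classical in
/-- Möbius inversion for the isomorphism classes. -/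
theorem tsum_mob_subSur (G : X0 p) :
    ∑' k, (-1) ^ k * mob p k * (subSur K k G : ℝ) = if G = K then 1 else 0 := by
  have : Fintype (Submodule ℤ_[p] G.rep) := Fintype.ofFinite _
  rw [tsum_eq_sum (s := Finset.range (rk p G.rep + 1)) fun k hk => by
    rw [subSur_eq_zero K k (by simpa [Nat.lt_succ_iff] using hk), Nat.cast_zero, mul_zero]]
  have h1 : ∀ k, (-1) ^ k * mob p k * (subSur K k G : ℝ) =
      ∑ M : Submodule ℤ_[p] G.rep, if Nonempty ((G.rep ⧸ M) ≃ₗ[ℤ_[p]] K.rep) then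
        (-1) ^ k * mob p k * (nSur p M (Fin k → Res p) : ℝ) else 0 := by
    intro k
    rw [subSur, tsum_fintype, Nat.cast_sum, Finset.mul_sum]
    refine Finset.sum_congr rfl fun M _ => ?_
    rw [Nat.cast_ite, Nat.cast_zero, mul_ite, mul_zero]
  simp_rw [h1]
  rw [Finset.sum_comm]
  -- The alternating sum singles out `M = ⊥`, whose quotient is `G`; the common upper limit `rk G`
  -- suffices because `rk M ≤ rk G`.
  have h2 : ∀ M : Submodule ℤ_[p] G.rep, (∑ k ∈ Finset.range (rk p G.rep + 1),
      if Nonempty ((G.rep ⧸ M) ≃ₗ[ℤ_[p]] K.rep) then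
        (-1) ^ k * mob p k * (nSur p M (Fin k → Res p) : ℝ) else 0) =
      if M = ⊥ then (if G = K then 1 else 0) else 0 := by
    intro M
    have hbot : M = ⊥ ↔ rk p M = 0 := by
      constructor
      · rintro rfl
        have : Subsingleton ((⊥ : Submodule ℤ_[p] G.rep) →ₗ[ℤ_[p]] Res p) :=
          ⟨fun f g => LinearMap.ext fun x => by
            rw [Subsingleton.elim x 0, map_zero, map_zero]⟩
        exact Module.finrank_zero_of_subsingleton
      · intro h
        have := subsingleton_of_rk_eq_zero h
        exact Submodule.subsingleton_iff_eq_bot.1 this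
    by_cases hM : Nonempty ((G.rep ⧸ M) ≃ₗ[ℤ_[p]] K.rep)
    · simp_rw [if_pos hM]
      rw [sum_mob_nSur _ _ (rk_submodule_le _ M)]
      by_cases h0 : M = ⊥
      · rw [if_pos (hbot.1 h0), if_pos h0, if_pos]
        rw [X0.eq_iff]
        exact hM.map ((Submodule.quotEquivOfEqBot M h0).symm.trans ·)
      · rw [if_neg (mt hbot.2 h0), if_neg h0]
    · simp_rw [if_neg hM]
      rw [Finset.sum_const_zero]
      split_ifs with h0 hGK
      · exact absurd (((X0.eq_iff G K).1 hGK).map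
          ((Submodule.quotEquivOfEqBot M h0).trans ·)) hM
      · rfl
      · rfl
  simp_rw [h2]
  rw [Finset.sum_ite_eq' Finset.univ ⊥, if_pos (Finset.mem_univ _)]

theorem mob_pos : 0 < mob p k :=
  div_pos (pow_pos (zero_lt_one.trans one_lt_p) _) (gl_pos k)

-- The ratio of consecutive terms is `B / (p ^ (k + 1) - 1)`, so the Möbius coefficients beat any
-- geometric growth.
variable (p) in
theorem summable_mob_mul_pow (B : ℝ) (hB : 0 < B) : Summable fun k => mob p k * B ^ k := by
  have hp1 := one_lt_p (p := p)
  refine summable_of_ratio_test_tendsto_lt_one zero_lt_one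
    (Filter.Eventually.of_forall fun k => (mul_pos (mob_pos k) (pow_pos hB k)).ne') ?_
  have h1 : ∀ k, ‖mob p (k + 1) * B ^ (k + 1)‖ / ‖mob p k * B ^ k‖ =
      B / ((p : ℝ) ^ (k + 1) - 1) := by
    intro k
    have h2 : (0 : ℝ) < (p : ℝ) ^ (k + 1) - 1 := sub_pos.2 (one_lt_pow₀ hp1 k.succ_ne_zero)
    have h3 := (mob_pos (p := p) (k + 1)).ne'
    rw [Real.norm_of_nonneg (mul_pos (mob_pos _) (pow_pos hB _)).le,
      Real.norm_of_nonneg (mul_pos (mob_pos _) (pow_pos hB _)).le, mob_succ k, pow_succ B]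
    field_simp
  simp_rw [h1]
  refine Filter.Tendsto.div_atTop tendsto_const_nhds ?_
  refine Filter.tendsto_atTop_add_const_right _ _ ?_
  exact (tendsto_pow_atTop_atTop_of_one_lt hp1).comp (Filter.tendsto_add_atTop_nat 1)

/-- An eigenfunction all of whose moments vanish is zero. -/
theorem eq_zero_of_mom_eq_zero {ν : X0 p → ℝ} (hν : ν ∈ L2 p) {c : ℝ} (hc : c ≠ 0)
    (he : Delta0 ν = c • ν)
    (h : ∀ (F : Type) [AddCommGroup F] [Module ℤ_[p] F] [Finite F], mom F ν = 0) : ν = 0 := by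
  classical
  ext K
  obtain ⟨l, hl⟩ := exists_card_hom_le (p := p) _ K.rep rfl
  obtain ⟨A, B, hA, hB, hAB⟩ := exists_weighted_bound hν hc he l
  have hbound : ∀ k G, |ν G| * subSur K k G ≤
      |ν G| * ((p : ℝ) ^ rk p G.rep) ^ l * nSur p G.rep (Fin k → Res p) := by
    intro k G
    rw [mul_assoc]
    refine mul_le_mul_of_nonneg_left ?_ (abs_nonneg _)
    exact_mod_cast (subSur_le K k G).trans (Nat.mul_le_mul_right _ (hl G.rep))
  have hs : ∀ k, Summable fun G => |ν G| * (subSur K k G : ℝ) := fun k =>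
    Summable.of_nonneg_of_le (fun G => mul_nonneg (abs_nonneg _) (Nat.cast_nonneg _)) (hbound k)
      (hAB k).1
  have hle : ∀ k, ∑' G, |ν G| * (subSur K k G : ℝ) ≤ A * B ^ k := fun k =>
    ((hs k).tsum_le_tsum (hbound k) (hAB k).1).trans (hAB k).2
  -- Summing over `k` first gives `ν(K)` by Möbius inversion; summing over `G` first gives
  -- combinations of moments, which vanish. The eigenvalue equation serves only to justify the
  -- exchange.
  let f : ℕ → X0 p → ℝ := fun k G => ν G * ((-1) ^ k * mob p k * (subSur K k G : ℝ))
  have hf : ∀ k G, ‖f k G‖ = mob p k * (|ν G| * subSur K k G) := by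
    intro k G
    rw [norm_mul, norm_mul, norm_mul, norm_pow, norm_neg, norm_one, one_pow, one_mul,
      Real.norm_eq_abs, Real.norm_of_nonneg (mob_pos k).le, Real.norm_of_nonneg (Nat.cast_nonneg _)]
    ring
  have hsum : Summable (Function.uncurry f) := by
    refine Summable.of_norm ((summable_prod_of_nonneg fun x => norm_nonneg _).2 ⟨fun k => ?_, ?_⟩)
    · exact ((hs k).mul_left (mob p k)).congr fun G => (hf k G).symm
    · refine Summable.of_nonneg_of_le (fun k => tsum_nonneg fun G => norm_nonneg _) (fun k => ?_)
        ((summable_mob_mul_pow p B (zero_lt_one.trans_le hB)).mul_left A)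
      calc ∑' G, ‖f k G‖ = mob p k * ∑' G, |ν G| * (subSur K k G : ℝ) := by
            simp_rw [hf]
            rw [tsum_mul_left]
        _ ≤ mob p k * (A * B ^ k) := mul_le_mul_of_nonneg_left (hle k) (mob_pos k).le
        _ = _ := by ring
  calc ν K = ∑' G, ν G * (if G = K then 1 else 0) := by
        rw [tsum_eq_single K fun G hG => by rw [if_neg hG, mul_zero], if_pos rfl, mul_one]
    _ = ∑' G, ∑' k, f k G := tsum_congr fun G => by rw [← tsum_mob_subSur, ← tsum_mul_left]
    _ = ∑' k, ∑' G, f k G := hsum.tsum_comm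
    _ = ∑' k, (0 : ℝ) := tsum_congr fun k => by
        have h1 : ∀ G, f k G = (-1) ^ k * mob p k * (ν G * subSur K k G) := fun G => by
          simp only [f]
          ring
        simp_rw [h1]
        rw [tsum_mul_left, tsum_mul_subSur K k hν h, mul_zero]
    _ = 0 := tsum_zero

end

/-! ## The square-summable eigenfunctions -/

section

variable {p : ℕ} [Fact p.Prime]

variable (p) in
/-- The square-summable measures with `Δ₀ ν = c ν`. -/
def eigen (c : ℝ) : Submodule ℝ (X0 p → ℝ) where
  carrier := {ν | ν ∈ L2 p ∧ Delta0 ν = c • ν}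
  zero_mem' := ⟨(L2 p).zero_mem, by
    have := Delta0_smul 0 (0 : X0 p → ℝ)
    rw [zero_smul, zero_smul] at this
    rw [this, smul_zero]⟩
  add_mem' {a b} ha hb := ⟨(L2 p).add_mem ha.1 hb.1, by
    rw [Delta0_add (L2.summable ha.1) (L2.summable hb.1), ha.2, hb.2, smul_add]⟩
  smul_mem' r a ha := ⟨(L2 p).smul_mem r ha.1, by rw [Delta0_smul, ha.2, smul_comm]⟩

/-- The moments of an eigenfunction are determined by the moments for the groups of one order. -/
theorem mom_eq_zero_of_eigen {ν : X0 p → ℝ} {c : ℝ} (hν : ν ∈ eigen p c)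
    (h : ∀ F : X0 p, 1 / (Nat.card F.rep : ℝ) = c → mom F.rep ν = 0) (n : ℕ) :
    ∀ (F : Type) [AddCommGroup F] [Module ℤ_[p] F] [Finite F], Nat.card F = n → mom F ν = 0 := by
  classical
  induction n using Nat.strong_induction_on with
  | _ n ih =>
    intro F _ _ _ hn
    by_cases hc : 1 / (Nat.card F : ℝ) = c
    · rw [← mom_congr (X0.rep_of (p := p) F).some]
      exact h _ (by rwa [X0.card_of])
    · have : Fintype F := Fintype.ofFinite F
      have h1 := (mom_Delta0 hν.1 F).2
      have h2 : mom F (c • ν) = c * mom F ν := by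
        rw [mom, mom, ← tsum_mul_left]
        exact tsum_congr fun G => by rw [Pi.smul_apply, smul_eq_mul, mul_assoc]
      -- The moments of the proper quotients vanish by induction, leaving `(c - 1 / #F) mom F ν =
      -- 0`.
      rw [hν.2, h2, ← Finset.add_sum_erase _ _ (Finset.mem_univ 0),
        mom_congr (Submodule.quotEquivOfEqBot _ (Submodule.span_zero_singleton _)),
        Finset.sum_eq_zero fun x hx => ih _
          (hn ▸ card_quotient_span_lt (Finset.ne_of_mem_erase hx)) _ rfl, add_zero, ← one_div,
        ← sub_eq_zero, ← sub_mul] at h1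
      exact (mul_eq_zero.1 h1).resolve_left (sub_ne_zero.2 (Ne.symm hc))

/-- Every square-summable eigenfunction with an eigenvalue that is not zero is a linear combination
of leading eigenfunctions. -/
theorem eigen_le_span {E : X0 p → X0 p → ℝ} (hE : ∀ F, IsLeadingEigenfunction F (E F)) {c : ℝ}
    (hc : c ≠ 0) : eigen p c ≤ Submodule.span ℝ (Set.range E) := by
  let I : Set (X0 p) := {F | 1 / (Nat.card F.rep : ℝ) = c}
  have hcard : ∀ F ∈ I, ∀ F' ∈ I, Nat.card F.rep = Nat.card F'.rep := by
    intro F hF F' hF'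
    have h1 : 1 / (Nat.card F.rep : ℝ) = 1 / (Nat.card F'.rep : ℝ) := hF.trans hF'.symm
    rw [one_div, one_div, inv_inj] at h1
    exact_mod_cast h1
  have hI : Finite I := by
    rcases I.eq_empty_or_nonempty with h | ⟨F, hF⟩
    · rw [h]
      infer_instance
    · exact ((finite_card_eq p (Nat.card F.rep)).subset fun F' hF' => hcard F' hF' F hF).to_subtype
  have : Fintype I := Fintype.ofFinite I
  -- The moments for the groups of order `1 / c` embed the eigenspace in `I → ℝ`, bounding its
  -- dimension by the number of these groups.
  let Φ : eigen p c →ₗ[ℝ] (I → ℝ) :=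
    { toFun := fun ν F => mom F.1.rep ν.1
      map_add' := fun ν ν' => by
        ext F
        rw [Pi.add_apply, mom, mom, mom, ← (L2.summable_mul ν.2.1 _).tsum_add
          (L2.summable_mul ν'.2.1 _)]
        exact tsum_congr fun G => by rw [Submodule.coe_add, Pi.add_apply, add_mul]
      map_smul' := fun r ν => by
        ext F
        rw [Pi.smul_apply, RingHom.id_apply, smul_eq_mul, mom, mom, ← tsum_mul_left]
        exact tsum_congr fun G => by
          rw [Submodule.coe_smul, Pi.smul_apply, smul_eq_mul, mul_assoc] }
  have hΦ : Function.Injective Φ := by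
    rw [← LinearMap.ker_eq_bot, LinearMap.ker_eq_bot']
    intro ν hν
    refine Subtype.ext (eq_zero_of_mom_eq_zero ν.2.1 hc ν.2.2 fun F _ _ _ => ?_)
    exact mom_eq_zero_of_eigen ν.2 (fun F hF => congrFun hν ⟨F, hF⟩) _ F rfl
  have hfin : Module.Finite ℝ (eigen p c) := Module.Finite.of_injective Φ hΦ
  let e : I → eigen p c := fun F => ⟨E F, leading_mem_L2 (hE F).2, by
    rw [(hE F).1.2, F.2]⟩
  have he : LinearIndependent ℝ e := by
    rw [Fintype.linearIndependent_iff]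
    intro g hg
    have h1 : ∑ F : I, g F • E F = 0 := by
      have := congrArg Subtype.val hg
      rwa [Submodule.coe_sum] at this
    have h2 : ∑ F : I, g F • moment F.1 = -∑ F : I, g F • (E F - moment F.1) := by
      rw [eq_neg_iff_add_eq_zero, ← Finset.sum_add_distrib, ← h1]
      exact Finset.sum_congr rfl fun F _ => by rw [← smul_add, add_sub_cancel]
    have h3 : ∑ F : I, g F • moment F.1 ∈ Submodule.span ℝ (moment '' I) :=
      Submodule.sum_mem _ fun F _ => Submodule.smul_mem _ _ (Submodule.subset_span ⟨F, F.2, rfl⟩)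
    -- The corrections in the leading eigenfunctions involve only groups of smaller order, outside
    -- `I`, so a relation among these eigenfunctions forces one among their leading moment measures.
    have h4 : ∑ F : I, g F • moment F.1 ∈ Submodule.span ℝ (moment '' Iᶜ) := by
      rw [h2]
      refine Submodule.neg_mem _ (Submodule.sum_mem _ fun F _ => Submodule.smul_mem _ _ ?_)
      refine Submodule.span_mono (Set.image_mono fun F' hF' hI' => ?_) (hE F).2
      exact (Below.card_lt hF').ne (hcard F' hI' F F.2)
    have h5 := Submodule.disjoint_def.1
      (linearIndependent_moment.disjoint_span_image disjoint_compl_right) _ h3 h4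
    exact Fintype.linearIndependent_iff.1
      (linearIndependent_moment.comp (Subtype.val : I → X0 p) Subtype.val_injective) g h5
  have hdim : Fintype.card I = Module.finrank ℝ (eigen p c) := by
    refine le_antisymm he.fintype_card_le_finrank ?_
    have := LinearMap.finrank_le_finrank_of_injective hΦ
    rwa [Module.finrank_fintype_fun_eq_card] at this
  have hspan := he.span_eq_top_of_card_eq_finrank' hdim
  intro ν hν
  have h1 : (⟨ν, hν⟩ : eigen p c) ∈ Submodule.span ℝ (Set.range e) := hspan ▸ Submodule.mem_top
  have h2 := Submodule.mem_map_of_mem (f := (eigen p c).subtype) h1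
  rw [Submodule.map_span, ← Set.range_comp] at h2
  refine Submodule.span_mono ?_ h2
  rintro _ ⟨F, rfl⟩
  exact ⟨F, rfl⟩

end

end CohenLenstra

end

theorem mainTheorem8 (p : ℕ) [Fact p.Prime] :
    ∃ E : CohenLenstra.X0 p → (CohenLenstra.X0 p → ℝ),
      (∀ (F : CohenLenstra.X0 p) (ε : CohenLenstra.X0 p → ℝ),
        CohenLenstra.IsLeadingEigenfunction F ε ↔ ε = E F) ∧
      ∀ (ν : CohenLenstra.X0 p → ℝ) (c : ℝ),
        CohenLenstra.SquareSummable ν → CohenLenstra.IsEigenfunction ν c →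
          CohenLenstra.Delta0 ν = 0 ∨ ν ∈ Submodule.span ℝ (Set.range E) := by
  choose E hE using fun F : CohenLenstra.X0 p => CohenLenstra.exists_leading F
  have hE' : ∀ F, CohenLenstra.IsLeadingEigenfunction F (E F) := fun F =>
    ⟨⟨CohenLenstra.leading_ne_zero (hE F).2, (hE F).1⟩, (hE F).2⟩
  refine ⟨E, fun F ε => ⟨fun h => CohenLenstra.leading_unique h (hE' F), fun h => h ▸ hE' F⟩,
    fun ν c hν h => ?_⟩
  rcases eq_or_ne c 0 with rfl | hc
  · exact Or.inl (by rw [h.2, zero_smul])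
  · exact Or.inr (CohenLenstra.eigen_le_span hE' hc ⟨hν, h.2⟩)
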